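/- Let $G$ be a finite group. A $G$-fibration is a continuous $G$-map $p:E\to B$ of $G$-spaces having the $G$-equivariant homotopy lifting property with respect to every $G$-space $X$. For $b\in B$ let $G_b$ be its isotropy group; it acts on the fiber $F_b=p^{-1}(b)$. Let $\mathrm{Iso}(B)=\{G_b : b\in B\}$, and let $\{F_H\}_{H\in \mathrm{Iso}(B)}$ be a family consisting of an $H$-space $F_H$ for each $H\in\mathrm{Iso}(B)$. One says that $p$ has fiber type $\{F_H\}$ if for every $b\in B$ the fiber $F_b$ is $G_b$-homotopy equivalent to $F_{G_b}$. **Proposition.** Let $B$ be a finite $G$-CW-complex and let $p:E\to B$ be a $G$-fibration with fiber type $\{F_H\}$. If $F_H$ is $H$-homotopy equivalent to a finite $H$-CW-complex for every $H\in\mathrm{Iso}(B)$, then $E$ is $G$-homotopy equivalent to a finite $G$-CW-complex. -/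

import Mathlib

/-!
# Equivariant homotopy theory for a discrete group

A `G`-space is a topological space `X` with `[MulAction G X] [ContinuousConstSMul G X]`, which for
a discrete (in particular, finite) group `G` is the same as a continuous action `G × X → X`.
-/

universe u

section GMaps

variable (G : Type u) [Group G]

/-- The map `f` commutes with the actions of `G`. -/
def IsGMap {X Y : Type u} [TopologicalSpace X] [TopologicalSpace Y] [MulAction G X] [MulAction G Y]
    (f : C(X, Y)) : Prop :=
  ∀ (g : G) (x : X), f (g • x) = g • f x

/-- `f₀` and `f₁` are `G`-homotopic: there is a homotopy from `f₀` to `f₁` through `G`-maps. -/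
def GHomotopic {X Y : Type u} [TopologicalSpace X] [TopologicalSpace Y] [MulAction G X]
    [MulAction G Y] (f₀ f₁ : C(X, Y)) : Prop :=
  ContinuousMap.HomotopicWith f₀ f₁ (IsGMap G)

/-- `X` and `Y` are `G`-homotopy equivalent. -/
def GHomotopyEquivalent (X Y : Type u) [TopologicalSpace X] [TopologicalSpace Y] [MulAction G X]
    [MulAction G Y] : Prop :=
  ∃ (f : C(X, Y)) (k : C(Y, X)), IsGMap G f ∧ IsGMap G k ∧
    GHomotopic G (k.comp f) (ContinuousMap.id X) ∧ GHomotopic G (f.comp k) (ContinuousMap.id Y)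

end GMaps

section GCW

/-- The closed unit disk `Dⁿ` in Euclidean `n`-space. Its boundary sphere `Sⁿ⁻¹` is the set of
points of norm `1` (empty for `n = 0`), its interior the set of points of norm `< 1`. -/
abbrev EuclideanDisk (n : ℕ) : Type := Metric.closedBall (0 : EuclideanSpace ℝ (Fin n)) 1

/-- A `G`-CW-structure on a `G`-space `X`, for a discrete group `G`: a filtration
`∅ = X₋₁ ⊆ X₀ ⊆ X₁ ⊆ ⋯` of `X` (here `skeletonLT n` is `Xₙ₋₁`), such that `X` is the union of the
`Xₙ` with the colimit topology and such that `Xₙ` arises from `Xₙ₋₁` through a pushout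
```
  ∐ᵢ G/Hᵢ × Sⁿ⁻¹ ---> Xₙ₋₁
        |              |
        v              v
  ∐ᵢ G/Hᵢ × Dⁿ   ---> Xₙ
```
of `G`-spaces. The pushout property is spelled out: on points, the open cells `G/Hᵢ × int Dⁿ`
are mapped bijectively onto `Xₙ \ Xₙ₋₁`, and `Xₙ` has the quotient topology from
`Xₙ₋₁ ⊔ ∐ᵢ G/Hᵢ × Dⁿ`. Since `G/Hᵢ` is discrete, a continuous map on `G/Hᵢ × Dⁿ` is given as a
family of continuous maps on `Dⁿ` indexed by `G/Hᵢ`. -/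
structure GCWComplex (G : Type u) [Group G] (X : Type u) [TopologicalSpace X] [MulAction G X] where
  /-- The index set of the equivariant `n`-cells. -/
  cell : ℕ → Type u
  /-- The isotropy group `Hᵢ` of an equivariant cell. -/
  stab : (n : ℕ) → cell n → Subgroup G
  /-- The characteristic map `G/Hᵢ × Dⁿ → X` of an equivariant cell. -/
  map : (n : ℕ) → (i : cell n) → G ⧸ stab n i → C(EuclideanDisk n, X)
  /-- The characteristic maps are `G`-maps. -/
  map_smul : ∀ (n : ℕ) (i : cell n) (g : G) (c : G ⧸ stab n i) (d : EuclideanDisk n),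
    map n i (g • c) d = g • map n i c d
  /-- The `(n - 1)`-skeleton `Xₙ₋₁`. -/
  skeletonLT : ℕ → Set X
  skeletonLT_zero : skeletonLT 0 = ∅
  skeletonLT_succ : ∀ n : ℕ, skeletonLT (n + 1) =
    skeletonLT n ∪ ⋃ (i : cell n) (c : G ⧸ stab n i), Set.range (map n i c)
  /-- The boundary of an `n`-cell is mapped to the `(n - 1)`-skeleton. -/
  map_boundary : ∀ (n : ℕ) (i : cell n) (c : G ⧸ stab n i) (d : EuclideanDisk n),
    ‖(d : EuclideanSpace ℝ (Fin n))‖ = 1 → map n i c d ∈ skeletonLT n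
  /-- The open `n`-cells are disjoint from the `(n - 1)`-skeleton. -/
  map_interior : ∀ (n : ℕ) (i : cell n) (c : G ⧸ stab n i) (d : EuclideanDisk n),
    ‖(d : EuclideanSpace ℝ (Fin n))‖ < 1 → map n i c d ∉ skeletonLT n
  /-- The characteristic maps are jointly injective on the open `n`-cells. -/
  map_injective : ∀ (n : ℕ) (y z : Σ i : cell n, (G ⧸ stab n i) × EuclideanDisk n),
    ‖(y.2.2 : EuclideanSpace ℝ (Fin n))‖ < 1 → ‖(z.2.2 : EuclideanSpace ℝ (Fin n))‖ < 1 →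
      map n y.1 y.2.1 y.2.2 = map n z.1 z.2.1 z.2.2 → y = z
  /-- The `n`-skeleton has the quotient topology from the `(n - 1)`-skeleton and the `n`-cells. -/
  isClosed_skeletonLT_succ : ∀ (n : ℕ) (A : Set X),
    IsClosed ((↑) ⁻¹' A : Set (skeletonLT n)) →
    (∀ (i : cell n) (c : G ⧸ stab n i), IsClosed (map n i c ⁻¹' A)) →
      IsClosed ((↑) ⁻¹' A : Set (skeletonLT (n + 1)))
  iUnion_skeletonLT : ⋃ n : ℕ, skeletonLT n = Set.univ
  /-- `X` has the colimit topology of its skeleta. -/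
  isClosed_of_skeletonLT : ∀ A : Set X,
    (∀ n : ℕ, IsClosed ((↑) ⁻¹' A : Set (skeletonLT n))) → IsClosed A

/-- A `G`-CW-complex is finite if it has only finitely many equivariant cells. -/
def GCWComplex.IsFinite {G : Type u} [Group G] {X : Type u} [TopologicalSpace X] [MulAction G X]
    (K : GCWComplex G X) : Prop :=
  Finite (Σ n : ℕ, K.cell n)

/-- The `G`-space `X` is a finite `G`-CW-complex (for some choice of the cell structure). -/
def IsFiniteGCWComplex (G : Type u) [Group G] (X : Type u) [TopologicalSpace X] [MulAction G X] :
    Prop :=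
  ∃ K : GCWComplex G X, K.IsFinite

/-- The `G`-space `X` is `G`-homotopy equivalent to some finite `G`-CW-complex. -/
def GHomotopyEquivalentToFiniteGCWComplex (G : Type u) [Group G] (X : Type u) [TopologicalSpace X]
    [MulAction G X] : Prop :=
  ∃ (Y : Type u) (_ : TopologicalSpace Y) (_ : MulAction G Y) (_ : ContinuousConstSMul G Y),
    IsFiniteGCWComplex G Y ∧ GHomotopyEquivalent G X Y

end GCW

section GFibrations

variable {G : Type u} [Group G] {E B : Type u} [TopologicalSpace E] [TopologicalSpace B]
  [MulAction G E] [MulAction G B]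

/-- A `G`-fibration: a (continuous) `G`-map with the homotopy lifting property for all
`G`-spaces. -/
structure IsGFibration (p : E →[G] B) : Prop where
  continuous : Continuous p
  homotopy_lifting : ∀ (X : Type u) [TopologicalSpace X] [MulAction G X] [ContinuousConstSMul G X]
    (h : C(X, E)) (H : C(X × unitInterval, B)),
    (∀ (g : G) (x : X), h (g • x) = g • h x) →
    (∀ (g : G) (x : X) (t : unitInterval), H (g • x, t) = g • H (x, t)) →
    (∀ x : X, H (x, 0) = p (h x)) →
    ∃ H' : C(X × unitInterval, E),
      (∀ (g : G) (x : X) (t : unitInterval), H' (g • x, t) = g • H' (x, t)) ∧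
      (∀ x : X, H' (x, 0) = h x) ∧
      (∀ (x : X) (t : unitInterval), p (H' (x, t)) = H (x, t))

/-- The fiber `F_b = p⁻¹(b)`, as a space with an action of the isotropy group `G_b`. -/
def gFiber (p : E →[G] B) (b : B) : SubMulAction (MulAction.stabilizer G b) E where
  carrier := p ⁻¹' {b}
  smul_mem' := by
    rintro ⟨g, hg⟩ e he
    have he' : p e = b := he
    have hg' : g • b = b := hg
    change p (g • e) = b
    rw [map_smul, he', hg']

variable (G B) in
/-- The set `Iso(B)` of the isotropy subgroups of the `G`-action on `B`. -/
def isotropySubgroups : Set (Subgroup G) :=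
  Set.range fun b : B => MulAction.stabilizer G b

/-- The isotropy group `G_b` of `b`, as an element of `Iso(B)`. -/
abbrev isotropyAt (G : Type u) [Group G] {B : Type u} [MulAction G B] (b : B) :
    isotropySubgroups G B :=
  ⟨MulAction.stabilizer G b, b, rfl⟩

/-- The map `p` has fiber type `{F_H}`: for every `b`, the fiber `F_b` is `G_b`-homotopy
equivalent to `F_{G_b}`. -/
def HasFiberType (p : E →[G] B) (F : isotropySubgroups G B → Type u)
    [∀ H, TopologicalSpace (F H)] [∀ H : isotropySubgroups G B, MulAction H.1 (F H)] : Prop :=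
  ∀ b : B, GHomotopyEquivalent (isotropyAt G b).1 (gFiber p b) (F (isotropyAt G b))

end GFibrations

open Set Topology unitInterval

set_option linter.unusedSectionVars false

/-! Call a `G`-space cellular if it arises from the empty space by finitely many attachments of
equivariant cells `G/H × Dⁿ`, with `G`-homotopy equivalences allowed in between (`IsCellular`).
Attaching maps need not be cellular, so this class is easy to enter. It is also easy to leave: by
`IsCellular.exists_equivalent` a cellular space is equivalent to a finite complex, since the
attaching map of an `n`-cell can be deformed into the `(n - 1)`-skeleton. Equivariantly this costs
nothing new: the coordinate on an orbit of cells is invariant, so only a map from a single sphere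
has to be moved off the origin.

The class is closed under attaching `T × Dⁿ` for any cellular `T`, not just an orbit
(`IsCellular.of_isAttachment`), because a cell `T₀ × Dᵐ` of `T` contributes a cell `T₀ × Dᵐ⁺ⁿ`.

The total space is now built along the cells of `B`. Let `A'` arise from `A` by attaching one orbit
of `n`-cells. Where the radius is at least `1/3`, homotopy lifting deforms the total space to the
part over `A` (`IsAttachment.isEquiv_incl_shell`). Where it is at most `2/3`, lifts of straight-line
motions identify the total space with `O × Dⁿ`, where `O` lies over the orbit of centers, and
identify the overlap of the two parts with `O × Sⁿ⁻¹` (`DiskTransport`). So the total space over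
`A'` is that over `A` with `O × Dⁿ` attached (`IsAttachment.isCellular_total`). Finally `O` is
induced from the fiber over one center `b`, a cellular `G_b`-space, and induction preserves
cellularity (`equivalent_centerShell`, `IsCellular.ind`).

Gluing up to homotopy goes through double mapping cylinders, which are invariant under equivalence
of all their data (`DoubleCyl.equivalent_of_isEquiv`) and which, for the inclusion of `T × Sⁿ⁻¹` in
`T × Dⁿ`, are genuine attachments (`DoubleCyl.isAttachment_attach`). -/

/-- A `G`-map between `G`-spaces. -/
structure GHom (G : Type u) [Group G] (X Y : Type u) [TopologicalSpace X] [TopologicalSpace Y]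
    [MulAction G X] [MulAction G Y] extends C(X, Y) where
  map_smul' : ∀ (g : G) (x : X), toFun (g • x) = g • toFun x

/-- `G` acts on a product with a space without action through the first factor. -/
instance prodTrivialAction (G : Type u) [Group G] (T : Type*) (D : Type*) [MulAction G T] :
    MulAction G (T × D) where
  smul g x := (g • x.1, x.2)
  one_smul x := Prod.ext (one_smul G x.1) rfl
  mul_smul g h x := Prod.ext (mul_smul g h x.1) rfl

section Prod

variable {G : Type u} [Group G] {T D : Type*} [MulAction G T]

@[simp] lemma smul_mk_trivial (g : G) (t : T) (d : D) : g • ((t, d) : T × D) = (g • t, d) := rfl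
@[simp] lemma smul_fst_trivial (g : G) (x : T × D) : (g • x).1 = g • x.1 := rfl
@[simp] lemma smul_snd_trivial (g : G) (x : T × D) : (g • x).2 = x.2 := rfl

instance [TopologicalSpace T] [TopologicalSpace D] [ContinuousConstSMul G T] :
    ContinuousConstSMul G (T × D) where
  continuous_const_smul g := (continuous_fst.const_smul g).prodMk continuous_snd

end Prod

/-! ### Equivariant maps, homotopies and homotopy equivalences -/

namespace GHom

variable {G : Type u} [Group G] {X Y Z W : Type u} [TopologicalSpace X] [TopologicalSpace Y]
  [TopologicalSpace Z] [TopologicalSpace W] [MulAction G X] [MulAction G Y] [MulAction G Z]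
  [MulAction G W]

instance : FunLike (GHom G X Y) X Y where
  coe f := f.toFun
  coe_injective f g h := by
    rcases f with ⟨⟨f, _⟩, _⟩; rcases g with ⟨⟨g, _⟩, _⟩; congr

instance : ContinuousMapClass (GHom G X Y) X Y where
  map_continuous f := f.continuous_toFun

@[ext] lemma ext {f g : GHom G X Y} (h : ∀ x, f x = g x) : f = g := DFunLike.ext _ _ h

@[fun_prop] protected lemma continuous (f : GHom G X Y) : Continuous f := f.continuous_toFun

@[simp] lemma map_smul (f : GHom G X Y) (g : G) (x : X) : f (g • x) = g • f x := f.map_smul' g x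

/-- A `G`-map from a continuous equivariant function. -/
def of (f : X → Y) (hf : Continuous f) (h : ∀ (g : G) x, f (g • x) = g • f x) : GHom G X Y :=
  ⟨⟨f, hf⟩, h⟩

@[simp] lemma of_apply (f : X → Y) (hf : Continuous f) (h : ∀ (g : G) x, f (g • x) = g • f x)
    (x : X) : of f hf h x = f x := rfl

variable (G X) in
/-- The identity. -/
def id : GHom G X X := of (fun x => x) continuous_id fun _ _ => rfl

@[simp] lemma id_apply (x : X) : id G X x = x := rfl

/-- Composition. -/
def comp (k : GHom G Y Z) (f : GHom G X Y) : GHom G X Z :=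
  of (fun x => k (f x)) (k.continuous.comp f.continuous) (by simp)

@[simp] lemma comp_apply (k : GHom G Y Z) (f : GHom G X Y) (x : X) : k.comp f x = k (f x) := rfl

/-- Product of a `G`-map with a map of spaces without action. -/
def prodMap {D D' : Type} [TopologicalSpace D] [TopologicalSpace D'] (f : GHom G X Y)
    (k : C(D, D')) : GHom G (X × D) (Y × D') :=
  of (fun x => (f x.1, k x.2)) (by fun_prop) (by simp)

@[simp] lemma prodMap_apply {D D' : Type} [TopologicalSpace D] [TopologicalSpace D']
    (f : GHom G X Y) (k : C(D, D')) (x : X × D) : f.prodMap k x = (f x.1, k x.2) := rfl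

/-- Curry a `G`-map. -/
def curry [ContinuousConstSMul G Y] {D : Type} [TopologicalSpace D] (H : GHom G (X × D) Y) :
    GHom G X C(D, Y) :=
  of (fun x => H.toContinuousMap.curry x) (map_continuous _) (by
    intro g x; ext d; exact H.map_smul g (x, d))

@[simp] lemma curry_apply [ContinuousConstSMul G Y] {D : Type} [TopologicalSpace D]
    (H : GHom G (X × D) Y) (x : X) (d : D) : H.curry x d = H (x, d) := rfl

/-- Uncurry a `G`-map. -/
def uncurry [ContinuousConstSMul G Y] {D : Type} [TopologicalSpace D] [LocallyCompactSpace D]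
    (H : GHom G X C(D, Y)) : GHom G (X × D) Y :=
  of (fun x => H x.1 x.2) (by fun_prop) (by simp)

@[simp] lemma uncurry_apply [ContinuousConstSMul G Y] {D : Type} [TopologicalSpace D]
    [LocallyCompactSpace D] (H : GHom G X C(D, Y)) (x : X × D) : H.uncurry x = H x.1 x.2 := rfl

/-- `G`-homotopy of `G`-maps, given by a `G`-map into the path space. -/
def Homotopic [ContinuousConstSMul G Y] (f k : GHom G X Y) : Prop :=
  ∃ H : GHom G X C(I, Y), (∀ x, H x 0 = f x) ∧ ∀ x, H x 1 = k x

/-- Both forms correspond by currying. The form with values in the path space is convenient for maps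
out of a quotient: a homotopy is again a map out of the quotient, and its product with `I` need not
be examined. The other form supplies symmetry and transitivity. -/
lemma homotopic_iff [ContinuousConstSMul G Y] (f k : GHom G X Y) :
    Homotopic f k ↔ GHomotopic G f.toContinuousMap k.toContinuousMap := by
  constructor
  · rintro ⟨H, h0, h1⟩
    refine ⟨⟨⟨⟨fun x => H.uncurry (x.2, x.1), by fun_prop⟩, h0, h1⟩, ?_⟩⟩
    intro t g x
    exact H.uncurry.map_smul g (x, t)
  · rintro ⟨H⟩
    refine ⟨(of (fun x : X × I => H (x.2, x.1)) (by fun_prop) ?_).curry, ?_, ?_⟩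
    · intro g x
      exact H.prop' x.2 g x.1
    · intro x; exact H.apply_zero x
    · intro x; exact H.apply_one x

namespace Homotopic

variable [ContinuousConstSMul G X] [ContinuousConstSMul G Y] [ContinuousConstSMul G Z]
  [ContinuousConstSMul G W]

lemma of_uncurried {f k : GHom G X Y} (H : GHom G (X × I) Y) (h0 : ∀ x, H (x, 0) = f x)
    (h1 : ∀ x, H (x, 1) = k x) : Homotopic f k := ⟨H.curry, h0, h1⟩

@[refl] lemma refl (f : GHom G X Y) : Homotopic f f :=
  of_uncurried (of (fun x => f x.1) (by fun_prop) (by simp)) (by simp) (by simp)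

lemma of_eq {f k : GHom G X Y} (h : ∀ x, f x = k x) : Homotopic f k := by
  rw [GHom.ext h]

@[symm] lemma symm {f k : GHom G X Y} (h : Homotopic f k) : Homotopic k f := by
  rw [homotopic_iff] at *
  exact ContinuousMap.HomotopicWith.symm h

@[trans] lemma trans {f k l : GHom G X Y} (h : Homotopic f k) (h' : Homotopic k l) :
    Homotopic f l := by
  rw [homotopic_iff] at *
  exact ContinuousMap.HomotopicWith.trans h h'

lemma comp_left {f k : GHom G X Y} (l : GHom G Y Z) (h : Homotopic f k) :
    Homotopic (l.comp f) (l.comp k) := by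
  obtain ⟨H, h0, h1⟩ := h
  exact of_uncurried (l.comp H.uncurry) (by simp [h0]) (by simp [h1])

lemma comp_right {f k : GHom G Y Z} (h : Homotopic f k) (l : GHom G X Y) :
    Homotopic (f.comp l) (k.comp l) := by
  obtain ⟨H, h0, h1⟩ := h
  exact ⟨H.comp l, by simp [h0], by simp [h1]⟩

end Homotopic

/-- A `G`-map is a `G`-homotopy equivalence. -/
def IsEquiv [ContinuousConstSMul G X] [ContinuousConstSMul G Y] (f : GHom G X Y) : Prop :=
  ∃ k : GHom G Y X, Homotopic (k.comp f) (GHom.id G X) ∧ Homotopic (f.comp k) (GHom.id G Y)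

variable [ContinuousConstSMul G X] [ContinuousConstSMul G Y] [ContinuousConstSMul G Z]
  [ContinuousConstSMul G W]

lemma gHomotopyEquivalent_iff :
    GHomotopyEquivalent G X Y ↔ ∃ f : GHom G X Y, f.IsEquiv := by
  constructor
  · rintro ⟨f, k, hf, hk, h1, h2⟩
    refine ⟨⟨f, hf⟩, ⟨k, hk⟩, ?_, ?_⟩
    · rw [homotopic_iff]; exact h1
    · rw [homotopic_iff]; exact h2
  · rintro ⟨f, k, h1, h2⟩
    rw [homotopic_iff] at h1 h2
    exact ⟨f.toContinuousMap, k.toContinuousMap, f.map_smul, k.map_smul, h1, h2⟩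

namespace IsEquiv

lemma of_strict {f : GHom G X Y} (k : GHom G Y X) (h1 : ∀ x, k (f x) = x)
    (h2 : ∀ y, f (k y) = y) : f.IsEquiv :=
  ⟨k, .of_eq h1, .of_eq h2⟩

variable (G X) in
lemma id : (GHom.id G X).IsEquiv := of_strict (GHom.id G X) (fun _ => rfl) fun _ => rfl

lemma exists_inverse {f : GHom G X Y} (h : f.IsEquiv) : ∃ k : GHom G Y X, k.IsEquiv ∧
    Homotopic (k.comp f) (GHom.id G X) ∧ Homotopic (f.comp k) (GHom.id G Y) := by
  obtain ⟨k, h1, h2⟩ := h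
  exact ⟨k, ⟨f, h2, h1⟩, h1, h2⟩

lemma of_homotopic {f k : GHom G X Y} (h : f.IsEquiv) (hk : Homotopic f k) : k.IsEquiv := by
  obtain ⟨l, h1, h2⟩ := h
  exact ⟨l, (hk.symm.comp_left l).trans h1, (hk.symm.comp_right l).trans h2⟩

/-- A map with a left and a right inverse up to homotopy. -/
lemma of_left_right {f : GHom G X Y} {l r : GHom G Y X} (hl : Homotopic (l.comp f) (GHom.id G X))
    (hr : Homotopic (f.comp r) (GHom.id G Y)) : f.IsEquiv := by
  have h : Homotopic l r := (hr.symm.comp_left l).trans (hl.comp_right r)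
  exact ⟨l, hl, (h.comp_left f).trans hr⟩

lemma comp {k : GHom G Y Z} {f : GHom G X Y} (hk : k.IsEquiv) (hf : f.IsEquiv) :
    (k.comp f).IsEquiv := by
  obtain ⟨k', a1, a2⟩ := hk
  obtain ⟨f', b1, b2⟩ := hf
  refine ⟨f'.comp k', ?_, ?_⟩
  · exact ((a1.comp_right f).comp_left f').trans b1
  · exact ((b2.comp_right k').comp_left k).trans a2

lemma of_comp_left {k : GHom G Y Z} {f : GHom G X Y} (hk : k.IsEquiv)
    (h : (k.comp f).IsEquiv) : f.IsEquiv := by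
  obtain ⟨k', hk', a1, a2⟩ := hk.exists_inverse
  exact (hk'.comp h).of_homotopic (a1.comp_right f)

lemma of_comp_right {k : GHom G Y Z} {f : GHom G X Y} (hf : f.IsEquiv)
    (h : (k.comp f).IsEquiv) : k.IsEquiv := by
  obtain ⟨f', hf', a1, a2⟩ := hf.exists_inverse
  exact (h.comp hf').of_homotopic (a2.comp_left k)

/-- The two-out-of-six property. -/
lemma two_of_six {l : GHom G Z W} {k : GHom G Y Z} {f : GHom G X Y} (h1 : (k.comp f).IsEquiv)
    (h2 : (l.comp k).IsEquiv) : f.IsEquiv := by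
  obtain ⟨a, _, ha⟩ := h1
  obtain ⟨b, hb, _⟩ := h2
  -- The middle map has a left and a right inverse up to homotopy, one from each composite.
  have hk : k.IsEquiv := of_left_right (l := b.comp l) (r := f.comp a) hb ha
  exact of_comp_left hk ⟨a, ‹_›, ha⟩

lemma of_bijective_isClosedMap (f : GHom G X Y) (hb : Function.Bijective f) (hc : IsClosedMap f) :
    f.IsEquiv := by
  let e := (Equiv.ofBijective f hb).toHomeomorphOfContinuousClosed f.continuous hc
  have he : ∀ x, e x = f x := fun _ => rfl
  refine of_strict (of e.symm e.symm.continuous ?_) (fun x => e.symm_apply_apply x)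
    fun y => e.apply_symm_apply y
  intro g y
  rw [e.symm_apply_eq, he, f.map_smul, ← he, e.apply_symm_apply]

end IsEquiv

end GHom

/-- `G`-homotopy equivalence of `G`-spaces, with the bundled notion of `G`-map. -/
def GEquivalent (G : Type u) [Group G] (X Y : Type u) [TopologicalSpace X] [TopologicalSpace Y]
    [MulAction G X] [MulAction G Y] [ContinuousConstSMul G X] [ContinuousConstSMul G Y] : Prop :=
  ∃ f : GHom G X Y, f.IsEquiv

namespace GEquivalent

variable {G : Type u} [Group G] {X Y Z : Type u} [TopologicalSpace X] [TopologicalSpace Y]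
  [TopologicalSpace Z] [MulAction G X] [MulAction G Y] [MulAction G Z] [ContinuousConstSMul G X]
  [ContinuousConstSMul G Y] [ContinuousConstSMul G Z]

lemma symm (h : GEquivalent G X Y) : GEquivalent G Y X := by
  obtain ⟨f, h⟩ := h
  obtain ⟨k, hk, _⟩ := h.exists_inverse
  exact ⟨k, hk⟩

lemma trans (h : GEquivalent G X Y) (h' : GEquivalent G Y Z) : GEquivalent G X Z := by
  obtain ⟨f, h⟩ := h
  obtain ⟨k, hk⟩ := h'
  exact ⟨k.comp f, hk.comp h⟩

lemma iff_gHomotopyEquivalent : GEquivalent G X Y ↔ GHomotopyEquivalent G X Y :=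
  GHom.gHomotopyEquivalent_iff.symm

end GEquivalent

/-! ### Double mapping cylinders -/

section DoubleMappingCylinder

variable {G : Type u} [Group G] {C N P C' N' P' Z : Type u} [TopologicalSpace C]
  [TopologicalSpace N] [TopologicalSpace P] [TopologicalSpace C'] [TopologicalSpace N']
  [TopologicalSpace P'] [TopologicalSpace Z] [MulAction G C] [MulAction G N] [MulAction G P]
  [MulAction G C'] [MulAction G N'] [MulAction G P'] [MulAction G Z]

/-- The identifications in the double mapping cylinder. -/
inductive CylRel (f : GHom G C N) (g : GHom G C P) : N ⊕ (C × I) ⊕ P → N ⊕ (C × I) ⊕ P → Prop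
  | left (c : C) : CylRel f g (.inr (.inl (c, 0))) (.inl (f c))
  | right (c : C) : CylRel f g (.inr (.inl (c, 1))) (.inr (.inr (g c)))

/-- The double mapping cylinder of `f : C → N` and `g : C → P`. -/
def DoubleCyl (f : GHom G C N) (g : GHom G C P) : Type u := Quot (CylRel f g)

namespace DoubleCyl

variable (f : GHom G C N) (g : GHom G C P)

instance : TopologicalSpace (DoubleCyl f g) := inferInstanceAs (TopologicalSpace (Quot _))

/-- The inclusion of the left end. -/
def inl : C(N, DoubleCyl f g) :=
  ⟨fun n => Quot.mk _ (.inl n), continuous_quot_mk.comp continuous_inl⟩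

/-- The inclusion of the right end. -/
def inr : C(P, DoubleCyl f g) :=
  ⟨fun p => Quot.mk _ (.inr (.inr p)), continuous_quot_mk.comp (continuous_inr.comp continuous_inr)⟩

/-- The cylinder part. -/
def cyl : C(C × I, DoubleCyl f g) :=
  ⟨fun c => Quot.mk _ (.inr (.inl c)), continuous_quot_mk.comp (continuous_inr.comp continuous_inl)⟩

lemma cyl_zero (c : C) : cyl f g (c, 0) = inl f g (f c) := Quot.sound (.left c)

lemma cyl_one (c : C) : cyl f g (c, 1) = inr f g (g c) := Quot.sound (.right c)

variable {f g} in
@[elab_as_elim]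
lemma ind {motive : DoubleCyl f g → Prop} (hl : ∀ n, motive (inl f g n))
    (hc : ∀ c t, motive (cyl f g (c, t))) (hr : ∀ p, motive (inr f g p)) (x) : motive x := by
  induction x using Quot.ind with | _ x =>
  rcases x with n | ⟨c, t⟩ | p
  exacts [hl n, hc c t, hr p]

lemma isClosed_iff (A : Set (DoubleCyl f g)) : IsClosed A ↔ IsClosed (inl f g ⁻¹' A) ∧
    IsClosed (cyl f g ⁻¹' A) ∧ IsClosed (inr f g ⁻¹' A) := by
  have : IsClosed A ↔ IsClosed (Quot.mk (CylRel f g) ⁻¹' A) :=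
    isQuotientMap_quot_mk.isClosed_preimage.symm
  rw [this, isClosed_sum_iff, isClosed_sum_iff]
  rfl

variable {f g} in
/-- Maps out of the double mapping cylinder, on the level of sets. -/
def lift {Z : Type*} (a : N → Z) (h : C × I → Z) (b : P → Z) (h0 : ∀ c, h (c, 0) = a (f c))
    (h1 : ∀ c, h (c, 1) = b (g c)) (x : DoubleCyl f g) : Z :=
  Quot.lift (Sum.elim a (Sum.elim h b)) (by rintro _ _ (c | c) <;> simp [h0, h1]) x

section

variable {Z : Type*} (a : N → Z) (h : C × I → Z) (b : P → Z) (h0 : ∀ c, h (c, 0) = a (f c))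
    (h1 : ∀ c, h (c, 1) = b (g c))

@[simp] lemma lift_inl (n : N) : lift a h b h0 h1 (inl f g n) = a n := rfl
@[simp] lemma lift_inr (p : P) : lift a h b h0 h1 (inr f g p) = b p := rfl
@[simp] lemma lift_cyl (c : C × I) : lift a h b h0 h1 (cyl f g c) = h c := rfl

lemma continuous_lift [TopologicalSpace Z] (ha : Continuous a) (hh : Continuous h)
    (hb : Continuous b) : Continuous (lift a h b h0 h1) :=
  continuous_quot_lift _ (ha.sumElim (hh.sumElim hb))

end

instance : MulAction G (DoubleCyl f g) where
  smul k := lift (fun n => inl f g (k • n)) (fun c => cyl f g (k • c)) (fun p => inr f g (k • p))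
    (fun c => by simp [cyl_zero]) (fun c => by simp [cyl_one])
  one_smul x := by
    induction x using ind with
    | hl n => exact congrArg (inl f g) (one_smul G n)
    | hc c t => exact congrArg (cyl f g) (one_smul G (c, t))
    | hr n => exact congrArg (inr f g) (one_smul G n)
  mul_smul k l x := by
    induction x using ind with
    | hl n => exact congrArg (inl f g) (mul_smul k l n)
    | hc c t => exact congrArg (cyl f g) (mul_smul k l (c, t))
    | hr n => exact congrArg (inr f g) (mul_smul k l n)

@[simp] lemma smul_inl (k : G) (n : N) : k • inl f g n = inl f g (k • n) := rfl
@[simp] lemma smul_inr (k : G) (n : P) : k • inr f g n = inr f g (k • n) := rfl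
@[simp] lemma smul_cyl (k : G) (n : C × I) : k • cyl f g n = cyl f g (k • n) := rfl

instance [ContinuousConstSMul G C] [ContinuousConstSMul G N] [ContinuousConstSMul G P] :
    ContinuousConstSMul G (DoubleCyl f g) where
  continuous_const_smul k := continuous_lift _ _ _ _ _ _ _
    (by fun_prop) (by fun_prop) (by fun_prop)

variable {f g}

/-- `G`-maps out of the double mapping cylinder. -/
def desc (a : GHom G N Z) (h : GHom G (C × I) Z) (b : GHom G P Z) (h0 : ∀ c, h (c, 0) = a (f c))
    (h1 : ∀ c, h (c, 1) = b (g c)) : GHom G (DoubleCyl f g) Z :=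
  .of (lift a h b h0 h1) (continuous_lift _ _ _ _ _ _ _ a.continuous h.continuous b.continuous) (by
    intro k x
    induction x using ind with
    | hl n => exact a.map_smul k n
    | hc c t => exact h.map_smul k (c, t)
    | hr n => exact b.map_smul k n)

section

variable (a : GHom G N Z) (h : GHom G (C × I) Z) (b : GHom G P Z) (h0 : ∀ c, h (c, 0) = a (f c))
    (h1 : ∀ c, h (c, 1) = b (g c))

@[simp] lemma desc_inl (n : N) : desc a h b h0 h1 (inl f g n) = a n := rfl
@[simp] lemma desc_inr (p : P) : desc a h b h0 h1 (inr f g p) = b p := rfl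
@[simp] lemma desc_cyl (c : C × I) : desc a h b h0 h1 (cyl f g c) = h c := rfl

end

variable (f g) in
/-- The left end as a `G`-map. -/
def inlG : GHom G N (DoubleCyl f g) := ⟨inl f g, fun _ _ => rfl⟩
variable (f g) in
/-- The right end as a `G`-map. -/
def inrG : GHom G P (DoubleCyl f g) := ⟨inr f g, fun _ _ => rfl⟩
variable (f g) in
/-- The cylinder as a `G`-map. -/
def cylG : GHom G (C × I) (DoubleCyl f g) := ⟨cyl f g, fun _ _ => rfl⟩

@[simp] lemma inlG_apply (n : N) : inlG f g n = inl f g n := rfl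
@[simp] lemma inrG_apply (n : P) : inrG f g n = inr f g n := rfl
@[simp] lemma cylG_apply (n : C × I) : cylG f g n = cyl f g n := rfl

/-- The square with the maps `f`, `f'`, `γ`, `a` commutes. -/
structure Commutes (f : GHom G C N) (f' : GHom G C' N') (γ : GHom G C C') (a : GHom G N N') :
    Prop where
  eq : ∀ c, f' (γ c) = a (f c)

/-- Strict functoriality. -/
def map {f' : GHom G C' N'} {g' : GHom G C' P'} (a : GHom G N N') (γ : GHom G C C')
    (b : GHom G P P') (ha : Commutes f f' γ a) (hb : Commutes g g' γ b) :
    GHom G (DoubleCyl f g) (DoubleCyl f' g') :=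
  desc ((inlG f' g').comp a) ((cylG f' g').comp (γ.prodMap (.id I))) ((inrG f' g').comp b)
    (by simp [cyl_zero, ha.eq]) (by simp [cyl_one, hb.eq])

section

variable {f' : GHom G C' N'} {g' : GHom G C' P'} (a : GHom G N N') (γ : GHom G C C')
    (b : GHom G P P') (ha : Commutes f f' γ a) (hb : Commutes g g' γ b)

@[simp] lemma map_inl (n : N) : map a γ b ha hb (inl f g n) = inl f' g' (a n) := rfl
@[simp] lemma map_inr (n : P) : map a γ b ha hb (inr f g n) = inr f' g' (b n) := rfl
@[simp] lemma map_cyl (c : C) (t : I) :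
    map a γ b ha hb (cyl f g (c, t)) = cyl f' g' (γ c, t) := rfl

end

/-! ### Homotopy invariance of double mapping cylinders -/

section Homotopy

variable [ContinuousConstSMul G C] [ContinuousConstSMul G N] [ContinuousConstSMul G P]

variable (C) in
/-- Inclusion of the slice of `C × I` at time `t`. -/
def slice (t : I) : GHom G C (C × I) := .of (fun c => (c, t)) (by fun_prop) (by simp)

@[simp] lemma slice_apply (t : I) (c : C) : (slice C t : GHom G C (C × I)) c = (c, t) := rfl

/-- Inclusion of the slice at time `t` of a double cylinder on `C × I`. -/
def sliceMap {F : GHom G (C × I) N} {K : GHom G (C × I) P} (t : I) (hf : ∀ c, F (c, t) = f c)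
    (hg : ∀ c, K (c, t) = g c) : GHom G (DoubleCyl f g) (DoubleCyl F K) :=
  map (.id G N) (slice C t) (.id G P) ⟨by simp [hf]⟩ ⟨by simp [hg]⟩

section

variable {F : GHom G (C × I) N} {K : GHom G (C × I) P} (t : I) (hf : ∀ c, F (c, t) = f c)
    (hg : ∀ c, K (c, t) = g c)

@[simp] lemma sliceMap_inl (n : N) : sliceMap t hf hg (inl f g n) = inl F K n := rfl
@[simp] lemma sliceMap_inr (n : P) : sliceMap t hf hg (inr f g n) = inr F K n := rfl
@[simp] lemma sliceMap_cyl (c : C) (s : I) :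
    sliceMap t hf hg (cyl f g (c, s)) = cyl F K ((c, t), s) := rfl

end

/-- The formula behind the retraction of a square onto three of its sides. -/
noncomputable def squash (w s t : I) : I × I :=
  -- Here `s` is the homotopy time and `t` the cylinder coordinate. At `w = 1` this is the identity;
  -- at `w = 0` the image lies in the sides `s = 0`, `t = 0`, `t = 1`; these three sides are fixed
  -- for every `w`. The second entry stretches the interval from `(1 - w) s / 3` to `1 - (1 - w) s /
  -- 3` onto `[0, 1]`.
  (projIcc 0 1 zero_le_one (max ((w : ℝ) * s) (max (s - 3 * t) (s - 3 * (1 - t)))),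
    projIcc 0 1 zero_le_one ((t - (1 - w) * s / 3) / (1 - 2 * (1 - w) * s / 3)))

lemma squash_denominator_pos (w s : I) : (0 : ℝ) < 1 - 2 * (1 - w) * s / 3 := by
  have h1 : (1 - w : ℝ) * s ≤ 1 := mul_le_one₀ (by linarith [w.2.1]) s.2.1 s.2.2
  linarith

lemma continuous_squash : Continuous fun x : I × I × I => squash x.1 x.2.1 x.2.2 := by
  unfold squash
  refine Continuous.prodMk (continuous_projIcc.comp (by fun_prop)) (continuous_projIcc.comp ?_)
  exact Continuous.div (by fun_prop) (by fun_prop)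
    fun x => (squash_denominator_pos x.1 x.2.1).ne'

lemma squash_t_zero (w s : I) : squash w s 0 = (s, 0) := by
  have hw := w.2; have hs := s.2
  ext
  · have : max ((w : ℝ) * s) (max (s - 3 * (0 : I)) (s - 3 * (1 - (0 : I)))) = s := by
      have : (w : ℝ) * s ≤ s := mul_le_of_le_one_left hs.1 hw.2
      rw [max_eq_right, max_eq_left] <;> simp [this]
    simp only [squash]
    rw [this]; simp
  · simp only [squash]
    rw [projIcc_of_le_left]
    · rfl
    · apply div_nonpos_of_nonpos_of_nonneg _ (squash_denominator_pos w s).le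
      have : 0 ≤ (1 - w : ℝ) * s := mul_nonneg (by linarith [hw.2]) hs.1
      simp; linarith

lemma squash_t_one (w s : I) : squash w s 1 = (s, 1) := by
  have hw := w.2; have hs := s.2
  ext
  · have : max ((w : ℝ) * s) (max (s - 3 * (1 : I)) (s - 3 * (1 - (1 : I)))) = s := by
      have : (w : ℝ) * s ≤ s := mul_le_of_le_one_left hs.1 hw.2
      rw [max_eq_right, max_eq_right] <;> simp [this]
    simp only [squash]
    rw [this]; simp
  · simp only [squash]
    rw [projIcc_of_right_le]
    · rfl
    · rw [one_le_div (squash_denominator_pos w s)]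
      have : 0 ≤ (1 - w : ℝ) * s := mul_nonneg (by linarith [hw.2]) hs.1
      simp; linarith

lemma squash_w_one (s t : I) : squash 1 s t = (s, t) := by
  have ht := t.2; have hs := s.2
  ext
  · have : max (((1 : I) : ℝ) * s) (max (s - 3 * t) (s - 3 * (1 - t))) = s := by
      rw [max_eq_left] <;> simp [ht.1, ht.2]
    simp only [squash]
    rw [this]; simp
  · simp [squash]

lemma squash_w_zero_left {s t : I} (h : (t : ℝ) ≤ s / 3) :
    squash 0 s t = (projIcc 0 1 zero_le_one ((s : ℝ) - 3 * t), 0) := by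
  have ht := t.2; have hs := s.2
  ext
  · have : max (((0 : I) : ℝ) * s) (max (s - 3 * t) (s - 3 * (1 - t))) = s - 3 * t := by
      rw [max_eq_right, max_eq_left]
      · linarith [hs.2]
      · apply le_max_of_le_left; simp; linarith
    simp only [squash]
    rw [this]
  · simp only [squash]
    rw [projIcc_of_le_left]
    · rfl
    · apply div_nonpos_of_nonpos_of_nonneg _ (squash_denominator_pos 0 s).le
      simp; linarith

lemma squash_w_zero_mid {s t : I} (h : (s : ℝ) / 3 ≤ t) (h' : (t : ℝ) ≤ 1 - s / 3) :
    squash 0 s t = (0, projIcc 0 1 zero_le_one ((t - s / 3 : ℝ) / (1 - 2 * s / 3))) := by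
  ext
  · have h0 : max (((0 : I) : ℝ) * s) (max (s - 3 * t) (s - 3 * (1 - t))) ≤ 0 :=
      max_le (by simp) (max_le (by linarith) (by linarith))
    simp only [squash]
    rw [projIcc_of_le_left _ h0]
    rfl
  · simp [squash]

lemma squash_w_zero_right {s t : I} (h : (1 - s / 3 : ℝ) ≤ t) :
    squash 0 s t = (projIcc 0 1 zero_le_one ((s : ℝ) - 3 * (1 - t)), 1) := by
  have ht := t.2; have hs := s.2
  ext
  · have : max (((0 : I) : ℝ) * s) (max (s - 3 * t) (s - 3 * (1 - t))) = s - 3 * (1 - t) := by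
      rw [max_eq_right, max_eq_right]
      · linarith [hs.2]
      · apply le_max_of_le_right; simp; linarith
    simp only [squash]
    rw [this]
  · simp only [squash]
    rw [projIcc_of_right_le]
    · rfl
    · rw [one_le_div (squash_denominator_pos 0 s)]
      simp; linarith

section Retraction

variable {F : GHom G (C × I) N} {K : GHom G (C × I) P}

variable (f g F K) in
/-- The retraction of `DoubleCyl F K` onto the slice at time `0`, on the cylinder part. -/
noncomputable def sliceRetractionFun (x : (C × I) × I) : DoubleCyl f g :=
  if (x.2 : ℝ) ≤ x.1.2 / 3 then inl _ _ (F (x.1.1, projIcc 0 1 zero_le_one (x.1.2 - 3 * x.2 : ℝ)))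
  else if (x.2 : ℝ) ≤ 1 - x.1.2 / 3 then
    cyl _ _ (x.1.1, projIcc 0 1 zero_le_one ((x.2 - x.1.2 / 3 : ℝ) / (1 - 2 * x.1.2 / 3)))
  else inr _ _ (K (x.1.1, projIcc 0 1 zero_le_one (x.1.2 - 3 * (1 - x.2) : ℝ)))

variable (hf : ∀ c, F (c, 0) = f c) (hg : ∀ c, K (c, 0) = g c)

include hf hg

lemma continuous_sliceRetractionFun : Continuous (sliceRetractionFun f g F K) := by
  have hden : ∀ s : I, (1 - 2 * s / 3 : ℝ) ≠ 0 := fun s => by linarith [s.2.2]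
  unfold sliceRetractionFun
  have hp := continuous_projIcc (a := (0 : ℝ)) (b := 1) (h := zero_le_one)
  refine Continuous.if_le ?_ (Continuous.if_le ?_ ?_ (by fun_prop) (by fun_prop) ?_)
    (by fun_prop) (by fun_prop) ?_
  · exact (map_continuous _).comp (F.continuous.comp
      ((by fun_prop : Continuous fun x : (C × I) × I => x.1.1).prodMk (hp.comp (by fun_prop))))
  · exact (map_continuous _).comp
      ((by fun_prop : Continuous fun x : (C × I) × I => x.1.1).prodMk (hp.comp
        (Continuous.div (by fun_prop) (by fun_prop) fun x => hden _)))
  · exact (map_continuous _).comp (K.continuous.comp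
      ((by fun_prop : Continuous fun x : (C × I) × I => x.1.1).prodMk (hp.comp (by fun_prop))))
  · rintro ⟨⟨c, s⟩, t⟩ h
    simp only at h
    have h1 : projIcc (0 : ℝ) 1 zero_le_one ((t - s / 3 : ℝ) / (1 - 2 * s / 3)) = 1 := by
      apply projIcc_of_right_le
      rw [h, show (1 - s / 3 - s / 3 : ℝ) = 1 - 2 * s / 3 by ring, div_self (hden s)]
    have h2 : projIcc (0 : ℝ) 1 zero_le_one (s - 3 * (1 - t) : ℝ) = 0 := by
      apply projIcc_of_le_left; rw [h]; linarith
    simp only [h1, h2, cyl_one, hg]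
  · rintro ⟨⟨c, s⟩, t⟩ h
    simp only at h
    have hs := s.2.2
    have h1 : projIcc (0 : ℝ) 1 zero_le_one ((t - s / 3 : ℝ) / (1 - 2 * s / 3)) = 0 := by
      apply projIcc_of_le_left
      rw [h]; simp
    have h2 : projIcc (0 : ℝ) 1 zero_le_one (s - 3 * t : ℝ) = 0 := by
      apply projIcc_of_le_left; rw [h]; linarith
    simp only [h1, h2]
    rw [if_pos (by rw [h]; linarith), cyl_zero, hf]

/-- The retraction of `DoubleCyl F K` onto the slice at time `0`. -/
noncomputable def sliceRetraction : GHom G (DoubleCyl F K) (DoubleCyl f g) :=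
  desc (inlG _ _) (.of (sliceRetractionFun f g F K) (continuous_sliceRetractionFun hf hg) (by
      rintro g ⟨⟨c, s⟩, t⟩
      simp only [sliceRetractionFun, smul_mk_trivial]
      split_ifs
      · rw [smul_inl, ← F.map_smul]; rfl
      · rfl
      · rw [smul_inr, ← K.map_smul]; rfl))
    (inrG _ _)
    (by
      rintro ⟨c, s⟩
      have h : (0 : ℝ) ≤ s / 3 := by linarith [s.2.1]
      simp [sliceRetractionFun, h])
    (by
      rintro ⟨c, s⟩
      have := s.2
      simp only [sliceRetractionFun, GHom.of_apply]
      rw [if_neg (by simp only [Icc.coe_one]; linarith [this.2])]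
      split_ifs with h
      · have hs : s = 0 := by
          ext
          simp only [Icc.coe_one, Icc.coe_zero] at h ⊢
          linarith [this.1]
        subst hs
        simp [cyl_one, hg]
      · simp)

@[simp] lemma sliceRetraction_inl (n : N) : sliceRetraction hf hg (inl F K n) = inl f g n := rfl
@[simp] lemma sliceRetraction_inr (n : P) : sliceRetraction hf hg (inr F K n) = inr f g n := rfl
@[simp] lemma sliceRetraction_cyl (x : (C × I) × I) :
    sliceRetraction hf hg (cyl F K x) = sliceRetractionFun f g F K x := rfl

/-- The square of homotopy time and cylinder coordinate retracts onto three sides. Two of them, `t =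
0` and `t = 1`, are absorbed by the ends through `F` and `K`, and the third is the slice at time
`0`. The deformation is `squash w`, which fixes the sides glued to the ends and therefore descends
to the cylinder. -/
theorem sliceMap_zero_isEquiv : (sliceMap 0 hf hg).IsEquiv := by
  refine ⟨sliceRetraction hf hg, .of_eq fun x => ?_, ?_⟩
  · induction x using ind with
    | hl n => rfl
    | hr n => rfl
    | hc c t =>
      have := t.2
      simp only [GHom.comp_apply, sliceMap_cyl, sliceRetraction_cyl,
        sliceRetractionFun, GHom.id_apply]
      split_ifs with h1 h2
      · have ht : t = 0 := by
          ext
          simp only [Icc.coe_zero] at h1 ⊢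
          linarith [this.1]
        subst ht
        simp [cyl_zero, hf]
      · simp
      · simp only [Icc.coe_zero] at h2; linarith [this.2]
  · refine ⟨desc (inlG F K |>.comp (.of Prod.fst continuous_fst (by simp))).curry
      (GHom.curry (.of (fun x : ((C × I) × I) × I =>
        cyl F K ((x.1.1.1, (squash x.2 x.1.1.2 x.1.2).1), (squash x.2 x.1.1.2 x.1.2).2)) ?_ ?_))
      (inrG F K |>.comp (.of Prod.fst continuous_fst (by simp))).curry ?_ ?_, ?_, ?_⟩
    · have := continuous_squash.comp
        (by fun_prop : Continuous fun x : ((C × I) × I) × I => (x.2, x.1.1.2, x.1.2))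
      exact (map_continuous _).comp (((by fun_prop : Continuous fun x : ((C × I) × I) × I =>
        x.1.1.1).prodMk this.fst).prodMk this.snd)
    · rintro g ⟨⟨⟨c, s⟩, t⟩, w⟩
      rfl
    · rintro ⟨c, s⟩
      ext w
      simp [squash_t_zero, cyl_zero]
    · rintro ⟨c, s⟩
      ext w
      simp [squash_t_one, cyl_one]
    · intro x
      induction x using ind with
      | hl n => rfl
      | hr n => rfl
      | hc c t =>
        obtain ⟨c, s⟩ := c
        simp only [desc_cyl, GHom.curry_apply, GHom.of_apply, GHom.comp_apply,
          sliceRetraction_cyl, sliceRetractionFun]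
        split_ifs with h1 h2
        · rw [squash_w_zero_left h1]; exact cyl_zero _ _ _
        · rw [squash_w_zero_mid (not_le.1 h1).le h2]; rfl
        · rw [squash_w_zero_right (not_le.1 h2).le]; exact cyl_one _ _ _
    · intro x
      induction x using ind with
      | hl n => rfl
      | hr n => rfl
      | hc c t =>
        simp only [desc_cyl, GHom.curry_apply, GHom.of_apply, squash_w_one]
        rfl

omit hf hg

variable (C) in
/-- Reversal of the cylinder coordinate. -/
noncomputable def flip : GHom G (C × I) (C × I) :=
  .of (fun x => (x.1, σ x.2)) (by fun_prop) (by simp)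

@[simp] lemma flip_apply (c : C) (t : I) : (flip C : GHom G (C × I) (C × I)) (c, t) = (c, σ t) := rfl

/-- Reversing the homotopy time reduces this to the slice at time `0`. -/
theorem sliceMap_one_isEquiv (hf : ∀ c, F (c, 1) = f c) (hg : ∀ c, K (c, 1) = g c) :
    (sliceMap 1 hf hg).IsEquiv := by
  let φ : GHom G (DoubleCyl (F.comp (flip C)) (K.comp (flip C))) (DoubleCyl F K) :=
    map (.id G N) (flip C) (.id G P) ⟨by simp⟩ ⟨by simp⟩
  let ψ : GHom G (DoubleCyl F K) (DoubleCyl (F.comp (flip C)) (K.comp (flip C))) :=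
    map (.id G N) (flip C) (.id G P) ⟨by rintro ⟨c, t⟩; simp⟩ ⟨by rintro ⟨c, t⟩; simp⟩
  have hφ : φ.IsEquiv := by
    refine .of_strict ψ ?_ ?_ <;> intro x <;> induction x using ind with
    | hl n => rfl
    | hr n => rfl
    | hc c t =>
      obtain ⟨c, s⟩ := c
      simp [φ, ψ]
  have h := sliceMap_zero_isEquiv (f := f) (g := g) (F := F.comp (flip C)) (K := K.comp (flip C))
    (by simp [hf]) (by simp [hg])
  refine (hφ.comp h).of_homotopic (.of_eq fun x => ?_)
  induction x using ind with
  | hl n => rfl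
  | hr n => rfl
  | hc c t => simp [φ]

end Retraction

variable [ContinuousConstSMul G C'] [ContinuousConstSMul G N'] [ContinuousConstSMul G P']

/-- The double mapping cylinder depends on the maps only up to homotopy. -/
theorem equivalent_of_homotopic {f₀ f₁ : GHom G C N} {g₀ g₁ : GHom G C P}
    (hf : f₀.Homotopic f₁) (hg : g₀.Homotopic g₁) :
    GEquivalent G (DoubleCyl f₀ g₀) (DoubleCyl f₁ g₁) := by
  obtain ⟨F, hF0, hF1⟩ := hf
  obtain ⟨K, hK0, hK1⟩ := hg
  -- Both cylinders are slices of the cylinder on `C × I` formed from the two homotopies.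
  exact GEquivalent.trans ⟨_, sliceMap_zero_isEquiv (F := F.uncurry) (K := K.uncurry) hF0 hK0⟩
    (GEquivalent.symm ⟨_, sliceMap_one_isEquiv (F := F.uncurry) (K := K.uncurry) hF1 hK1⟩)

/-- The homotopies `H` and `L` on the ends, restricted along `f` and `g`, define a double cylinder
on `C × I`. Its slice at time `1`, preceded by the map in question, is homotopic to its slice at
time `0`: move the ends along `H` and `L` and the base along the time coordinate. Both slices are
equivalences. -/
lemma map_id_isEquiv {f : GHom G C N} {g : GHom G C P} {f' : GHom G C N} {g' : GHom G C P}
    {a : GHom G N N} {b : GHom G P P} (ha : (GHom.id G N).Homotopic a)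
    (hb : (GHom.id G P).Homotopic b) (hf : Commutes f f' (.id G C) a)
    (hg : Commutes g g' (.id G C) b) :
    (map a (.id G C) b hf hg).IsEquiv := by
  obtain ⟨H, hH0, hH1⟩ := ha
  obtain ⟨L, hL0, hL1⟩ := hb
  have hf' := hf.eq
  have hg' := hg.eq
  simp only [GHom.id_apply] at hH0 hL0 hf' hg'
  let F : GHom G (C × I) N := (H.comp f).uncurry
  let K : GHom G (C × I) P := (L.comp g).uncurry
  have h1 := sliceMap_one_isEquiv (f := f') (g := g') (F := F) (K := K) (by simp [F, hH1, hf'])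
    (by simp [K, hL1, hg'])
  have h0 := sliceMap_zero_isEquiv (f := f) (g := g) (F := F) (K := K) (by simp [F, hH0])
    (by simp [K, hL0])
  refine .of_comp_left h1 (h0.of_homotopic ⟨desc
    ((inlG F K).comp H.uncurry).curry
    (((cylG F K).comp (.of (fun x : (C × I) × I => ((x.1.1, x.2), x.1.2)) (by fun_prop)
      (by simp))).curry) ((inrG F K).comp L.uncurry).curry ?_ ?_, ?_, ?_⟩)
  · intro c
    ext w
    simp [cyl_zero, F]
  · intro c
    ext w
    simp [cyl_one, K]
  · intro x
    induction x using ind with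
    | hl n => simp [hH0]
    | hr n => simp [hL0]
    | hc c t => simp
  · intro x
    induction x using ind with
    | hl n => simp [hH1]
    | hr n => simp [hL1]
    | hc c t => simp

/-- Homotopy invariance in the ends. -/
theorem map_ends_isEquiv {f : GHom G C N} {g : GHom G C P} {f' : GHom G C N'} {g' : GHom G C P'}
    {a : GHom G N N'} {b : GHom G P P'} (ha : a.IsEquiv) (hb : b.IsEquiv)
    (hf : Commutes f f' (.id G C) a) (hg : Commutes g g' (.id G C) b) :
    (map a (.id G C) b hf hg).IsEquiv := by
  obtain ⟨a', a1, a2⟩ := ha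
  obtain ⟨b', b1, b2⟩ := hb
  have hf' := hf.eq
  have hg' := hg.eq
  simp only [GHom.id_apply] at hf' hg'
  -- `M₁` and `M₂` apply the inverses `a'`, `b'` and then `a`, `b` again. Each pair of consecutive
  -- maps composes to one with ends homotopic to identities, as two-out-of-six requires.
  let M₁ := map (f := f') (g := g') (f' := a'.comp f') (g' := b'.comp g') a' (.id G C) b'
    ⟨by simp⟩ ⟨by simp⟩
  let M₂ := map (f := a'.comp f') (g := b'.comp g') (f' := a.comp (a'.comp f'))
    (g' := b.comp (b'.comp g')) a (.id G C) b ⟨by simp⟩ ⟨by simp⟩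
  refine .two_of_six (k := M₁) (l := M₂) ?_ ?_
  · refine (map_id_isEquiv (f := f) (g := g) (f' := a'.comp f') (g' := b'.comp g')
      a1.symm b1.symm ⟨by simp [hf']⟩ ⟨by simp [hg']⟩).of_homotopic (.of_eq fun x => ?_)
    induction x using ind <;> simp [M₁]
  · refine (map_id_isEquiv (f := f') (g := g') (f' := a.comp (a'.comp f'))
      (g' := b.comp (b'.comp g')) a2.symm b2.symm ⟨by simp⟩ ⟨by simp⟩).of_homotopic
        (.of_eq fun x => ?_)
    induction x using ind <;> simp [M₁, M₂]

/-- Collapsing `C × I` to `C` by the homotopy gives a map `R` on double cylinders. It is a left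
inverse of the slice at time `1`, hence an equivalence, and on the slice at time `0` it is the map
in question. -/
lemma map_base_isEquiv_of_homotopic_id {f : GHom G C N} {g : GHom G C P} {f' : GHom G C N}
    {g' : GHom G C P} {e : GHom G C C} (he : e.Homotopic (.id G C))
    (hf : Commutes f' f e (.id G N)) (hg : Commutes g' g e (.id G P)) :
    (map (.id G N) e (.id G P) hf hg).IsEquiv := by
  obtain ⟨H, hH0, hH1⟩ := he
  have hf' := hf.eq
  have hg' := hg.eq
  simp only [GHom.id_apply] at hH1 hf' hg'
  let F := f.comp H.uncurry
  let K := g.comp H.uncurry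
  let R : GHom G (DoubleCyl F K) (DoubleCyl f g) :=
    map (.id G N) H.uncurry (.id G P) ⟨by simp [F]⟩ ⟨by simp [K]⟩
  have h1 := sliceMap_one_isEquiv (f := f) (g := g) (F := F) (K := K) (by simp [F, hH1])
    (by simp [K, hH1])
  have h0 := sliceMap_zero_isEquiv (f := f') (g := g') (F := F) (K := K) (by simp [F, hH0, hf'])
    (by simp [K, hH0, hg'])
  have hR : R.IsEquiv := .of_comp_right h1 (GHom.IsEquiv.of_homotopic (.id G _) (.of_eq fun x => by
    induction x using ind <;> simp [R, hH1]))
  refine (hR.comp h0).of_homotopic (.of_eq fun x => ?_)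
  induction x using ind <;> simp [R, hH0]

/-- Homotopy invariance in the base of the cylinder. -/
theorem map_base_isEquiv {f : GHom G C N} {g : GHom G C P} {f' : GHom G C' N} {g' : GHom G C' P}
    {γ : GHom G C' C} (hγ : γ.IsEquiv)
    (hf : Commutes f' f γ (.id G N)) (hg : Commutes g' g γ (.id G P)) :
    (map (.id G N) γ (.id G P) hf hg).IsEquiv := by
  obtain ⟨δ, h1, h2⟩ := hγ
  have hf' := hf.eq
  have hg' := hg.eq
  simp only [GHom.id_apply] at hf' hg'
  let M₁ := map (f := f'.comp δ) (g := g'.comp δ) (f' := f') (g' := g') (.id G N) δ (.id G P)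
    ⟨by simp⟩ ⟨by simp⟩
  let M₂ := map (f := (f'.comp δ).comp γ) (g := (g'.comp δ).comp γ) (f' := f'.comp δ)
    (g' := g'.comp δ) (.id G N) γ (.id G P) ⟨by simp⟩ ⟨by simp⟩
  have e1 : (M₁.comp M₂).IsEquiv := by
    refine (map_base_isEquiv_of_homotopic_id (f := f') (g := g') (f' := (f'.comp δ).comp γ)
      (g' := (g'.comp δ).comp γ) h1 ⟨by simp⟩ ⟨by simp⟩).of_homotopic (.of_eq fun x => ?_)
    induction x using ind <;> simp [M₁, M₂]
  have e2 : ((map (.id G N) γ (.id G P) hf hg).comp M₁).IsEquiv := by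
    refine (map_base_isEquiv_of_homotopic_id (f := f) (g := g) (f' := f'.comp δ)
      (g' := g'.comp δ) h2 ⟨by simp [hf']⟩ ⟨by simp [hg']⟩).of_homotopic (.of_eq fun x => ?_)
    induction x using ind <;> simp [M₁]
  -- `M₁` has a right inverse from `e1` and a left inverse from `e2`; then `e2` transfers the
  -- conclusion to the given map.
  have e3 : M₁.IsEquiv := by
    obtain ⟨r, _, hr⟩ := e1
    obtain ⟨l, hl, _⟩ := e2
    exact .of_left_right (l := l.comp (map (.id G N) γ (.id G P) hf hg)) (r := M₂.comp r) hl hr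
  exact .of_comp_right e3 e2

/-- Homotopy invariance of the double mapping cylinder. -/
theorem equivalent_of_isEquiv {f : GHom G C N} {g : GHom G C P} {f' : GHom G C' N'}
    {g' : GHom G C' P'} {a : GHom G N N'} {γ : GHom G C C'} {b : GHom G P P'} (ha : a.IsEquiv)
    (hγ : γ.IsEquiv) (hb : b.IsEquiv) (hf : (a.comp f).Homotopic (f'.comp γ))
    (hg : (b.comp g).Homotopic (g'.comp γ)) :
    GEquivalent G (DoubleCyl f g) (DoubleCyl f' g') :=
  -- Replace the ends, deform the two maps so that they factor through `γ`, then replace the base.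
  (GEquivalent.trans ⟨_, map_ends_isEquiv (f' := a.comp f) (g' := b.comp g) ha hb ⟨by simp⟩
    ⟨by simp⟩⟩ (equivalent_of_homotopic hf hg)).trans
      ⟨_, map_base_isEquiv (f := f') (g := g') hγ ⟨by simp⟩ ⟨by simp⟩⟩

end Homotopy

end DoubleCyl

end DoubleMappingCylinder

/-! ### Attaching `T × D` along `T × S` -/

section Attachment

variable {G : Type u} [Group G] {X Y T Z : Type u} {D : Type} [TopologicalSpace X]
  [TopologicalSpace Y] [TopologicalSpace T] [TopologicalSpace Z] [TopologicalSpace D]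
  [MulAction G X] [MulAction G Y] [MulAction G T] [MulAction G Z]

/-- The `G`-space `Y` arises from the closed `G`-subspace `X` by attaching `T × D` along `T × S`,
with characteristic map `χ`. -/
structure IsAttachment (S : Set D) (i : GHom G X Y) (χ : GHom G (T × D) Y) : Prop where
  isClosedEmbedding : IsClosedEmbedding i
  mem_range_iff : ∀ t d, χ (t, d) ∈ range i ↔ d ∈ S
  injective : ∀ t d t' d', d ∉ S → d' ∉ S → χ (t, d) = χ (t', d') → t = t' ∧ d = d'
  surjective : ∀ y, y ∈ range i ∨ y ∈ range χ
  isClosed_of : ∀ A : Set Y, IsClosed (i ⁻¹' A) → IsClosed (χ ⁻¹' A) → IsClosed A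

namespace IsAttachment

variable {S : Set D} {i : GHom G X Y} {χ : GHom G (T × D) Y} (h : IsAttachment S i χ)

include h

open Classical in
/-- Functions out of an attachment. -/
noncomputable def lift {Z : Type*} (a : X → Z) (b : T × D → Z) (y : Y) : Z :=
  if hy : y ∈ range i then a hy.choose else b ((h.surjective y).resolve_left hy).choose

lemma lift_left {Z : Type*} (a : X → Z) (b : T × D → Z) (x : X) : h.lift a b (i x) = a x := by
  have hx : i x ∈ range i := mem_range_self x
  rw [lift, dif_pos hx, h.isClosedEmbedding.injective hx.choose_spec]

lemma lift_right {Z : Type*} {a : X → Z} {b : T × D → Z}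
    (hab : ∀ x t d, i x = χ (t, d) → a x = b (t, d)) (x : T × D) : h.lift a b (χ x) = b x := by
  obtain ⟨t, d⟩ := x
  rw [lift]
  split_ifs with hy
  · exact hab _ _ _ hy.choose_spec
  · have hy' := (h.surjective (χ (t, d))).resolve_left hy
    have hd : d ∉ S := fun hd => hy ((h.mem_range_iff t d).2 hd)
    have hd' : hy'.choose.2 ∉ S := fun hd' => hy (by
      rw [← hy'.choose_spec]
      exact (h.mem_range_iff _ _).2 hd')
    obtain ⟨h1, h2⟩ := h.injective _ _ _ _ hd' hd hy'.choose_spec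
    exact congrArg b (Prod.ext h1 h2)

lemma continuous_iff {Z : Type*} [TopologicalSpace Z] {f : Y → Z} :
    Continuous f ↔ Continuous (fun x => f (i x)) ∧ Continuous fun x => f (χ x) := by
  refine ⟨fun hf => ⟨hf.comp i.continuous, hf.comp χ.continuous⟩, fun hf => ?_⟩
  rw [continuous_iff_isClosed]
  intro A hA
  exact h.isClosed_of _ (hA.preimage hf.1) (hA.preimage hf.2)

lemma continuous_lift {Z : Type*} [TopologicalSpace Z] {a : X → Z} {b : T × D → Z}
    (hab : ∀ x t d, i x = χ (t, d) → a x = b (t, d)) (ha : Continuous a) (hb : Continuous b) :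
    Continuous (h.lift a b) := by
  rw [h.continuous_iff]
  simp_rw [h.lift_left, h.lift_right hab]
  exact ⟨ha, hb⟩

lemma ind {motive : Y → Prop} (hl : ∀ x, motive (i x)) (hr : ∀ t d, motive (χ (t, d))) (y : Y) :
    motive y := by
  rcases h.surjective y with ⟨x, rfl⟩ | ⟨⟨t, d⟩, rfl⟩
  exacts [hl x, hr t d]

/-- `G`-maps out of an attachment. -/
noncomputable def desc (a : GHom G X Z) (b : GHom G (T × D) Z)
    (hab : ∀ x t d, i x = χ (t, d) → a x = b (t, d)) : GHom G Y Z :=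
  .of (h.lift a b) (h.continuous_lift hab a.continuous b.continuous) (by
    intro g y
    induction y using h.ind with
    | hl x => rw [← i.map_smul, h.lift_left, h.lift_left, a.map_smul]
    | hr t d => rw [← χ.map_smul, h.lift_right hab, h.lift_right hab, b.map_smul])

@[simp] lemma desc_left (a : GHom G X Z) (b : GHom G (T × D) Z) (hab) (x : X) :
    h.desc a b hab (i x) = a x := h.lift_left _ _ x

@[simp] lemma desc_right (a : GHom G X Z) (b : GHom G (T × D) Z) (hab) (x : T × D) :
    h.desc a b hab (χ x) = b x := h.lift_right hab x

lemma mem_of_eq (x : X) (t : T) (d : D) (hx : i x = χ (t, d)) : d ∈ S :=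
  (h.mem_range_iff t d).1 ⟨x, hx⟩

/-- The attaching map. -/
noncomputable def attachingMap : GHom G (T × S) X :=
  .of (fun x => ((h.mem_range_iff x.1 x.2).2 x.2.2).choose) (by
    rw [h.isClosedEmbedding.continuous_iff]
    have : (i ∘ fun x : T × S => ((h.mem_range_iff x.1 x.2).2 x.2.2).choose) =
        fun x => χ (x.1, x.2) := by
      ext x
      exact ((h.mem_range_iff x.1 x.2).2 x.2.2).choose_spec
    rw [this]
    fun_prop) (by
    intro g x
    apply h.isClosedEmbedding.injective
    rw [i.map_smul, ((h.mem_range_iff x.1 x.2).2 x.2.2).choose_spec, ← χ.map_smul]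
    exact ((h.mem_range_iff (g • x).1 (g • x).2).2 (g • x).2.2).choose_spec)

lemma attachingMap_spec (x : T × S) : i (h.attachingMap x) = χ (x.1, x.2) :=
  ((h.mem_range_iff x.1 x.2).2 x.2.2).choose_spec

lemma attachingMap_eq {x : X} {t : T} {d : D} (hd : d ∈ S) (hx : i x = χ (t, d)) :
    h.attachingMap (t, ⟨d, hd⟩) = x :=
  h.isClosedEmbedding.injective ((h.attachingMap_spec _).trans hx.symm)

/-- Two attachments along the same attaching map are homeomorphic. -/
theorem equivalent_of_attachingMap_eq [ContinuousConstSMul G X] [ContinuousConstSMul G Y] {Y' : Type u}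
    [TopologicalSpace Y'] [MulAction G Y'] [ContinuousConstSMul G Y'] {i' : GHom G X Y'}
    {χ' : GHom G (T × D) Y'} (h' : IsAttachment S i' χ') (e : h.attachingMap = h'.attachingMap) :
    GEquivalent G Y Y' := by
  have key : ∀ x t d, i x = χ (t, d) ↔ i' x = χ' (t, d) := by
    intro x t d
    constructor
    · intro hx
      have hd := h.mem_of_eq _ _ _ hx
      rw [← h.attachingMap_eq hd hx, e, h'.attachingMap_spec]
    · intro hx
      have hd := h'.mem_of_eq _ _ _ hx
      rw [← h'.attachingMap_eq hd hx, ← e, h.attachingMap_spec]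
  refine ⟨h.desc i' χ' fun x t d => (key x t d).1, .of_strict (h'.desc i χ fun x t d => (key x t d).2)
    (fun y => ?_) fun y => ?_⟩
  · induction y using h.ind <;> simp
  · induction y using h'.ind <;> simp

/-- A map of the model `D` fixing `S`, continuously depending on a parameter, induces a map of the
attachment. -/
noncomputable def cellwise [ContinuousConstSMul G Y] {W : Type} [TopologicalSpace W]
    [LocallyCompactSpace W] (τ : C(D × W, D)) (hτ : ∀ s ∈ S, ∀ w, τ (s, w) = s) :
    GHom G (Y × W) Y :=
  -- Constructing a map from `Y` to `C(W, Y)` avoids showing that `Y × W` is again an attachment;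
  -- local compactness of `W` is used to uncurry.
  (h.desc (Z := C(W, Y)) (i.comp (.of Prod.fst continuous_fst (by simp)) : GHom G (X × W) Y).curry
    (GHom.curry (.of (fun x : (T × D) × W => χ (x.1.1, τ (x.1.2, x.2))) (by fun_prop)
      (by intro g x; exact χ.map_smul g (x.1.1, τ (x.1.2, x.2))))) (by
    intro x t d hx
    ext w
    simp [hτ d (h.mem_of_eq _ _ _ hx), hx])).uncurry

section

variable [ContinuousConstSMul G Y] {W : Type} [TopologicalSpace W]
    [LocallyCompactSpace W] (τ : C(D × W, D)) (hτ : ∀ s ∈ S, ∀ w, τ (s, w) = s)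

@[simp] lemma cellwise_left (x : X) (w : W) : h.cellwise τ hτ (i x, w) = i x := by
  simp [cellwise]

@[simp] lemma cellwise_right (t : T) (d : D) (w : W) :
    h.cellwise τ hτ (χ (t, d), w) = χ (t, τ (d, w)) := by
  simp [cellwise]

end

/-- Change of the model `D` along a homeomorphism. -/
lemma congr_model {D' : Type} [TopologicalSpace D'] (e : D' ≃ₜ D) :
    IsAttachment (e ⁻¹' S) i (χ.comp ((GHom.id G T).prodMap (e : C(D', D)))) where
  isClosedEmbedding := h.isClosedEmbedding
  mem_range_iff t d := h.mem_range_iff t (e d)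
  injective t d t' d' hd hd' hχ := by
    obtain ⟨h1, h2⟩ := h.injective t (e d) t' (e d') hd hd' hχ
    exact ⟨h1, e.injective h2⟩
  surjective y := by
    rcases h.surjective y with hy | ⟨⟨t, d⟩, rfl⟩
    · exact .inl hy
    · exact .inr ⟨(t, e.symm d), by simp⟩
  isClosed_of A h1 h2 := by
    refine h.isClosed_of A h1 ?_
    have : Continuous fun x : T × D => (x.1, e.symm x.2) := by fun_prop
    convert h2.preimage this using 1
    ext ⟨t, d⟩
    simp

end IsAttachment

end Attachment

/-! ### Points and closed subspaces of double mapping cylinders -/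

namespace DoubleCyl

section Injectivity

variable {G : Type u} [Group G] {C N P : Type u} [TopologicalSpace C]
  [TopologicalSpace N] [TopologicalSpace P] [MulAction G C] [MulAction G N] [MulAction G P]
  (f : GHom G C N) (g : GHom G C P)

open Classical in
/-- A normal form for points of the double mapping cylinder. -/
noncomputable def normalForm : DoubleCyl f g → N ⊕ (C × I) ⊕ P :=
  lift .inl (fun c => if c.2 = 0 then .inl (f c.1) else if c.2 = 1 then .inr (.inr (g c.1)) else
    .inr (.inl c)) (fun p => .inr (.inr p)) (by simp) (by simp)

lemma normalForm_cyl {c : C} {t : I} (h0 : t ≠ 0) (h1 : t ≠ 1) :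
    normalForm f g (cyl f g (c, t)) = .inr (.inl (c, t)) := by
  simp [normalForm, h0, h1]

lemma inl_injective : Function.Injective (inl f g) := fun _ _ h =>
  Sum.inl_injective (congrArg (normalForm f g) h)

lemma inr_injective : Function.Injective (inr f g) := fun _ _ h =>
  Sum.inr_injective (Sum.inr_injective (congrArg (normalForm f g) h))

lemma inl_ne_inr (n : N) (p : P) : inl f g n ≠ inr f g p := fun h => by
  simpa [normalForm] using congrArg (normalForm f g) h

lemma cyl_eq_inl {c : C} {t : I} {n : N} (h : cyl f g (c, t) = inl f g n) :
    t = 0 ∧ f c = n := by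
  have h' := congrArg (normalForm f g) h
  simp only [normalForm, lift_cyl, lift_inl] at h'
  split_ifs at h'
  simp_all

lemma cyl_eq_inr {c : C} {t : I} {p : P} (h : cyl f g (c, t) = inr f g p) :
    t = 1 ∧ g c = p := by
  have h' := congrArg (normalForm f g) h
  simp only [normalForm, lift_cyl, lift_inr] at h'
  split_ifs at h' <;> simp_all

lemma cyl_injective {c c' : C} {t t' : I} (h0 : t ≠ 0) (h1 : t ≠ 1)
    (h : cyl f g (c, t) = cyl f g (c', t')) : c = c' ∧ t = t' := by
  have h' := congrArg (normalForm f g) h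
  rw [normalForm_cyl f g h0 h1] at h'
  simp only [normalForm, lift_cyl] at h'
  split_ifs at h' <;> simp_all

lemma isClosedEmbedding_inl : IsClosedEmbedding (inl f g) := by
  refine .of_continuous_injective_isClosedMap (map_continuous _) (inl_injective f g) fun A hA => ?_
  rw [isClosed_iff]
  refine ⟨?_, ?_, ?_⟩
  · rwa [preimage_image_eq _ (inl_injective f g)]
  · have : cyl f g ⁻¹' (inl f g '' A) = (fun c : C × I => f c.1) ⁻¹' A ∩ {c | c.2 = 0} := by
      ext ⟨c, t⟩
      constructor
      · rintro ⟨n, hn, h⟩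
        obtain ⟨h1, h2⟩ := cyl_eq_inl f g h.symm
        exact ⟨by simpa [h2] using hn, h1⟩
      · rintro ⟨h1, h2⟩
        simp only [mem_ofPred_eq] at h2
        subst h2
        exact ⟨f c, h1, (cyl_zero f g c).symm⟩
    rw [this]
    exact (hA.preimage (by fun_prop)).inter (isClosed_eq continuous_snd continuous_const)
  · have : inr f g ⁻¹' (inl f g '' A) = ∅ := by
      ext p
      simp only [mem_preimage, mem_image, mem_empty_iff_false, iff_false]
      rintro ⟨n, _, h⟩
      exact inl_ne_inr f g n p h
    rw [this]
    exact isClosed_empty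

end Injectivity

end DoubleCyl

/-! ### Cell attachments as double mapping cylinders -/

section Disk

/-- The boundary sphere of a disk. -/
abbrev diskBoundary (n : ℕ) : Set (EuclideanDisk n) :=
  {d | ‖(d : EuclideanSpace ℝ (Fin n))‖ = 1}

variable {n : ℕ}

lemma EuclideanDisk.norm_le (d : EuclideanDisk n) : ‖(d : EuclideanSpace ℝ (Fin n))‖ ≤ 1 :=
  mem_closedBall_zero_iff.1 d.2

/-- Radial projection of the Euclidean space onto the unit disk. -/
noncomputable def clip : C(EuclideanSpace ℝ (Fin n), EuclideanDisk n) where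
  toFun v := ⟨(max 1 ‖v‖)⁻¹ • v, by
    have h : 0 < max 1 ‖v‖ := by positivity
    rw [mem_closedBall_zero_iff, norm_smul, norm_inv, Real.norm_of_nonneg h.le,
      inv_mul_le_one₀ h]
    exact le_max_right _ _⟩
  continuous_toFun := by
    have h : ∀ v : EuclideanSpace ℝ (Fin n), max 1 ‖v‖ ≠ 0 := fun v => by positivity
    fun_prop (disch := exact h _)

lemma clip_of_le {v : EuclideanSpace ℝ (Fin n)} (h : ‖v‖ ≤ 1) :
    (clip v : EuclideanSpace ℝ (Fin n)) = v := by
  simp [clip, max_eq_left h]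

@[simp] lemma clip_coe (d : EuclideanDisk n) : clip (d : EuclideanSpace ℝ (Fin n)) = d :=
  Subtype.ext (clip_of_le d.norm_le)

end Disk

lemma continuous_of_isClosed_cover {X Y : Type*} [TopologicalSpace X] [TopologicalSpace Y]
    {f : X → Y} {A B : Set X} (hA : IsClosed A) (hB : IsClosed B) (hAB : ∀ x, x ∈ A ∨ x ∈ B)
    (fA : Continuous fun x : A => f x) (fB : Continuous fun x : B => f x) : Continuous f := by
  rw [← continuousOn_univ, ← show A ∪ B = univ from eq_univ_of_forall hAB]
  exact (continuousOn_iff_continuous_domRestrict.2 fA).union_of_isClosed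
    (continuousOn_iff_continuous_domRestrict.2 fB) hA hB

namespace DoubleCyl

variable {G : Type u} [Group G] {X T : Type u} [TopologicalSpace X] [TopologicalSpace T]
  [MulAction G X] [MulAction G T] {n : ℕ} (φ : GHom G (T × diskBoundary n) X)

variable (G T n) in
/-- The inclusion of `T × S` in `T × D`. -/
def boundaryInclusion : GHom G (T × diskBoundary n) (T × EuclideanDisk n) :=
  (GHom.id G T).prodMap ⟨Subtype.val, continuous_subtype_val⟩

@[simp] lemma boundaryInclusion_apply (x : T × diskBoundary n) :
    boundaryInclusion G T n x = (x.1, (x.2 : EuclideanDisk n)) := rfl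

/-- The space obtained from `X` by attaching `T × D` along `φ`, with a collar. -/
abbrev Attach : Type u := DoubleCyl φ (boundaryInclusion G T n)

open Classical in
/-- The characteristic map of `T × D` in `Attach φ`, as a function. -/
noncomputable def attachCharFun (x : T × EuclideanDisk n) : Attach φ :=
  -- The shell of norm at least `1 / 2` fills the collar, with cylinder coordinate `0` on the unit
  -- sphere and `1` at norm `1 / 2`; the inner disk is scaled up by `2`.
  if h : 1 / 2 ≤ ‖(x.2 : EuclideanSpace ℝ (Fin n))‖ then
    cyl φ (boundaryInclusion G T n) ((x.1, ⟨clip (‖(x.2 : EuclideanSpace ℝ (Fin n))‖⁻¹ •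
      (x.2 : EuclideanSpace ℝ (Fin n))), by
        have h1 : ‖(x.2 : EuclideanSpace ℝ (Fin n))‖ ≠ 0 := by positivity
        have h2 : ‖‖(x.2 : EuclideanSpace ℝ (Fin n))‖⁻¹ • (x.2 : EuclideanSpace ℝ (Fin n))‖ = 1 := by
          rw [norm_smul, norm_inv, norm_norm, inv_mul_cancel₀ h1]
        change ‖_‖ = 1
        rw [clip_of_le h2.le, h2]⟩),
      projIcc 0 1 zero_le_one (2 - 2 * ‖(x.2 : EuclideanSpace ℝ (Fin n))‖))
  else inr φ (boundaryInclusion G T n) (x.1, clip ((2 : ℝ) • (x.2 : EuclideanSpace ℝ (Fin n))))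

lemma attachCharFun_inner (t : T) (d : EuclideanDisk n) :
    attachCharFun φ (t, clip ((1 / 2 : ℝ) • (d : EuclideanSpace ℝ (Fin n)))) = inr φ _ (t, d) := by
  have h1 : ‖(1 / 2 : ℝ) • (d : EuclideanSpace ℝ (Fin n))‖ =
      1 / 2 * ‖(d : EuclideanSpace ℝ (Fin n))‖ := by
    rw [norm_smul]; norm_num
  have hd := d.norm_le
  have h2 : (clip ((1 / 2 : ℝ) • (d : EuclideanSpace ℝ (Fin n))) : EuclideanSpace ℝ (Fin n)) =
      (1 / 2 : ℝ) • (d : EuclideanSpace ℝ (Fin n)) := clip_of_le (by rw [h1]; linarith)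
  simp only [attachCharFun, h2, h1, smul_smul]
  split_ifs with h
  · have hd' : ‖(d : EuclideanSpace ℝ (Fin n))‖ = 1 := by linarith
    have : projIcc (0 : ℝ) 1 zero_le_one (2 - 2 * (1 / 2 * ‖(d : EuclideanSpace ℝ (Fin n))‖)) = 1 :=
      projIcc_of_right_le _ (by rw [hd']; norm_num)
    rw [this, cyl_one]
    simp [hd']
  · norm_num

lemma attachCharFun_collar (t : T) (s : diskBoundary n) (τ : I) :
    attachCharFun φ (t, clip ((1 - τ / 2 : ℝ) • ((s : EuclideanDisk n) :
      EuclideanSpace ℝ (Fin n)))) = cyl φ _ ((t, s), τ) := by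
  have hτ := τ.2
  have hs : ‖((s : EuclideanDisk n) : EuclideanSpace ℝ (Fin n))‖ = 1 := s.2
  have hpos : (0 : ℝ) < 1 - τ / 2 := by linarith [hτ.2]
  have h1 : ‖(1 - τ / 2 : ℝ) • ((s : EuclideanDisk n) : EuclideanSpace ℝ (Fin n))‖ = 1 - τ / 2 := by
    rw [norm_smul, hs, Real.norm_of_nonneg hpos.le, mul_one]
  have h2 : (clip ((1 - τ / 2 : ℝ) • ((s : EuclideanDisk n) : EuclideanSpace ℝ (Fin n))) :
      EuclideanSpace ℝ (Fin n)) = (1 - τ / 2 : ℝ) • ((s : EuclideanDisk n) :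
        EuclideanSpace ℝ (Fin n)) := clip_of_le (by rw [h1]; linarith [hτ.1])
  simp only [attachCharFun, h2, h1, smul_smul, inv_mul_cancel₀ hpos.ne', one_smul, clip_coe]
  rw [dif_pos (by linarith [hτ.2])]
  congr 3
  rw [show (2 - 2 * (1 - τ / 2) : ℝ) = τ by ring]
  exact projIcc_val _ τ

/-- Coordinates inverse to those in `attachCharFun`. The condition `τ ≠ 1` removes the sphere of
norm `1 / 2` from the collar, so that the two cases are disjoint. -/
lemma disk_cases (d : EuclideanDisk n) :
    (∃ d' : EuclideanDisk n, d = clip ((1 / 2 : ℝ) • (d' : EuclideanSpace ℝ (Fin n)))) ∨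
    ∃ (s : diskBoundary n) (τ : I), τ ≠ 1 ∧
      d = clip ((1 - τ / 2 : ℝ) • ((s : EuclideanDisk n) : EuclideanSpace ℝ (Fin n))) := by
  have hd := d.norm_le
  by_cases h : ‖(d : EuclideanSpace ℝ (Fin n))‖ ≤ 1 / 2
  · left
    refine ⟨clip ((2 : ℝ) • (d : EuclideanSpace ℝ (Fin n))), ?_⟩
    rw [clip_of_le, smul_smul]
    · norm_num
    · rw [norm_smul]; norm_num; linarith
  · right
    push Not at h
    have h1 : ‖(d : EuclideanSpace ℝ (Fin n))‖ ≠ 0 := by positivity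
    have h2 : ‖‖(d : EuclideanSpace ℝ (Fin n))‖⁻¹ • (d : EuclideanSpace ℝ (Fin n))‖ = 1 := by
      rw [norm_smul, norm_inv, norm_norm, inv_mul_cancel₀ h1]
    refine ⟨⟨⟨_, mem_closedBall_zero_iff.2 h2.le⟩, h2⟩,
      ⟨2 - 2 * ‖(d : EuclideanSpace ℝ (Fin n))‖, by linarith, by linarith⟩, ?_, ?_⟩
    · intro e
      have := congrArg Subtype.val e
      simp only [Icc.coe_one] at this
      linarith
    · have : (1 - (2 - 2 * ‖(d : EuclideanSpace ℝ (Fin n))‖) / 2) =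
        ‖(d : EuclideanSpace ℝ (Fin n))‖ := by ring
      simp only [this, smul_smul, mul_inv_cancel₀ h1, one_smul, clip_coe]

lemma norm_inner_lt (d : EuclideanDisk n) :
    ‖(clip ((1 / 2 : ℝ) • (d : EuclideanSpace ℝ (Fin n))) : EuclideanSpace ℝ (Fin n))‖ < 1 := by
  have h1 : ‖(1 / 2 : ℝ) • (d : EuclideanSpace ℝ (Fin n))‖ =
      1 / 2 * ‖(d : EuclideanSpace ℝ (Fin n))‖ := by
    rw [norm_smul]; norm_num
  have hd := d.norm_le
  rw [clip_of_le] <;> linarith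

lemma norm_collar (s : diskBoundary n) (τ : I) :
    ‖(clip ((1 - τ / 2 : ℝ) • ((s : EuclideanDisk n) : EuclideanSpace ℝ (Fin n))) :
      EuclideanSpace ℝ (Fin n))‖ = 1 - τ / 2 := by
  have hτ := τ.2
  have hs : ‖((s : EuclideanDisk n) : EuclideanSpace ℝ (Fin n))‖ = 1 := s.2
  have h1 : ‖(1 - τ / 2 : ℝ) • ((s : EuclideanDisk n) : EuclideanSpace ℝ (Fin n))‖ = 1 - τ / 2 := by
    rw [norm_smul, hs, Real.norm_of_nonneg (by linarith [hτ.2]), mul_one]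
  rw [clip_of_le] <;> linarith [hτ.1]

lemma continuous_attachCharFun : Continuous (attachCharFun φ) := by
  have hn : Continuous fun x : T × EuclideanDisk n => ‖(x.2 : EuclideanSpace ℝ (Fin n))‖ := by
    fun_prop
  refine continuous_of_isClosed_cover (A := {x | 1 / 2 ≤ ‖(x.2 : EuclideanSpace ℝ (Fin n))‖})
    (B := {x | ‖(x.2 : EuclideanSpace ℝ (Fin n))‖ ≤ 1 / 2}) (isClosed_le continuous_const hn)
    (isClosed_le hn continuous_const) (fun x => by simp only [mem_ofPred_eq]; exact le_total _ _) ?_ ?_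
  · have : ∀ x : {x : T × EuclideanDisk n | 1 / 2 ≤ ‖(x.2 : EuclideanSpace ℝ (Fin n))‖},
        ‖(x.1.2 : EuclideanSpace ℝ (Fin n))‖ ≠ 0 := fun x => by
      have : 1 / 2 ≤ ‖(x.1.2 : EuclideanSpace ℝ (Fin n))‖ := x.2
      positivity
    simp only [attachCharFun]
    have h : ∀ x : {x : T × EuclideanDisk n | 1 / 2 ≤ ‖(x.2 : EuclideanSpace ℝ (Fin n))‖},
      1 / 2 ≤ ‖(x.1.2 : EuclideanSpace ℝ (Fin n))‖ := fun x => x.2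
    simp only [h, dite_true]
    refine (map_continuous _).comp (Continuous.prodMk (Continuous.prodMk (by fun_prop)
      (Continuous.subtype_mk (clip.continuous.comp ?_) _)) (continuous_projIcc.comp (by fun_prop)))
    fun_prop (disch := exact this _)
  · have : ∀ x : {x : T × EuclideanDisk n | ‖(x.2 : EuclideanSpace ℝ (Fin n))‖ ≤ 1 / 2},
        attachCharFun φ x = inr φ (boundaryInclusion G T n) (x.1.1,
          clip ((2 : ℝ) • (x.1.2 : EuclideanSpace ℝ (Fin n)))) := by
      rintro ⟨⟨t, d⟩, hd⟩
      have hd' : ‖(d : EuclideanSpace ℝ (Fin n))‖ ≤ 1 / 2 := hd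
      rw [← attachCharFun_inner, clip_of_le (v := (2 : ℝ) • (d : EuclideanSpace ℝ (Fin n))),
        smul_smul]
      · norm_num
      · rw [norm_smul]; norm_num; linarith
    simp only [this]
    fun_prop

/-- The characteristic map of `T × D` in `Attach φ`. -/
noncomputable def attachChar : GHom G (T × EuclideanDisk n) (Attach φ) :=
  .of (attachCharFun φ) (continuous_attachCharFun φ) (by
    rintro g ⟨t, d⟩
    simp only [attachCharFun, smul_mk_trivial]
    split_ifs <;> rfl)

/-- A disk with an outer collar glued on is again a disk. Thus the homotopy invariant construction
is a strict cell attachment, and it retains `φ` as its attaching map. -/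
theorem isAttachment_attach : IsAttachment (diskBoundary n) (inlG φ _) (attachChar φ) where
  isClosedEmbedding := isClosedEmbedding_inl _ _
  mem_range_iff t d := by
    rcases disk_cases d with ⟨d, rfl⟩ | ⟨s, τ, hτ, rfl⟩
    · simp only [attachChar, GHom.of_apply, attachCharFun_inner, mem_range, mem_ofPred_eq]
      exact iff_of_false (fun ⟨x, hx⟩ => inl_ne_inr _ _ _ _ hx) (norm_inner_lt d).ne
    · simp only [attachChar, GHom.of_apply, attachCharFun_collar, mem_range, mem_ofPred_eq,
        norm_collar]
      constructor
      · rintro ⟨x, hx⟩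
        obtain ⟨rfl, -⟩ := cyl_eq_inl _ _ hx.symm
        simp
      · intro h
        obtain rfl : τ = 0 := by ext; simp only [Icc.coe_zero]; linarith
        exact ⟨φ (t, s), (cyl_zero _ _ _).symm⟩
  injective t d t' d' hd hd' h := by
    simp only [attachChar, GHom.of_apply] at h
    rcases disk_cases d with ⟨d, rfl⟩ | ⟨s, τ, hτ, rfl⟩ <;>
      rcases disk_cases d' with ⟨d', rfl⟩ | ⟨s', τ', hτ', rfl⟩ <;>
      simp only [attachCharFun_inner, attachCharFun_collar] at h
    · have := inr_injective _ _ h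
      simp only [Prod.mk.injEq] at this
      exact ⟨this.1, by rw [this.2]⟩
    · exact absurd (cyl_eq_inr _ _ h.symm).1 hτ'
    · exact absurd (cyl_eq_inr _ _ h).1 hτ
    · have h0 : τ ≠ 0 := by
        rintro rfl
        exact hd (by simp only [mem_ofPred_eq, norm_collar]; simp)
      obtain ⟨h1, rfl⟩ := cyl_injective _ _ h0 hτ h
      simp only [Prod.mk.injEq] at h1
      exact ⟨h1.1, by rw [h1.2]⟩
  surjective y := by
    induction y using ind with
    | hl x => exact .inl ⟨x, rfl⟩
    | hr x => exact .inr ⟨_, attachCharFun_inner φ x.1 x.2⟩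
    | hc x τ => exact .inr ⟨_, attachCharFun_collar φ x.1 x.2 τ⟩
  isClosed_of A h1 h2 := by
    rw [isClosed_iff]
    refine ⟨h1, ?_, ?_⟩
    · have hc : Continuous fun x : (T × diskBoundary n) × I => (x.1.1, clip ((1 - x.2 / 2 : ℝ) •
        ((x.1.2 : EuclideanDisk n) : EuclideanSpace ℝ (Fin n)))) := by fun_prop
      convert h2.preimage hc using 1
      ext ⟨⟨t, s⟩, τ⟩
      simp [attachChar, attachCharFun_collar]
    · have hc : Continuous fun x : T × EuclideanDisk n => (x.1, clip ((1 / 2 : ℝ) •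
        (x.2 : EuclideanSpace ℝ (Fin n)))) := by fun_prop
      convert h2.preimage hc using 1
      ext ⟨t, d⟩
      simp only [mem_preimage, attachChar, GHom.of_apply, attachCharFun_inner]

lemma attachingMap_attach : (isAttachment_attach φ).attachingMap = φ := by
  ext ⟨t, s⟩
  apply inl_injective φ (boundaryInclusion G T n)
  have h := (isAttachment_attach φ).attachingMap_spec (t, s)
  have h2 := attachCharFun_collar φ t s 0
  simp only [Icc.coe_zero, zero_div, sub_zero, one_smul, clip_coe] at h2
  rw [inlG_apply] at h
  rw [h]
  exact h2.trans (cyl_zero _ _ _)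

end DoubleCyl

/-- An attachment is a double mapping cylinder. -/
theorem IsAttachment.equivalent_attach {G : Type u} [Group G] {X Y T : Type u} {n : ℕ}
    [TopologicalSpace X] [TopologicalSpace Y] [TopologicalSpace T] [MulAction G X] [MulAction G Y]
    [MulAction G T] [ContinuousConstSMul G X] [ContinuousConstSMul G Y] [ContinuousConstSMul G T]
    {i : GHom G X Y} {χ : GHom G (T × EuclideanDisk n) Y} (h : IsAttachment (diskBoundary n) i χ) :
    GEquivalent G Y (DoubleCyl.Attach h.attachingMap) :=
  h.equivalent_of_attachingMap_eq (DoubleCyl.isAttachment_attach _)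
    (DoubleCyl.attachingMap_attach _).symm

/-! ### Invariant subspaces and products of homotopies -/

section SubSpaces

variable {G : Type u} [Group G] {X Y : Type u} [TopologicalSpace X] [TopologicalSpace Y]
  [MulAction G X] [MulAction G Y]

instance [ContinuousConstSMul G X] (A : SubMulAction G X) : ContinuousConstSMul G A where
  continuous_const_smul g := by
    have : Continuous fun x : A => g • (x : X) := by fun_prop
    exact this.subtype_mk _

namespace GHom

/-- The inclusion of a `G`-subspace. -/
def val (A : SubMulAction G X) : GHom G A X := .of Subtype.val continuous_subtype_val (by simp)

@[simp] lemma val_apply (A : SubMulAction G X) (x : A) : val A x = x := rfl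

/-- Restriction of the codomain of a `G`-map. -/
def codRestrict (f : GHom G Y X) (A : SubMulAction G X) (h : ∀ y, f y ∈ A) : GHom G Y A :=
  .of (fun y => ⟨f y, h y⟩) (by fun_prop) (by intro g y; ext; simp)

@[simp] lemma coe_codRestrict (f : GHom G Y X) (A : SubMulAction G X) (h : ∀ y, f y ∈ A) (y : Y) :
    (f.codRestrict A h y : X) = f y := rfl

/-- The inclusion of a `G`-subspace in a larger one. -/
def incl {A B : SubMulAction G X} (h : A ≤ B) : GHom G A B := (val A).codRestrict B fun x => h x.2

@[simp] lemma coe_incl {A B : SubMulAction G X} (h : A ≤ B) (x : A) : (incl h x : X) = x := rfl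

end GHom

end SubSpaces

section ProdHomotopy

variable {G : Type u} [Group G] {X Y : Type u} [TopologicalSpace X] [TopologicalSpace Y]
  [MulAction G X] [MulAction G Y] [ContinuousConstSMul G X] [ContinuousConstSMul G Y]
  {D D' : Type} [TopologicalSpace D] [TopologicalSpace D']

lemma GHom.Homotopic.prodMap {f k : GHom G X Y} (h : f.Homotopic k) (c : C(D, D')) :
    (f.prodMap c).Homotopic (k.prodMap c) := by
  obtain ⟨H, h0, h1⟩ := h
  exact .of_uncurried (.of (fun x : (X × D) × I => (H x.1.1 x.2, c x.1.2)) (by fun_prop) (by simp))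
    (by simp [h0]) (by simp [h1])

lemma GHom.IsEquiv.prodMap {f : GHom G X Y} (h : f.IsEquiv) : (f.prodMap (.id D)).IsEquiv := by
  obtain ⟨k, h1, h2⟩ := h
  exact ⟨k.prodMap (.id D), h1.prodMap (.id D), h2.prodMap (.id D)⟩

end ProdHomotopy

/-! ### Products of disks and iterated attachments -/

section DiskProduct

/-- The product of two disks is a disk. -/
lemma exists_diskProd_homeomorph (m n : ℕ) :
    ∃ e : EuclideanDisk (m + n) ≃ₜ EuclideanDisk m × EuclideanDisk n,
      e ⁻¹' {p | p.1 ∈ diskBoundary m ∨ p.2 ∈ diskBoundary n} = diskBoundary (m + n) := by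
  let V := EuclideanSpace ℝ (Fin m) × EuclideanSpace ℝ (Fin n)
  let W := EuclideanSpace ℝ (Fin (m + n))
  let L : V ≃L[ℝ] W := ContinuousLinearEquiv.ofFinrankEq (by simp [V, W])
  let s : Set W := L '' Metric.closedBall (0 : V) 1
  have hs : s = L.symm ⁻¹' Metric.closedBall (0 : V) 1 := L.image_eq_preimage_symm _
  have hint : interior s = L '' Metric.ball (0 : V) 1 := by
    rw [← interior_closedBall (0 : V) one_ne_zero]
    exact (L.toHomeomorph.image_interior _).symm
  have hfr : frontier s = L '' Metric.sphere (0 : V) 1 := by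
    rw [← frontier_closedBall (0 : V) one_ne_zero]
    exact (L.toHomeomorph.image_frontier _).symm
  have hcl : closure s = s := by
    apply IsClosed.closure_eq
    exact L.toHomeomorph.isClosedMap _ Metric.isClosed_closedBall
  -- The product norm is the maximum, so the product of the disks is a unit ball whose sphere is
  -- exactly the set where one factor lies on its boundary. Its image under `L` is a bounded convex
  -- body, which is homeomorphic to the round ball with frontier going to the sphere.
  obtain ⟨h, h1, h2, h3⟩ := exists_homeomorph_image_interior_closure_frontier_eq_unitBall
    (s := s) ((convex_closedBall (0 : V) 1).linear_image L.toLinearEquiv.toLinearMap)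
    (by rw [hint]; exact (Metric.nonempty_ball.2 one_pos).image _)
    (by
      have := (isCompact_closedBall (0 : V) 1).image L.continuous
      exact this.isBounded)
  rw [hcl] at h2
  rw [hfr] at h3
  let E : V ≃ₜ W := L.toHomeomorph.trans h
  have hE2 : E '' Metric.closedBall (0 : V) 1 = Metric.closedBall 0 1 := by
    rw [← h2, image_image]; rfl
  have hE3 : E '' Metric.sphere (0 : V) 1 = Metric.sphere 0 1 := by
    rw [← h3, image_image]; rfl
  let e₁ : Metric.closedBall (0 : V) 1 ≃ₜ EuclideanDisk (m + n) :=
    (E.image _).trans (Homeomorph.setCongr hE2)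
  let e₂ : Metric.closedBall (0 : V) 1 ≃ₜ EuclideanDisk m × EuclideanDisk n :=
    (Homeomorph.setCongr (by
      rw [closedBall_prod_same]; rfl)).trans
      (Homeomorph.Set.prod (Metric.closedBall (0 : EuclideanSpace ℝ (Fin m)) 1)
        (Metric.closedBall (0 : EuclideanSpace ℝ (Fin n)) 1))
  refine ⟨e₁.symm.trans e₂, ?_⟩
  ext d
  obtain ⟨v, rfl⟩ := e₁.surjective d
  have k1 : (e₁ v : W) = E v := rfl
  have k2 : ((e₂ v).1 : EuclideanSpace ℝ (Fin m)) = (v : V).1 := rfl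
  have k3 : ((e₂ v).2 : EuclideanSpace ℝ (Fin n)) = (v : V).2 := rfl
  have hv : ‖(v : V)‖ ≤ 1 := mem_closedBall_zero_iff.1 v.2
  have k4 : ‖(E v : W)‖ = 1 ↔ ‖(v : V)‖ = 1 := by
    rw [← mem_sphere_zero_iff_norm, ← mem_sphere_zero_iff_norm, ← hE3]
    exact E.injective.mem_set_image
  simp only [mem_preimage, Homeomorph.trans_apply, Homeomorph.symm_apply_apply, mem_ofPred_eq, k1,
    k2, k3, k4]
  rw [Prod.norm_def] at hv ⊢
  have h1 := (max_le_iff.1 hv).1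
  have h2 := (max_le_iff.1 hv).2
  constructor
  · rintro (h | h) <;> rw [h] at * <;> simp [*]
  · intro h
    rcases max_choice ‖(v : V).1‖ ‖(v : V).2‖ with h' | h' <;> rw [h'] at h <;> simp [h]

end DiskProduct

section Product

variable {G : Type u} [Group G] {X Y T : Type u} {D : Type} [TopologicalSpace X]
  [TopologicalSpace Y] [TopologicalSpace T] [TopologicalSpace D]
  [MulAction G X] [MulAction G Y] [MulAction G T]

/-- An open subset of `Y × W` is a continuous map to the Sierpiński space `Prop`, hence by the
exponential law for locally compact `W` a continuous map from `Y` to `C(W, Prop)`. Its continuity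
can be tested on `X` and `T × D`. -/
lemma IsAttachment.isClosed_prod {S : Set D} {i : GHom G X Y} {χ : GHom G (T × D) Y}
    (h : IsAttachment S i χ) {W : Type} [TopologicalSpace W] [LocallyCompactSpace W]
    {A : Set (Y × W)} (h1 : IsClosed {x : X × W | (i x.1, x.2) ∈ A})
    (h2 : IsClosed {x : (T × D) × W | (χ x.1, x.2) ∈ A}) : IsClosed A := by
  have c1 : Continuous fun x : X × W => (i x.1, x.2) ∉ A := by
    rw [continuous_Prop]; exact h1.isOpen_compl
  have c2 : Continuous fun x : (T × D) × W => (χ x.1, x.2) ∉ A := by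
    rw [continuous_Prop]; exact h2.isOpen_compl
  have hy : ∀ y, Continuous fun w : W => (y, w) ∉ A := by
    intro y
    induction y using h.ind with
    | hl x => exact c1.comp (Continuous.prodMk_right x)
    | hr t d => exact c2.comp (Continuous.prodMk_right (t, d))
  let F : Y → C(W, Prop) := fun y => ⟨fun w => (y, w) ∉ A, hy y⟩
  have hF : Continuous F := by
    rw [h.continuous_iff]
    exact ⟨map_continuous (ContinuousMap.curry ⟨_, c1⟩), map_continuous (ContinuousMap.curry ⟨_, c2⟩)⟩
  have : Continuous fun x : Y × W => F x.1 x.2 := by fun_prop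
  have h3 := continuous_Prop.1 this
  rw [← isOpen_compl_iff]
  exact h3

end Product

section IteratedAttachment

variable {G : Type u} [Group G] {X Y T T₀ T₁ : Type u} {D D₀ : Type} [TopologicalSpace X]
  [TopologicalSpace Y] [TopologicalSpace T] [TopologicalSpace T₀] [TopologicalSpace T₁]
  [TopologicalSpace D] [TopologicalSpace D₀]
  [MulAction G X] [MulAction G Y] [MulAction G T] [MulAction G T₀] [MulAction G T₁]

namespace IsAttachment

variable {S : Set D} {S₀ : Set D₀} {i : GHom G X Y} {χ : GHom G (T × D) Y} {j : GHom G T₁ T}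
  {ψ : GHom G (T₀ × D₀) T}

variable (i χ j) in
/-- The intermediate stage of an attachment of `T × D`, where only `T₁ × D` is attached. -/
def intermediate : SubMulAction G Y where
  carrier := range i ∪ range fun x : T₁ × D => χ (j x.1, x.2)
  smul_mem' := by
    rintro g _ (⟨x, rfl⟩ | ⟨x, rfl⟩)
    · exact .inl ⟨g • x, i.map_smul g x⟩
    · exact .inr ⟨g • x, by
        simp only [smul_fst_trivial, smul_snd_trivial, j.map_smul]
        exact χ.map_smul g (j x.1, x.2)⟩

lemma mem_intermediate {y : Y} : y ∈ intermediate i χ j ↔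
    (∃ x, i x = y) ∨ ∃ (t : T₁) (d : D), χ (j t, d) = y := by
  refine or_congr Iff.rfl ?_
  simp [Prod.exists]

variable (h : IsAttachment S i χ) (hT : IsAttachment S₀ j ψ) (hS : IsClosed S)

include h hT hS

/-- A point of `T × D` that `χ` sends into `A` lies over the image of `T₁` or has second coordinate
in `S`. The first set is closed by `h2`; the second is controlled by `X` through the attaching map.
-/
lemma isClosed_of_subset_intermediate {A : Set Y} (hA : ∀ y ∈ A, y ∈ intermediate i χ j)
    (h1 : IsClosed (i ⁻¹' A)) (h2 : IsClosed {x : T₁ × D | χ (j x.1, x.2) ∈ A}) : IsClosed A := by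
  refine h.isClosed_of A h1 ?_
  have e : χ ⁻¹' A = (Prod.map j id '' {x : T₁ × D | χ (j x.1, x.2) ∈ A}) ∪
      (Prod.map id Subtype.val '' (h.attachingMap ⁻¹' (i ⁻¹' A))) := by
    ext ⟨t, d⟩
    constructor
    · intro hx
      have hx' : χ (t, d) ∈ A := hx
      by_cases hd : d ∈ S
      · refine .inr ⟨(t, ⟨d, hd⟩), ?_, rfl⟩
        rw [mem_preimage, mem_preimage, h.attachingMap_spec]
        exact hx'
      · rcases mem_intermediate.1 (hA _ hx') with hy | ⟨t', d', hy⟩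
        · exact absurd ((h.mem_range_iff t d).1 hy) hd
        · have hd' : d' ∉ S := fun hd' => hd ((h.mem_range_iff t d).1
            (hy ▸ (h.mem_range_iff _ _).2 hd'))
          obtain ⟨rfl, rfl⟩ := h.injective _ _ _ _ hd' hd hy
          exact .inl ⟨(t', d'), hx', rfl⟩
    · rintro (⟨⟨t', d'⟩, hx, he⟩ | ⟨⟨t', d'⟩, hx, he⟩)
      · rw [← he]; exact hx
      · rw [← he]
        rw [mem_preimage, mem_preimage, h.attachingMap_spec] at hx
        exact hx
  rw [e]
  refine IsClosed.union ?_ ?_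
  · exact (hT.isClosedEmbedding.prodMap IsClosedEmbedding.id).isClosedMap _ h2
  · exact (IsClosedEmbedding.id.prodMap hS.isClosedEmbedding_subtypeVal).isClosedMap _
      (h1.preimage h.attachingMap.continuous)

lemma isClosed_intermediate : IsClosed (intermediate i χ j : Set Y) := by
  refine h.isClosed_of_subset_intermediate hT hS (fun y hy => hy) ?_ ?_
  · convert isClosed_univ
    ext x
    simp only [mem_preimage, mem_univ, iff_true, SetLike.mem_coe]
    exact mem_intermediate.2 (.inl ⟨x, rfl⟩)
  · convert isClosed_univ
    ext x
    simp only [mem_ofPred_eq, mem_univ, iff_true, SetLike.mem_coe]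
    exact mem_intermediate.2 (.inr ⟨x.1, x.2, rfl⟩)

/-- Attaching `T × D` restricts to attaching `T₁ × D`. -/
theorem attachment_intermediate : IsAttachment S
    (i.codRestrict (intermediate i χ j) fun x => mem_intermediate.2 (.inl ⟨x, rfl⟩))
    ((χ.comp (j.prodMap (.id D))).codRestrict (intermediate i χ j)
      fun x => mem_intermediate.2 (.inr ⟨x.1, x.2, rfl⟩)) where
  isClosedEmbedding := by
    rw [← (h.isClosed_intermediate hT hS).isClosedEmbedding_subtypeVal.of_comp_iff]
    exact h.isClosedEmbedding
  mem_range_iff t d := by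
    rw [← h.mem_range_iff (j t) d]
    constructor
    · rintro ⟨x, hx⟩; exact ⟨x, congrArg Subtype.val hx⟩
    · rintro ⟨x, hx⟩; exact ⟨x, Subtype.ext hx⟩
  injective t d t' d' hd hd' e := by
    obtain ⟨h1, h2⟩ := h.injective _ _ _ _ hd hd' (congrArg Subtype.val e)
    exact ⟨hT.isClosedEmbedding.injective h1, h2⟩
  surjective y := by
    rcases mem_intermediate.1 y.2 with ⟨x, hx⟩ | ⟨t, d, hx⟩
    · exact .inl ⟨x, Subtype.ext hx⟩
    · exact .inr ⟨(t, d), Subtype.ext hx⟩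
  isClosed_of A h1 h2 := by
    have hA : IsClosed (Subtype.val '' A) := by
      refine h.isClosed_of_subset_intermediate hT hS ?_ ?_ ?_
      · rintro _ ⟨y, _, rfl⟩; exact y.2
      · convert h1 using 1
        ext x
        constructor
        · rintro ⟨y, hy, e⟩
          rw [mem_preimage]
          convert hy
          exact Subtype.ext e.symm
        · intro hx; exact ⟨_, hx, rfl⟩
      · convert h2 using 1
        ext x
        constructor
        · rintro ⟨y, hy, e⟩
          rw [mem_preimage]
          convert hy
          exact Subtype.ext e.symm
        · intro hx; exact ⟨_, hx, rfl⟩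
    convert hA.preimage continuous_subtype_val
    exact (preimage_image_eq _ Subtype.val_injective).symm

variable (χ ψ) in
omit h hT hS in
/-- The characteristic map for the second stage of an iterated attachment. -/
def intermediateChar : GHom G (T₀ × (D₀ × D)) Y :=
  .of (fun x => χ (ψ (x.1, x.2.1), x.2.2)) (by fun_prop) (by
    intro g x
    simp only [smul_fst_trivial, smul_snd_trivial]
    rw [← smul_mk_trivial, ψ.map_smul, ← smul_mk_trivial, χ.map_smul])

/-- The second stage of an iterated attachment. -/
theorem attachment_of_intermediate [LocallyCompactSpace D] :
    IsAttachment {p : D₀ × D | p.1 ∈ S₀ ∨ p.2 ∈ S} (GHom.val (intermediate i χ j))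
      (intermediateChar χ ψ) where
  isClosedEmbedding := (h.isClosed_intermediate hT hS).isClosedEmbedding_subtypeVal
  mem_range_iff t := by
    rintro ⟨d, e⟩
    have : intermediateChar χ ψ (t, d, e) ∈ range (GHom.val (intermediate i χ j)) ↔
        χ (ψ (t, d), e) ∈ intermediate i χ j := by
      constructor
      · rintro ⟨y, hy⟩
        have hy' : (y : Y) = χ (ψ (t, d), e) := hy
        exact hy' ▸ y.2
      · intro hy
        exact ⟨⟨_, hy⟩, rfl⟩
    rw [this, mem_intermediate, mem_ofPred_eq]
    constructor
    · rintro (hx | ⟨t', d', hx⟩)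
      · exact .inr ((h.mem_range_iff _ _).1 hx)
      · by_cases he : e ∈ S
        · exact .inr he
        · have he' : d' ∉ S := fun he' => he ((h.mem_range_iff _ _).1
            (hx ▸ (h.mem_range_iff _ _).2 he'))
          obtain ⟨h1, -⟩ := h.injective _ _ _ _ he' he hx
          exact .inl ((hT.mem_range_iff t d).1 ⟨t', h1⟩)
    · rintro (hd | he)
      · obtain ⟨t', ht'⟩ := (hT.mem_range_iff t d).2 hd
        exact .inr ⟨t', e, by rw [ht']⟩
      · exact .inl ((h.mem_range_iff _ _).2 he)
  injective := by
    rintro t ⟨d, e⟩ t' ⟨d', e'⟩ hd hd' hx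
    simp only [mem_ofPred_eq, not_or] at hd hd'
    obtain ⟨h1, h2⟩ := h.injective _ _ _ _ hd.2 hd'.2 hx
    obtain ⟨h3, h4⟩ := hT.injective _ _ _ _ hd.1 hd'.1 h1
    exact ⟨h3, Prod.ext h4 h2⟩
  surjective y := by
    rcases h.surjective y with hy | ⟨⟨t, d⟩, rfl⟩
    · exact .inl ⟨⟨y, mem_intermediate.2 (.inl hy)⟩, rfl⟩
    · rcases hT.surjective t with ⟨t', rfl⟩ | ⟨⟨t', d'⟩, rfl⟩
      · exact .inl ⟨⟨_, mem_intermediate.2 (.inr ⟨t', d, rfl⟩)⟩, rfl⟩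
      · exact .inr ⟨(t', d', d), rfl⟩
  isClosed_of A h1 h2 := by
    refine h.isClosed_of A ?_ ?_
    · exact h1.preimage (i.codRestrict (intermediate i χ j)
        fun x => mem_intermediate.2 (.inl ⟨x, rfl⟩)).continuous
    -- The topology of `T × D` is detected on `T₁ × D` and `(T₀ × D₀) × D`; local compactness of `D`
    -- enters here.
    · refine hT.isClosed_prod ?_ ?_
      · exact h1.preimage ((χ.comp (j.prodMap (.id D))).codRestrict (intermediate i χ j)
          fun x => mem_intermediate.2 (.inr ⟨x.1, x.2, rfl⟩)).continuous
      · exact h2.preimage (by fun_prop : Continuous fun x : (T₀ × D₀) × D =>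
          (x.1.1, x.1.2, x.2))

end IsAttachment

end IteratedAttachment

/-! ### Cellular `G`-spaces -/

section Cellular

/-- The `G`-spaces obtained from the empty space by finitely many steps, each of which is a
`G`-homotopy equivalence or the attachment of an equivariant cell. -/
inductive IsCellular (G : Type u) [Group G] : ∀ (X : Type u) [TopologicalSpace X] [MulAction G X]
    [ContinuousConstSMul G X], Prop
  | empty (X : Type u) [TopologicalSpace X] [MulAction G X] [ContinuousConstSMul G X] [IsEmpty X] :
      IsCellular G X
  | equiv {X Y : Type u} [TopologicalSpace X] [MulAction G X] [ContinuousConstSMul G X]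
      [TopologicalSpace Y] [MulAction G Y] [ContinuousConstSMul G Y] (hX : IsCellular G X)
      (h : GEquivalent G X Y) : IsCellular G Y
  | attach {X Y T : Type u} [TopologicalSpace X] [MulAction G X] [ContinuousConstSMul G X]
      [TopologicalSpace Y] [MulAction G Y] [ContinuousConstSMul G Y] [TopologicalSpace T]
      [MulAction G T] [DiscreteTopology T] [MulAction.IsPretransitive G T] [Nonempty T] {n : ℕ}
      {i : GHom G X Y} {χ : GHom G (T × EuclideanDisk n) Y} (hX : IsCellular G X)
      (h : IsAttachment (diskBoundary n) i χ) : IsCellular G Y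

lemma isClosed_diskBoundary (n : ℕ) : IsClosed (diskBoundary n) :=
  isClosed_eq (by fun_prop) continuous_const

variable {G : Type u} [Group G]

/-- Attaching `T × D` to a cellular space yields a cellular space, if `T` is cellular. -/
theorem IsCellular.of_isAttachment {T : Type u} [TopologicalSpace T] [MulAction G T]
    [ContinuousConstSMul G T] (hT : IsCellular G T) :
    ∀ {X Y : Type u} [TopologicalSpace X] [MulAction G X] [ContinuousConstSMul G X]
      [TopologicalSpace Y] [MulAction G Y] [ContinuousConstSMul G Y] {n : ℕ}
      {i : GHom G X Y} {χ : GHom G (T × EuclideanDisk n) Y} (_ : IsCellular G X)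
      (_ : IsAttachment (diskBoundary n) i χ), IsCellular G Y := by
  induction hT with
  | empty T =>
    intro X Y _ _ _ _ _ _ n i χ hX h
    refine hX.equiv ⟨i, .of_bijective_isClosedMap i ⟨h.isClosedEmbedding.injective, fun y => ?_⟩
      h.isClosedEmbedding.isClosedMap⟩
    rcases h.surjective y with hy | ⟨x, _⟩
    · exact hy
    · exact isEmptyElim x.1
  | @equiv T T' _ _ _ _ _ _ hT e ih =>
    intro X Y _ _ _ _ _ _ n i χ hX h
    obtain ⟨f, hf⟩ := e.symm
    obtain ⟨k, hk1, hk2⟩ := hf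
    have hf : f.IsEquiv := ⟨k, hk1, hk2⟩
    -- Transport the attaching map along the homotopy inverse; the double cylinder does not notice
    -- the change.
    let φ : GHom G (T × diskBoundary n) X :=
      h.attachingMap.comp (k.prodMap (.id (diskBoundary n)))
    have hφ : GEquivalent G Y (DoubleCyl.Attach φ) := by
      refine h.equivalent_attach.trans (DoubleCyl.equivalent_of_isEquiv (GHom.IsEquiv.id G X)
        (hf.prodMap (D := diskBoundary n)) (hf.prodMap (D := EuclideanDisk n)) ?_ (.of_eq ?_))
      · exact (hk1.symm.prodMap (.id (diskBoundary n))).comp_left h.attachingMap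
      · intro x; rfl
    exact (ih hX (DoubleCyl.isAttachment_attach φ)).equiv hφ.symm
  | @attach T₁ T T₀ _ _ _ _ _ _ _ _ _ _ _ m j ψ hT₁ hT ih =>
    intro X Y _ _ _ _ _ _ n i χ hX h
    have hS := isClosed_diskBoundary n
    -- Attach `T₁ × Dⁿ` by the inductive hypothesis. What remains is `T₀ × Dᵐ × Dⁿ`, a single cell
    -- of dimension `m + n`.
    have h1 := ih hX (h.attachment_intermediate hT hS)
    obtain ⟨e, he⟩ := exists_diskProd_homeomorph m n
    have h2 := (h.attachment_of_intermediate hT hS).congr_model e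
    rw [he] at h2
    exact h1.attach h2

end Cellular

/-! ### Closed covers as double mapping cylinders -/

section Cover

variable {G : Type u} [Group G] {X : Type u} [TopologicalSpace X] [MulAction G X]
  [ContinuousConstSMul G X]

variable (N P : SubMulAction G X)

/-- The thickened cover in `X × I` associated with a cover of `X` by two subspaces. -/
def thickCover : SubMulAction G (X × I) where
  carrier := {x | (x.2 ≠ 1 → x.1 ∈ N) ∧ (x.2 ≠ 0 → x.1 ∈ P)}
  smul_mem' g _ hx := ⟨fun h => N.smul_mem g (hx.1 h), fun h => P.smul_mem g (hx.2 h)⟩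

lemma mem_thickCover {x : X} {t : I} :
    (x, t) ∈ thickCover N P ↔ (t ≠ 1 → x ∈ N) ∧ (t ≠ 0 → x ∈ P) := Iff.rfl

/-- The space is equivalent to the thickened cover. -/
theorem equivalent_thickCover {τ : X → I} (hτ : Continuous τ) (hinv : ∀ (g : G) x, τ (g • x) = τ x)
    (hN : ∀ x, τ x ≠ 1 → x ∈ N) (hP : ∀ x, τ x ≠ 0 → x ∈ P) :
    GEquivalent G X (thickCover N P) := by
  -- The graph of `τ` is a section of the projection, and sliding the second coordinate linearly
  -- towards `τ x` deforms the thickened cover onto it.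
  let f : GHom G X (thickCover N P) :=
    (GHom.of (fun x => (x, τ x)) (by fun_prop) (by intro g x; simp [hinv])).codRestrict _
      fun x => ⟨hN x, hP x⟩
  let k : GHom G (thickCover N P) X := .of (fun x => x.1.1) (by fun_prop) (fun _ _ => rfl)
  have cvx : ∀ (w t s : I), ∃ r : I, (r : ℝ) = (1 - w) * t + w * s := by
    intro w t s
    refine ⟨⟨(1 - w) * t + w * s, ?_⟩, rfl⟩
    exact (convex_Icc (0 : ℝ) 1) t.2 s.2 (by linarith [w.2.2]) w.2.1 (by ring)
  let c : C((I × I) × I, I) := ⟨fun x => projIcc 0 1 zero_le_one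
    ((1 - x.2 : ℝ) * x.1.1 + x.2 * x.1.2), continuous_projIcc.comp (by fun_prop)⟩
  have hc : ∀ w t s, (c ((t, s), w) : ℝ) = (1 - w) * t + w * s := by
    intro w t s
    obtain ⟨r, hr⟩ := cvx w t s
    simp only [c, ContinuousMap.coe_mk, ← hr, projIcc_val]
  refine ⟨f, k, .of_eq fun x => rfl, GHom.Homotopic.symm (.of_uncurried
    ((GHom.of (X := thickCover N P × I) (fun x => (x.1.1.1, c ((x.1.1.2, τ x.1.1.1), x.2)))
      (by fun_prop) ?_).codRestrict _ ?_) ?_ ?_)⟩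
  · rintro g ⟨⟨⟨x, t⟩, hx⟩, w⟩
    refine Prod.ext rfl ?_
    change c ((t, τ (g • x)), w) = c ((t, τ x), w)
    rw [hinv]
  · rintro ⟨⟨⟨x, t⟩, hx⟩, w⟩
    rw [mem_thickCover] at hx
    -- If the interpolated value differs from `1`, then `t` or `τ x` differs from `1`, and either
    -- puts `x` in `N`. The same holds for `0` and `P`.
    rw [GHom.of_apply, mem_thickCover]
    simp only
    constructor
    · intro h
      by_cases ht : t = 1
      · by_cases hx : τ x = 1
        · exact absurd (Subtype.ext (by rw [hc, ht, hx]; simp)) h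
        · exact hN x hx
      · exact hx.1 ht
    · intro h
      by_cases ht : t = 0
      · by_cases hx : τ x = 0
        · exact absurd (Subtype.ext (by rw [hc, ht, hx]; simp)) h
        · exact hP x hx
      · exact hx.2 ht
  · rintro ⟨⟨x, t⟩, hx⟩
    exact Subtype.ext (Prod.ext rfl (Subtype.ext (by simp [hc])))
  · rintro ⟨⟨x, t⟩, hx⟩
    exact Subtype.ext (Prod.ext rfl (Subtype.ext (by simp only [GHom.coe_codRestrict, GHom.of_apply, hc]; simp; rfl)))

lemma isClosedEmbedding_slice {A : SubMulAction G X} (hA : IsClosed (A : Set X)) (t : I) :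
    IsClosedEmbedding fun x : A => ((x : X), t) := by
  refine .of_continuous_injective_isClosedMap (by fun_prop) (fun x y h => ?_) fun K hK => ?_
  · exact Subtype.ext (congrArg Prod.fst h)
  · have : (fun x : A => ((x : X), t)) '' K = (Subtype.val '' K) ×ˢ {t} := by
      ext ⟨x, s⟩
      simp only [mem_image, Prod.mk.injEq, mem_prod, mem_singleton_iff]
      constructor
      · rintro ⟨a, h1, h2, h3⟩; exact ⟨⟨a, h1, h2⟩, h3.symm⟩
      · rintro ⟨⟨a, h1, h2⟩, h3⟩; exact ⟨a, h1, h2, h3.symm⟩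
    rw [this]
    exact (hA.isClosedEmbedding_subtypeVal.isClosedMap _ hK).prod isClosed_singleton

variable {N P} in
/-- The double mapping cylinder of a closed cover is the thickened cover. -/
theorem doubleCyl_equivalent_thickCover (hN : IsClosed (N : Set X)) (hP : IsClosed (P : Set X)) :
    GEquivalent G (DoubleCyl (GHom.incl (inf_le_left : N ⊓ P ≤ N))
      (GHom.incl (inf_le_right : N ⊓ P ≤ P))) (thickCover N P) := by
  let a : GHom G N (thickCover N P) :=
    (GHom.of (fun x : N => ((x : X), (0 : I))) (by fun_prop) (fun _ _ => rfl)).codRestrict _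
      fun x => ⟨fun _ => x.2, fun h => absurd rfl h⟩
  let b : GHom G P (thickCover N P) :=
    (GHom.of (fun x : P => ((x : X), (1 : I))) (by fun_prop) (fun _ _ => rfl)).codRestrict _
      fun x => ⟨fun h => absurd rfl h, fun _ => x.2⟩
  let c : GHom G (↥(N ⊓ P) × I) (thickCover N P) :=
    (GHom.of (fun x : ↥(N ⊓ P) × I => ((x.1 : X), x.2)) (by fun_prop) (fun _ _ => rfl)).codRestrict _
      fun x => ⟨fun _ => x.1.2.1, fun _ => x.1.2.2⟩
  let F := DoubleCyl.desc (f := GHom.incl (inf_le_left : N ⊓ P ≤ N))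
    (g := GHom.incl (inf_le_right : N ⊓ P ≤ P)) a c b (fun _ => rfl) (fun _ => rfl)
  -- Every point of the cylinder can be recovered from its image, separately over `0`, over `1` and
  -- in between. Injectivity follows.
  have key : ∀ y, (∃ h : (F y).1.2 = 0, y = DoubleCyl.inl _ _ ⟨(F y).1.1, (F y).2.1 (by simp [h])⟩) ∨
      (∃ h : (F y).1.2 = 1, y = DoubleCyl.inr _ _ ⟨(F y).1.1, (F y).2.2 (by simp [h])⟩) ∨
      (∃ h : (F y).1.2 ≠ 0 ∧ (F y).1.2 ≠ 1,
        y = DoubleCyl.cyl _ _ (⟨(F y).1.1, (F y).2.1 h.2, (F y).2.2 h.1⟩, (F y).1.2)) := by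
    intro y
    induction y using DoubleCyl.ind with
    | hl n => exact .inl ⟨rfl, rfl⟩
    | hr n => exact .inr (.inl ⟨rfl, rfl⟩)
    | hc x t =>
      by_cases h0 : t = 0
      · subst h0; exact .inl ⟨rfl, DoubleCyl.cyl_zero _ _ _⟩
      · by_cases h1 : t = 1
        · subst h1; exact .inr (.inl ⟨rfl, DoubleCyl.cyl_one _ _ _⟩)
        · exact .inr (.inr ⟨⟨h0, h1⟩, rfl⟩)
  refine ⟨F, .of_bijective_isClosedMap F ⟨?_, ?_⟩ ?_⟩
  · intro y z h
    rcases key y with ⟨h1, e1⟩ | ⟨h1, e1⟩ | ⟨h1, e1⟩ <;>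
      rcases key z with ⟨h2, e2⟩ | ⟨h2, e2⟩ | ⟨h2, e2⟩ <;>
      first
      | (rw [e1, e2]; simp only [h]; done)
      | (rw [h] at h1; simp [h2] at h1)
  · rintro ⟨⟨x, t⟩, hx⟩
    by_cases h0 : t = 0
    · subst h0; exact ⟨DoubleCyl.inl _ _ ⟨x, hx.1 (by simp)⟩, rfl⟩
    · by_cases h1 : t = 1
      · subst h1; exact ⟨DoubleCyl.inr _ _ ⟨x, hx.2 (by simp)⟩, rfl⟩
      · exact ⟨DoubleCyl.cyl _ _ (⟨x, hx.1 h1, hx.2 h0⟩, t), rfl⟩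
  · intro K hK
    obtain ⟨k1, k2, k3⟩ := (DoubleCyl.isClosed_iff _ _ K).1 hK
    have e : Subtype.val '' (F '' K) =
        ((fun x : N => ((x : X), (0 : I))) '' (DoubleCyl.inl _ _ ⁻¹' K)) ∪
        (Prod.map Subtype.val id '' (DoubleCyl.cyl _ _ ⁻¹' K)) ∪
        ((fun x : P => ((x : X), (1 : I))) '' (DoubleCyl.inr _ _ ⁻¹' K)) := by
      ext x
      constructor
      · rintro ⟨_, ⟨y, hy, rfl⟩, rfl⟩
        induction y using DoubleCyl.ind with
        | hl n => exact .inl (.inl ⟨n, hy, rfl⟩)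
        | hr n => exact .inr ⟨n, hy, rfl⟩
        | hc x t => exact .inl (.inr ⟨(x, t), hy, rfl⟩)
      · rintro ((⟨n, hn, rfl⟩ | ⟨n, hn, rfl⟩) | ⟨n, hn, rfl⟩)
        · exact ⟨_, ⟨_, hn, rfl⟩, rfl⟩
        · exact ⟨_, ⟨_, hn, rfl⟩, rfl⟩
        · exact ⟨_, ⟨_, hn, rfl⟩, rfl⟩
    have hcl : IsClosed (Subtype.val '' (F '' K)) := by
      rw [e]
      refine ((( isClosedEmbedding_slice hN 0).isClosedMap _ k1).union ?_).union
        ((isClosedEmbedding_slice hP 1).isClosedMap _ k3)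
      have hNP : IsClosed ((N ⊓ P : SubMulAction G X) : Set X) := by
        have : ((N ⊓ P : SubMulAction G X) : Set X) = (N : Set X) ∩ P := rfl
        rw [this]; exact hN.inter hP
      exact (hNP.isClosedEmbedding_subtypeVal.prodMap IsClosedEmbedding.id).isClosedMap _ k2
    convert hcl.preimage continuous_subtype_val
    exact (preimage_image_eq _ Subtype.val_injective).symm

variable {N P} in
/-- A `G`-space is the double mapping cylinder of a closed cover with a partition function. -/
theorem equivalent_doubleCyl_of_cover (hNc : IsClosed (N : Set X)) (hPc : IsClosed (P : Set X))
    {τ : X → I} (hτ : Continuous τ) (hinv : ∀ (g : G) x, τ (g • x) = τ x)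
    (hN : ∀ x, τ x ≠ 1 → x ∈ N) (hP : ∀ x, τ x ≠ 0 → x ∈ P) :
    GEquivalent G X (DoubleCyl (GHom.incl (inf_le_left : N ⊓ P ≤ N))
      (GHom.incl (inf_le_right : N ⊓ P ≤ P))) :=
  (equivalent_thickCover N P hτ hinv hN hP).trans (doubleCyl_equivalent_thickCover hNc hPc).symm

end Cover

/-! ### Induction from a subgroup -/

/-- The induced `G`-space `G ×_H X` of an `H`-space `X`, described using representatives of the
cosets in `G ⧸ H`. -/
def Ind {G : Type u} [Group G] (H : Subgroup G) (X : Type u) : Type u := (G ⧸ H) × X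

namespace Ind

variable {G : Type u} [Group G] {H : Subgroup G} {X Y T : Type u}

/-- The element of the induced space given by a coset and a point. -/
def mk (c : G ⧸ H) (x : X) : Ind H X := (c, x)

lemma mk_injective {c c' : G ⧸ H} {x x' : X} (h : mk c x = mk c' x') : c = c' ∧ x = x' :=
  Prod.mk.inj h

lemma exists_mk (z : Ind H X) : ∃ c x, z = mk c x := ⟨z.1, z.2, rfl⟩

variable (H) in
/-- The element of `H` by which `g` acts on the coset `c`, relative to coset representatives. -/
noncomputable def cocycle (g : G) (c : G ⧸ H) : H :=
  ⟨(g • c).out⁻¹ * (g * c.out), by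
    rw [← QuotientGroup.eq, QuotientGroup.out_eq', ← smul_eq_mul, ← MulAction.Quotient.coe_smul_out]⟩

lemma out_mul_cocycle (g : G) (c : G ⧸ H) : (g • c).out * (cocycle H g c : G) = g * c.out := by
  simp [cocycle]

noncomputable instance [MulAction H X] : MulAction G (Ind H X) where
  smul g z := mk (g • z.1) (cocycle H g z.1 • z.2)
  one_smul z := by
    refine Prod.ext (one_smul G z.1) ?_
    have : cocycle H 1 z.1 = 1 := Subtype.ext (by simp [cocycle])
    change cocycle H 1 z.1 • z.2 = z.2
    rw [this, one_smul]
  mul_smul g k z := by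
    refine Prod.ext (mul_smul g k z.1) ?_
    have : cocycle H (g * k) z.1 = cocycle H g (k • z.1) * cocycle H k z.1 :=
      Subtype.ext (by simp [cocycle, mul_smul, mul_assoc])
    change cocycle H (g * k) z.1 • z.2 = cocycle H g (k • z.1) • cocycle H k z.1 • z.2
    rw [this, mul_smul]

lemma smul_mk [MulAction H X] (g : G) (c : G ⧸ H) (x : X) :
    g • mk c x = mk (g • c) (cocycle H g c • x) := rfl

section Topology

variable [TopologicalSpace X] [TopologicalSpace Y] [TopologicalSpace T]

instance : TopologicalSpace (Ind H X) := @instTopologicalSpaceProd (G ⧸ H) X ⊥ _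

lemma continuous_iff {Z : Type*} [TopologicalSpace Z] {f : Ind H X → Z} :
    Continuous f ↔ ∀ c, Continuous fun x => f (mk c x) := by
  let _ : TopologicalSpace (G ⧸ H) := ⊥
  have : DiscreteTopology (G ⧸ H) := ⟨rfl⟩
  exact continuous_prod_of_discrete_left

lemma continuous_mk (c : G ⧸ H) : Continuous (mk c : X → Ind H X) :=
  continuous_iff.1 continuous_id c

lemma isClosed_iff {A : Set (Ind H X)} : IsClosed A ↔ ∀ c, IsClosed (mk c ⁻¹' A) := by
  have h := continuous_iff (f := fun z : Ind H X => z ∉ A)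
  simp only [continuous_Prop] at h
  rw [← isOpen_compl_iff]
  refine h.trans (forall_congr' fun c => ?_)
  rw [← isOpen_compl_iff]
  rfl

lemma continuous_prod_iff {W Z : Type*} [TopologicalSpace W] [TopologicalSpace Z]
    {f : Ind H X × W → Z} : Continuous f ↔ ∀ c, Continuous fun x : X × W => f (mk c x.1, x.2) := by
  refine ⟨fun hf c => hf.comp ((continuous_mk c).prodMap continuous_id), fun hf => ?_⟩
  let _ : TopologicalSpace (G ⧸ H) := ⊥
  have : DiscreteTopology (G ⧸ H) := ⟨rfl⟩
  let e : Ind H X × W ≃ₜ (G ⧸ H) × (X × W) := Homeomorph.prodAssoc (G ⧸ H) X W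
  have : Continuous (f ∘ e.symm) := continuous_prod_of_discrete_left.2 hf
  convert this.comp e.continuous
  ext x
  simp

variable [MulAction H X] [MulAction H Y] [MulAction H T]

instance [ContinuousConstSMul H X] : ContinuousConstSMul G (Ind H X) where
  continuous_const_smul g := by
    rw [continuous_iff]
    intro c
    exact (continuous_mk (g • c)).comp (continuous_const_smul (cocycle H g c))

/-- Functoriality of induction. -/
noncomputable def map (f : GHom H X Y) : GHom G (Ind H X) (Ind H Y) :=
  .of (fun z => mk z.1 (f z.2)) (continuous_iff.2 fun c => (continuous_mk c).comp f.continuous) (by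
    intro g z
    exact congrArg (mk (g • z.1)) (f.map_smul _ _))

@[simp] lemma map_mk (f : GHom H X Y) (c : G ⧸ H) (x : X) : map f (mk c x) = mk c (f x) := rfl

/-- Induction for maps defined on a product. -/
noncomputable def mapProd {D : Type} [TopologicalSpace D] (f : GHom H (T × D) Y) :
    GHom G (Ind H T × D) (Ind H Y) :=
  .of (fun z => mk z.1.1 (f (z.1.2, z.2)))
    (continuous_prod_iff.2 fun c => (continuous_mk c).comp f.continuous) (by
    intro g z
    exact congrArg (mk (g • z.1.1)) (f.map_smul (cocycle H g z.1.1) (z.1.2, z.2)))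

@[simp] lemma mapProd_mk {D : Type} [TopologicalSpace D] (f : GHom H (T × D) Y) (c : G ⧸ H) (t : T)
    (d : D) : mapProd f (mk c t, d) = mk c (f (t, d)) := rfl

lemma homotopic_map [ContinuousConstSMul H X] [ContinuousConstSMul H Y] {f k : GHom H X Y}
    (h : f.Homotopic k) : (map f : GHom G (Ind H X) (Ind H Y)).Homotopic (map k) := by
  obtain ⟨F, h0, h1⟩ := h
  refine .of_uncurried (mapProd F.uncurry) (fun z => ?_) (fun z => ?_) <;>
    obtain ⟨c, x, rfl⟩ := exists_mk z
  · simp [h0]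
  · simp [h1]

lemma equivalent [ContinuousConstSMul H X] [ContinuousConstSMul H Y] (h : GEquivalent H X Y) :
    GEquivalent G (Ind H X) (Ind H Y) := by
  obtain ⟨f, k, h1, h2⟩ := h
  exact ⟨map f, map k, homotopic_map h1, homotopic_map h2⟩

lemma isAttachment {D : Type} [TopologicalSpace D] {S : Set D} {i : GHom H X Y}
    {χ : GHom H (T × D) Y} (h : IsAttachment S i χ) :
    IsAttachment S (map i : GHom G (Ind H X) (Ind H Y)) (mapProd χ) where
  isClosedEmbedding := by
    refine .of_continuous_injective_isClosedMap (GHom.continuous _) (fun y z e => ?_) fun A hA => ?_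
    · obtain ⟨c, x, rfl⟩ := exists_mk y
      obtain ⟨c', x', rfl⟩ := exists_mk z
      rw [map_mk, map_mk] at e
      obtain ⟨rfl, h2⟩ := mk_injective e
      rw [h.isClosedEmbedding.injective h2]
    · rw [isClosed_iff] at hA ⊢
      intro c
      convert h.isClosedEmbedding.isClosedMap _ (hA c)
      ext y
      constructor
      · rintro ⟨z, hz, e⟩
        obtain ⟨c', x, rfl⟩ := exists_mk z
        obtain ⟨rfl, rfl⟩ := mk_injective e
        exact ⟨x, hz, rfl⟩
      · rintro ⟨x, hx, rfl⟩
        exact ⟨mk c x, hx, rfl⟩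
  mem_range_iff t d := by
    obtain ⟨c, t, rfl⟩ := exists_mk t
    rw [← h.mem_range_iff t d]
    constructor
    · rintro ⟨z, e⟩
      obtain ⟨c', x, rfl⟩ := exists_mk z
      exact ⟨x, (mk_injective e).2⟩
    · rintro ⟨x, e⟩
      exact ⟨mk c x, by simp [e]⟩
  injective t d t' d' hd hd' e := by
    obtain ⟨c, t, rfl⟩ := exists_mk t
    obtain ⟨c', t', rfl⟩ := exists_mk t'
    obtain ⟨rfl, h2⟩ := mk_injective e
    obtain ⟨rfl, rfl⟩ := h.injective _ _ _ _ hd hd' h2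
    exact ⟨rfl, rfl⟩
  surjective y := by
    obtain ⟨c, y, rfl⟩ := exists_mk y
    rcases h.surjective y with ⟨x, rfl⟩ | ⟨⟨t, d⟩, rfl⟩
    · exact .inl ⟨mk c x, rfl⟩
    · exact .inr ⟨(mk c t, d), rfl⟩
  isClosed_of A h1 h2 := by
    rw [isClosed_iff]
    intro c
    refine h.isClosed_of _ ?_ ?_
    · exact h1.preimage (continuous_mk c)
    · exact h2.preimage ((continuous_mk c).prodMap continuous_id)

instance [DiscreteTopology T] : DiscreteTopology (Ind H T) := by
  rw [discreteTopology_iff_forall_isClosed]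
  intro A
  rw [isClosed_iff]
  exact fun c => isClosed_discrete _

instance [Nonempty T] : Nonempty (Ind H T) := ⟨mk ((1 : G) : G ⧸ H) (Classical.arbitrary T)⟩

instance [MulAction.IsPretransitive H T] : MulAction.IsPretransitive G (Ind H T) where
  exists_smul_eq y z := by
    obtain ⟨c, x, rfl⟩ := exists_mk y
    obtain ⟨c', x', rfl⟩ := exists_mk z
    obtain ⟨h, hx⟩ := MulAction.exists_smul_eq H x x'
    -- In terms of the chosen representatives, this group element carries `c` to `c'` with cocycle
    -- value exactly `h`.
    have e : (c'.out * h * c.out⁻¹ : G) • c = c' := by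
      conv_lhs => rw [← QuotientGroup.out_eq' c, MulAction.Quotient.smul_mk]
      conv_rhs => rw [← QuotientGroup.out_eq' c']
      rw [QuotientGroup.eq]
      simp
    refine ⟨c'.out * h * c.out⁻¹, ?_⟩
    have e2 : cocycle H (c'.out * h * c.out⁻¹ : G) c = h := by
      apply Subtype.ext
      have := out_mul_cocycle (H := H) (c'.out * h * c.out⁻¹ : G) c
      rw [e] at this
      simpa using this
    rw [smul_mk, e2, e, hx]

end Topology

end Ind

/-- Induction preserves each generating step. In particular a transitive discrete `H`-set induces a
transitive discrete `G`-set, so a cell remains a single cell of the same dimension. -/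
theorem IsCellular.ind {G : Type u} [Group G] {H : Subgroup G} {X : Type u} [TopologicalSpace X]
    [MulAction H X] [ContinuousConstSMul H X] (h : IsCellular H X) : IsCellular G (Ind H X) := by
  induction h with
  | empty X =>
    have : IsEmpty (Ind H X) := ⟨fun z => isEmptyElim z.2⟩
    exact .empty _
  | equiv _ e ih => exact ih.equiv (Ind.equivalent e)
  | attach _ h ih => exact ih.attach (Ind.isAttachment h)

/-- A `G`-space which is the disjoint union of the translates of a closed `H`-subspace is
induced. -/
theorem equivalent_ind {G : Type u} [Group G] [Finite G] {H : Subgroup G} {X Z : Type u}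
    [TopologicalSpace X] [MulAction H X] [ContinuousConstSMul H X] [TopologicalSpace Z]
    [MulAction G Z] [ContinuousConstSMul G Z] {j : X → Z} (hj : IsClosedEmbedding j)
    (hs : ∀ (h : H) x, j (h • x) = (h : G) • j x) (hm : ∀ (g : G) x x', g • j x = j x' → g ∈ H)
    (hZ : ∀ z, ∃ (g : G) (x : X), z = g • j x) : GEquivalent G (Ind H X) Z := by
  let F : GHom G (Ind H X) Z := .of (fun z => z.1.out • j z.2)
    (Ind.continuous_iff.2 fun c => hj.continuous.const_smul c.out) (by
      intro g z
      change (g • z.1).out • j (Ind.cocycle H g z.1 • z.2) = g • z.1.out • j z.2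
      rw [hs, ← mul_smul, Ind.out_mul_cocycle, mul_smul])
  have hF : ∀ c x, F (Ind.mk c x) = c.out • j x := fun _ _ => rfl
  refine ⟨F, .of_bijective_isClosedMap F ⟨fun y z e => ?_, fun z => ?_⟩ fun A hA => ?_⟩
  · obtain ⟨c, x, rfl⟩ := Ind.exists_mk y
    obtain ⟨c', x', rfl⟩ := Ind.exists_mk z
    rw [hF, hF] at e
    have e' : (c'.out⁻¹ * c.out) • j x = j x' := by rw [mul_smul, e, inv_smul_smul]
    obtain rfl : c' = c := by
      have := QuotientGroup.eq.2 (hm _ _ _ e')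
      rwa [QuotientGroup.out_eq', QuotientGroup.out_eq'] at this
    rw [hj.injective ((MulAction.injective _) e)]
  · obtain ⟨g, x, rfl⟩ := hZ z
    have hg : ((g : G ⧸ H).out)⁻¹ * g ∈ H := by
      rw [← QuotientGroup.eq, QuotientGroup.out_eq']
    refine ⟨Ind.mk (g : G ⧸ H) ((⟨_, hg⟩ : H) • x), ?_⟩
    rw [hF, hs, ← mul_smul]
    simp
  · have : F '' A = ⋃ c : G ⧸ H, (fun z => c.out • z) '' (j '' (Ind.mk c ⁻¹' A)) := by
      ext z
      simp only [mem_image, mem_iUnion]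
      constructor
      · rintro ⟨y, hy, rfl⟩
        obtain ⟨c, x, rfl⟩ := Ind.exists_mk y
        exact ⟨c, _, ⟨x, hy, rfl⟩, rfl⟩
      · rintro ⟨c, _, ⟨x, hx, rfl⟩, rfl⟩
        exact ⟨_, hx, rfl⟩
    rw [this]
    -- Finiteness of `G` enters here: only finitely many closed translates are united.
    refine isClosed_iUnion_of_finite fun c => ?_
    exact (isClosedMap_smul c.out) _ (hj.isClosedMap _ (Ind.isClosed_iff.1 hA c))

/-! ### General position for maps of spheres -/

section Approximation

open MeasureTheory in
/-- A continuous map from a sphere of dimension less than `m` to `ℝᵐ` can be approximated by maps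
missing the origin. -/
lemma exists_approx_ne_zero {m n : ℕ} (hmn : n ≤ m)
    (v : C(diskBoundary n, EuclideanSpace ℝ (Fin m))) {ε : ℝ} (hε : 0 < ε) :
    ∃ w : C(diskBoundary n, EuclideanSpace ℝ (Fin m)), ∀ s, w s ≠ 0 ∧ ‖w s - v s‖ < ε := by
  -- Placing the source sphere isometrically in the unit sphere of the target space makes source and
  -- target dimensions equal, as the statement on null sets below requires.
  let e : EuclideanSpace ℝ (Fin n) →ₗᵢ[ℝ] EuclideanSpace ℝ (Fin m) :=
    LinearMap.isometryOfOrthonormal ((EuclideanSpace.basisFun (Fin n) ℝ).toBasis.constr ℝ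
      (fun i => EuclideanSpace.basisFun (Fin m) ℝ (Fin.castLE hmn i)))
      (v := (EuclideanSpace.basisFun (Fin n) ℝ).toBasis)
      (by simp) (by
        have h := (EuclideanSpace.basisFun (Fin m) ℝ).orthonormal.comp _ (Fin.castLE_injective hmn)
        refine (congrArg (Orthonormal ℝ) (funext fun i => ?_)).mpr h
        simp only [Function.comp_apply, Module.Basis.constr_basis])
  let ι : diskBoundary n → EuclideanSpace ℝ (Fin m) := fun s => e (s : EuclideanDisk n)
  have : CompactSpace (EuclideanDisk n) := isCompact_iff_compactSpace.1 (isCompact_closedBall _ _)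
  have : CompactSpace (diskBoundary n) :=
    isCompact_iff_compactSpace.1 (isClosed_diskBoundary n).isCompact
  have hι : IsClosedEmbedding ι := by
    refine Continuous.isClosedEmbedding (by fun_prop) fun x y h => ?_
    exact Subtype.ext (Subtype.ext (e.injective h))
  have hιn : ∀ s, ‖ι s‖ = 1 := fun s => by
    simp only [ι, e.norm_map]
    exact s.2
  -- Extend `v` over the whole space by Tietze, then approximate by a smooth map uniformly on the
  -- unit sphere.
  obtain ⟨V, hV⟩ := ContinuousMap.exists_extension (Y := EuclideanSpace ℝ (Fin m)) hι v
  have hV' : ∀ s, V (ι s) = v s := fun s => DFunLike.congr_fun hV s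
  have hd := ContinuousMap.dense_setOfPred_contDiff V
  rw [mem_closure_iff_nhds_basis (nhds_basis_uniformity
    Metric.uniformity_basis_dist.compactConvergenceUniformity)] at hd
  obtain ⟨W, hW, hVW⟩ := hd ⟨Metric.sphere 0 1, ε / 2⟩ ⟨isCompact_sphere _ _, half_pos hε⟩
  rw [mem_ofPred_eq] at hW
  -- The unit sphere is a null set and a differentiable self-map of `ℝᵐ` preserves null sets. So
  -- arbitrarily small vectors `y` are missed, and subtracting one makes the map avoid `0`.
  have hnull : volume (W '' Metric.sphere 0 1) = 0 :=
    addHaar_image_eq_zero_of_differentiableOn_of_addHaar_eq_zero volume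
      ((hW.differentiable (by simp)).differentiableOn)
      (Measure.addHaar_sphere_of_ne_zero volume 0 one_ne_zero)
  obtain ⟨y, hy, hyW⟩ : ∃ y ∈ Metric.ball (0 : EuclideanSpace ℝ (Fin m)) (ε / 2),
      y ∉ W '' Metric.sphere 0 1 := by
    by_contra! h
    have := measure_mono_null (fun y hy => h y hy) hnull
    exact (Metric.measure_ball_pos volume (0 : EuclideanSpace ℝ (Fin m)) (half_pos hε)).ne' this
  refine ⟨⟨fun s => W (ι s) - y, by fun_prop⟩, fun s => ⟨?_, ?_⟩⟩
  · intro h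
    exact hyW ⟨ι s, mem_sphere_zero_iff_norm.2 (hιn s), sub_eq_zero.1 h⟩
  · have h1 : dist (W (ι s)) (V (ι s)) < ε / 2 := hVW (ι s) (mem_sphere_zero_iff_norm.2 (hιn s))
    rw [dist_eq_norm, hV'] at h1
    have h2 := mem_ball_zero_iff.1 hy
    calc ‖W (ι s) - y - v s‖ = ‖(W (ι s) - v s) - y‖ := by congr 1; abel
      _ ≤ ‖W (ι s) - v s‖ + ‖y‖ := norm_sub_le _ _
      _ < ε := by linarith

end Approximation

/-! ### Pushing maps off a cell -/

section Compression

/-- Lifting a `G`-map through a closed embedding. -/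
noncomputable def GHom.liftEmbedding {G : Type u} [Group G] {X Y Z : Type u} [TopologicalSpace X]
    [TopologicalSpace Y] [TopologicalSpace Z] [MulAction G X] [MulAction G Y] [MulAction G Z]
    {i : GHom G X Y} (hi : IsClosedEmbedding i) (f : GHom G Z Y) (h : ∀ z, f z ∈ range i) :
    GHom G Z X :=
  .of (fun z => (h z).choose) (by
    rw [hi.continuous_iff]
    convert f.continuous
    ext z
    exact (h z).choose_spec) (by
    intro g z
    apply hi.injective
    rw [i.map_smul, (h z).choose_spec, (h (g • z)).choose_spec, f.map_smul])

lemma GHom.liftEmbedding_spec {G : Type u} [Group G] {X Y Z : Type u} [TopologicalSpace X]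
    [TopologicalSpace Y] [TopologicalSpace Z] [MulAction G X] [MulAction G Y] [MulAction G Z]
    {i : GHom G X Y} (hi : IsClosedEmbedding i) (f : GHom G Z Y) (h : ∀ z, f z ∈ range i) (z : Z) :
    i (GHom.liftEmbedding hi f h z) = f z := (h z).choose_spec

variable {G : Type u} [Group G] {A A' T₀ T : Type u} [TopologicalSpace A] [TopologicalSpace A']
  [TopologicalSpace T₀] [TopologicalSpace T] [MulAction G A] [MulAction G A'] [MulAction G T₀]
  [MulAction G T]

section Coordinates

variable {m : ℕ} {j : GHom G A A'} {ψ : GHom G (T₀ × EuclideanDisk m) A'}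
  (h : IsAttachment (diskBoundary m) j ψ)

namespace IsAttachment

include h

/-- The radial coordinate of an attachment. -/
noncomputable def radius : A' → ℝ := h.lift (fun _ => 1) fun x => ‖(x.2 : EuclideanSpace ℝ (Fin m))‖

lemma radius_compat (x : A) (t : T₀) (d : EuclideanDisk m) (e : j x = ψ (t, d)) :
    (1 : ℝ) = ‖(d : EuclideanSpace ℝ (Fin m))‖ := (h.mem_of_eq x t d e).symm

lemma radius_left (x : A) : h.radius (j x) = 1 := h.lift_left _ _ x

lemma radius_right (t : T₀) (d : EuclideanDisk m) :
    h.radius (ψ (t, d)) = ‖(d : EuclideanSpace ℝ (Fin m))‖ := h.lift_right h.radius_compat (t, d)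

lemma continuous_radius : Continuous h.radius :=
  h.continuous_lift h.radius_compat continuous_const (by fun_prop)

lemma radius_smul (g : G) (y : A') : h.radius (g • y) = h.radius y := by
  induction y using h.ind with
  | hl x => rw [← j.map_smul, radius_left, radius_left]
  | hr t d => rw [← ψ.map_smul, smul_mk_trivial, radius_right, radius_right]

lemma radius_nonneg (y : A') : 0 ≤ h.radius y := by
  induction y using h.ind with
  | hl x => rw [radius_left]; exact zero_le_one
  | hr t d => rw [radius_right]; exact norm_nonneg _

lemma radius_le_one (y : A') : h.radius y ≤ 1 := by
  induction y using h.ind with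
  | hl x => rw [radius_left]
  | hr t d => rw [radius_right]; exact d.norm_le

lemma mem_range_of_radius_eq_one {y : A'} (hy : h.radius y = 1) : y ∈ range j := by
  induction y using h.ind with
  | hl x => exact ⟨x, rfl⟩
  | hr t d => rw [radius_right] at hy; exact (h.mem_range_iff t d).2 hy

lemma exists_of_radius_ne_one {y : A'} (hy : h.radius y ≠ 1) : ∃ t d, ψ (t, d) = y := by
  induction y using h.ind with
  | hl x => exact absurd (h.radius_left x) hy
  | hr t d => exact ⟨t, d, rfl⟩

/-- The coordinate of the points of radius at most `2 / 3` of an attachment, extended to a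
continuous function. -/
noncomputable def coord : A' → EuclideanSpace ℝ (Fin m) :=
  -- The factor is `1` up to norm `2 / 3` and vanishes on the boundary, where the cell meets `A`.
  h.lift (fun _ => 0) fun x => (min 1 (3 * (1 - ‖(x.2 : EuclideanSpace ℝ (Fin m))‖))) •
    (x.2 : EuclideanSpace ℝ (Fin m))

lemma coord_compat (x : A) (t : T₀) (d : EuclideanDisk m) (e : j x = ψ (t, d)) :
    (0 : EuclideanSpace ℝ (Fin m)) = (min 1 (3 * (1 - ‖(d : EuclideanSpace ℝ (Fin m))‖))) •
      (d : EuclideanSpace ℝ (Fin m)) := by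
  rw [← h.radius_compat x t d e]
  simp

lemma coord_left (x : A) : h.coord (j x) = 0 := h.lift_left _ _ x

lemma coord_right (t : T₀) (d : EuclideanDisk m) :
    h.coord (ψ (t, d)) = (min 1 (3 * (1 - ‖(d : EuclideanSpace ℝ (Fin m))‖))) •
      (d : EuclideanSpace ℝ (Fin m)) := h.lift_right h.coord_compat (t, d)

lemma coord_right_of_le {t : T₀} {d : EuclideanDisk m}
    (hd : ‖(d : EuclideanSpace ℝ (Fin m))‖ ≤ 2 / 3) : h.coord (ψ (t, d)) = d := by
  rw [coord_right, min_eq_left (by linarith), one_smul]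

lemma continuous_coord : Continuous h.coord :=
  h.continuous_lift h.coord_compat continuous_const (by fun_prop)

lemma coord_smul (g : G) (y : A') : h.coord (g • y) = h.coord y := by
  induction y using h.ind with
  | hl x => rw [← j.map_smul, coord_left, coord_left]
  | hr t d => rw [← ψ.map_smul, smul_mk_trivial, coord_right, coord_right]

end IsAttachment

end Coordinates

/-- Pushing a point of the disk by a vector, with damping away from the center. -/
noncomputable def diskPush (m : ℕ) :
    C(EuclideanDisk m × (EuclideanSpace ℝ (Fin m) × I), EuclideanDisk m) where
  -- The damping factor is `1` up to norm `1 / 3` and `0` from norm `1 / 2` on, so the boundary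
  -- stays fixed.
  toFun x := clip ((x.1 : EuclideanSpace ℝ (Fin m)) +
    (x.2.2 * max 0 (min 1 (3 - 6 * ‖(x.1 : EuclideanSpace ℝ (Fin m))‖)) : ℝ) • x.2.1)

lemma diskPush_boundary {m : ℕ} (s : EuclideanDisk m) (hs : s ∈ diskBoundary m)
    (w : EuclideanSpace ℝ (Fin m) × I) : diskPush m (s, w) = s := by
  have hs' : ‖(s : EuclideanSpace ℝ (Fin m))‖ = 1 := hs
  simp only [diskPush, ContinuousMap.coe_mk, hs']
  rw [max_eq_left (by norm_num)]
  simp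

lemma diskPush_zero {m : ℕ} (d : EuclideanDisk m) (u : EuclideanSpace ℝ (Fin m)) :
    diskPush m (d, (u, 0)) = d := by
  simp [diskPush]

lemma clip_ne_zero {m : ℕ} {v : EuclideanSpace ℝ (Fin m)} (hv : v ≠ 0) :
    ‖(clip v : EuclideanSpace ℝ (Fin m))‖ ≠ 0 := by
  rw [norm_ne_zero_iff]
  have : 0 < max 1 ‖v‖ := by positivity
  exact smul_ne_zero (inv_ne_zero this.ne') hv

/-- Radial expansion of the disk, mapping the points of norm at least `δ` to the boundary. -/
noncomputable def diskExpand (m : ℕ) (δ : ℝ) (hδ : 0 < δ) : C(EuclideanDisk m × I, EuclideanDisk m) where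
  toFun x := clip (((1 - x.2 : ℝ) + x.2 / max ‖(x.1 : EuclideanSpace ℝ (Fin m))‖ δ) •
    (x.1 : EuclideanSpace ℝ (Fin m)))
  continuous_toFun := by
    have : ∀ x : EuclideanDisk m × I, max ‖(x.1 : EuclideanSpace ℝ (Fin m))‖ δ ≠ 0 :=
      fun x => (lt_max_of_lt_right hδ).ne'
    fun_prop (disch := exact this _)

lemma diskExpand_boundary {m : ℕ} {δ : ℝ} (hδ : 0 < δ) (hδ1 : δ ≤ 1) (s : EuclideanDisk m)
    (hs : s ∈ diskBoundary m) (t : I) : diskExpand m δ hδ (s, t) = s := by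
  have hs' : ‖(s : EuclideanSpace ℝ (Fin m))‖ = 1 := hs
  simp only [diskExpand, ContinuousMap.coe_mk, hs', max_eq_left hδ1]
  simp

lemma diskExpand_zero {m : ℕ} {δ : ℝ} (hδ : 0 < δ) (d : EuclideanDisk m) :
    diskExpand m δ hδ (d, 0) = d := by
  simp [diskExpand]

lemma norm_diskExpand_one {m : ℕ} {δ : ℝ} (hδ : 0 < δ) (d : EuclideanDisk m)
    (hd : δ ≤ ‖(d : EuclideanSpace ℝ (Fin m))‖) : diskExpand m δ hδ (d, 1) ∈ diskBoundary m := by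
  have hd0 : ‖(d : EuclideanSpace ℝ (Fin m))‖ ≠ 0 := (hδ.trans_le hd).ne'
  have h1 : ‖(1 / ‖(d : EuclideanSpace ℝ (Fin m))‖) • (d : EuclideanSpace ℝ (Fin m))‖ = 1 := by
    rw [norm_smul, norm_div, norm_norm, norm_one, one_div, inv_mul_cancel₀ hd0]
  simp only [diskExpand, ContinuousMap.coe_mk, max_eq_left hd, mem_ofPred_eq, Icc.coe_one, sub_self,
    zero_add]
  rw [clip_of_le h1.le, h1]

/-- Equivariant maps from `T × Sⁿ⁻¹` can be pushed off an attached cell of dimension at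
least `n`. -/
theorem IsAttachment.exists_compression [ContinuousConstSMul G A] [ContinuousConstSMul G A']
    [ContinuousConstSMul G T] [MulAction.IsPretransitive G T] [Nonempty T] {m n : ℕ} (hmn : n ≤ m)
    {j : GHom G A A'} {ψ : GHom G (T₀ × EuclideanDisk m) A'}
    (h : IsAttachment (diskBoundary m) j ψ) (φ : GHom G (T × diskBoundary n) A') :
    ∃ φ' : GHom G (T × diskBoundary n) A, φ.Homotopic (j.comp φ') := by
  have : CompactSpace (EuclideanDisk n) := isCompact_iff_compactSpace.1 (isCompact_closedBall _ _)
  have : CompactSpace (diskBoundary n) :=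
    isCompact_iff_compactSpace.1 (isClosed_diskBoundary n).isCompact
  obtain ⟨t₀⟩ := ‹Nonempty T›
  -- `coord` is invariant and `T` is transitive, so the coordinate of `φ (t, s)` depends on `s`
  -- alone. The equivariant problem becomes one about a single sphere.
  let v : C(diskBoundary n, EuclideanSpace ℝ (Fin m)) :=
    ⟨fun s => h.coord (φ (t₀, s)), h.continuous_coord.comp (by fun_prop)⟩
  have hv : ∀ t s, h.coord (φ (t, s)) = v s := by
    intro t s
    obtain ⟨g, rfl⟩ := MulAction.exists_smul_eq G t₀ t
    rw [← smul_mk_trivial, φ.map_smul, h.coord_smul]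
    rfl
  -- Points of norm at most `1 / 3` are moved exactly onto `w s ≠ 0`; points farther out move by
  -- less than `1 / 12` and cannot reach the center.
  obtain ⟨w, hw⟩ := exists_approx_ne_zero hmn v (ε := 1 / 12) (by norm_num)
  let P₁ := h.cellwise (diskPush m) diskPush_boundary
  let F₁ : GHom G ((T × diskBoundary n) × I) A' :=
    .of (fun x => P₁ (φ x.1, (w x.1.2 - v x.1.2, x.2))) (by fun_prop) (by
      intro g x
      simp only [smul_fst_trivial, smul_snd_trivial, φ.map_smul]
      exact P₁.map_smul g (φ x.1, (w x.1.2 - v x.1.2, x.2)))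
  let φ₁ : GHom G (T × diskBoundary n) A' := F₁.comp (DoubleCyl.slice _ 1)
  have hφ₁ : φ.Homotopic φ₁ := .of_uncurried F₁ (fun x => by
    simp only [F₁, GHom.of_apply]
    generalize φ x = y
    induction y using h.ind with
    | hl x => exact h.cellwise_left _ _ _ _
    | hr t d => exact (h.cellwise_right _ _ _ _ _).trans (by rw [diskPush_zero])) fun x => rfl
  have hpos : ∀ x, 0 < h.radius (φ₁ x) := by
    rintro ⟨t, s⟩
    obtain ⟨hw0, hwv⟩ := hw s
    have hts := hv t s
    have hval : φ₁ (t, s) = P₁ (φ (t, s), (w s - v s, 1)) := rfl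
    refine lt_of_le_of_ne (h.radius_nonneg _) (Ne.symm ?_)
    rw [hval]
    generalize φ (t, s) = y at hts
    induction y using h.ind with
    | hl x => simp [P₁, h.radius_left]
    | hr t' d =>
      simp only [P₁, h.cellwise_right, h.radius_right]
      refine clip_ne_zero ?_
      simp only [Icc.coe_one, one_mul]
      by_cases hd : ‖(d : EuclideanSpace ℝ (Fin m))‖ ≤ 1 / 3
      · rw [min_eq_left (by linarith), max_eq_right zero_le_one, one_smul, ← hts,
          h.coord_right_of_le (by linarith)]
        simpa using hw0
      · push Not at hd
        intro h0
        set β := max 0 (min 1 (3 - 6 * ‖(d : EuclideanSpace ℝ (Fin m))‖)) with hβ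
        have hβ0 : 0 ≤ β := le_max_left _ _
        have hβ1 : β ≤ 1 := max_le zero_le_one (min_le_left _ _)
        have : (d : EuclideanSpace ℝ (Fin m)) = -(β • (w s - v s)) := eq_neg_of_add_eq_zero_left h0
        rw [this, norm_neg, norm_smul, Real.norm_of_nonneg hβ0] at hd
        nlinarith [norm_nonneg (w s - v s)]
  -- By compactness of the sphere and transitivity of `T` the image keeps a uniform distance from
  -- the centers. Radial expansion then sends it into the boundary.
  obtain ⟨δ, hδ, hδ1, hδle⟩ : ∃ δ : ℝ, 0 < δ ∧ δ ≤ 1 ∧ ∀ x, δ ≤ h.radius (φ₁ x) := by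
    have hc : Continuous fun s : diskBoundary n => h.radius (φ₁ (t₀, s)) :=
      h.continuous_radius.comp (by fun_prop)
    have hinv : ∀ t s, h.radius (φ₁ (t, s)) = h.radius (φ₁ (t₀, s)) := by
      intro t s
      obtain ⟨g, rfl⟩ := MulAction.exists_smul_eq G t₀ t
      rw [← smul_mk_trivial, φ₁.map_smul, h.radius_smul]
    rcases isEmpty_or_nonempty (diskBoundary n) with he | he
    · exact ⟨1, one_pos, le_rfl, fun x => isEmptyElim x.2⟩
    · obtain ⟨s₀, -, hs₀⟩ := isCompact_univ.exists_isMinOn univ_nonempty hc.continuousOn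
      refine ⟨_, hpos (t₀, s₀), h.radius_le_one _, ?_⟩
      rintro ⟨t, s⟩
      exact (isMinOn_iff.1 hs₀ s (mem_univ s)).trans_eq (hinv t s).symm
  let P₂ := h.cellwise (diskExpand m δ hδ) (diskExpand_boundary hδ hδ1)
  let F₂ : GHom G ((T × diskBoundary n) × I) A' := P₂.comp (φ₁.prodMap (.id I))
  let φ₂ : GHom G (T × diskBoundary n) A' := F₂.comp (DoubleCyl.slice _ 1)
  have hφ₂ : φ₁.Homotopic φ₂ := .of_uncurried F₂ (fun x => by
    simp only [F₂, GHom.comp_apply, GHom.prodMap_apply, ContinuousMap.id_apply]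
    generalize φ₁ x = y
    induction y using h.ind with
    | hl x => exact h.cellwise_left _ _ _ _
    | hr t d => exact (h.cellwise_right _ _ _ _ _).trans (by rw [diskExpand_zero])) fun x => rfl
  have hr : ∀ x, φ₂ x ∈ range j := by
    intro x
    have hx := hδle x
    have hval : φ₂ x = P₂ (φ₁ x, 1) := rfl
    rw [hval]
    generalize φ₁ x = y at hx
    induction y using h.ind with
    | hl x => exact ⟨x, by simp [P₂]⟩
    | hr t d =>
      rw [h.radius_right] at hx
      simp only [P₂, h.cellwise_right]
      exact (h.mem_range_iff _ _).2 (norm_diskExpand_one hδ d hx)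
  refine ⟨GHom.liftEmbedding h.isClosedEmbedding φ₂ hr, hφ₁.trans (hφ₂.trans (.of_eq fun x => ?_))⟩
  exact (GHom.liftEmbedding_spec h.isClosedEmbedding φ₂ hr x).symm

end Compression

/-! ### Finite `G`-CW-complexes, one equivariant cell at a time -/

/-- The discrete `G`-space `G/H`. -/
def CosetSpace {G : Type u} [Group G] (H : Subgroup G) : Type u := G ⧸ H

namespace CosetSpace

variable {G : Type u} [Group G] (H : Subgroup G)

instance : TopologicalSpace (CosetSpace H) := ⊥

instance : DiscreteTopology (CosetSpace H) := ⟨rfl⟩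

instance : MulAction G (CosetSpace H) := inferInstanceAs (MulAction G (G ⧸ H))

instance : MulAction.IsPretransitive G (CosetSpace H) :=
  inferInstanceAs (MulAction.IsPretransitive G (G ⧸ H))

instance : Nonempty (CosetSpace H) := inferInstanceAs (Nonempty (G ⧸ H))

end CosetSpace

lemma isClosedEmbedding_incl {G : Type u} [Group G] {X : Type u} [TopologicalSpace X]
    [MulAction G X] {A B : SubMulAction G X} (h : A ≤ B) (hA : IsClosed (A : Set X)) :
    IsClosedEmbedding (GHom.incl h) :=
  .inclusion h (hA.preimage continuous_subtype_val)

lemma isClosed_preimage_val_iff {X : Type*} [TopologicalSpace X] {Z A : Set X} (hZ : IsClosed Z) :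
    IsClosed ((↑) ⁻¹' A : Set Z) ↔ IsClosed (A ∩ Z) := by
  rw [hZ.isClosedEmbedding_subtypeVal.isClosed_iff_image_isClosed, Subtype.image_preimage_coe,
    inter_comm]

namespace GCWComplex

variable {G : Type u} [Group G] {X : Type u} [TopologicalSpace X] [MulAction G X]
  (K : GCWComplex G X)

lemma skeletonLT_mono : Monotone K.skeletonLT :=
  monotone_nat_of_le_succ fun n => by
    rw [K.skeletonLT_succ]
    exact subset_union_left

lemma map_mem_skeletonLT (n : ℕ) (i : K.cell n) (c : G ⧸ K.stab n i) (d : EuclideanDisk n) :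
    K.map n i c d ∈ K.skeletonLT (n + 1) := by
  rw [K.skeletonLT_succ]
  exact .inr (mem_iUnion₂.2 ⟨i, c, d, rfl⟩)

lemma mem_skeletonLT_succ {n : ℕ} {x : X} : x ∈ K.skeletonLT (n + 1) ↔
    x ∈ K.skeletonLT n ∨ ∃ i c d, K.map n i c d = x := by
  simp [K.skeletonLT_succ]

lemma smul_mem_skeletonLT (n : ℕ) (g : G) {x : X} (hx : x ∈ K.skeletonLT n) :
    g • x ∈ K.skeletonLT n := by
  induction n generalizing x with
  | zero => simp [K.skeletonLT_zero] at hx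
  | succ n ih =>
    rcases K.mem_skeletonLT_succ.1 hx with hx | ⟨i, c, d, rfl⟩
    · exact K.mem_skeletonLT_succ.2 (.inl (ih hx))
    · rw [← K.map_smul]
      exact K.map_mem_skeletonLT _ _ _ _

lemma map_mem_skeletonLT_iff {n : ℕ} {i : K.cell n} {c : G ⧸ K.stab n i} {d : EuclideanDisk n} :
    K.map n i c d ∈ K.skeletonLT n ↔ d ∈ diskBoundary n := by
  refine ⟨fun h => ?_, K.map_boundary n i c d⟩
  by_contra hd
  exact K.map_interior n i c d (lt_of_le_of_ne d.norm_le hd) h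

/-- Cells of dimension at least `n` meet `Z` only along their boundary spheres, which map to lower
skeleta. Closedness therefore passes from one skeleton to the next. -/
lemma isClosed_of_subset_skeletonLT {n : ℕ} {Z : Set X} (hZ : Z ⊆ K.skeletonLT n)
    (h : IsClosed ((↑) ⁻¹' Z : Set (K.skeletonLT n))) : IsClosed Z := by
  refine K.isClosed_of_skeletonLT Z fun m => ?_
  rcases le_total m n with hmn | hnm
  · exact h.preimage (continuous_inclusion (K.skeletonLT_mono hmn))
  · induction m, hnm using Nat.le_induction with
    | base => exact h
    | succ m hnm ih =>
      refine K.isClosed_skeletonLT_succ m Z ih fun i c => ?_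
      let b : diskBoundary m → K.skeletonLT m := fun d => ⟨K.map m i c d, K.map_boundary m i c d d.2⟩
      have hb : Continuous b := by fun_prop
      have := (isClosed_diskBoundary m).isClosedEmbedding_subtypeVal.isClosedMap _ (ih.preimage hb)
      convert this
      ext d
      constructor
      · intro hd
        exact ⟨⟨d, K.map_mem_skeletonLT_iff.1 (K.skeletonLT_mono hnm (hZ hd))⟩, hd, rfl⟩
      · rintro ⟨d, hd, rfl⟩
        exact hd

lemma isClosed_skeletonLT (n : ℕ) : IsClosed (K.skeletonLT n) :=
  K.isClosed_of_subset_skeletonLT subset_rfl (by simp)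

lemma isClosed_of_subset_skeletonLT_succ {n : ℕ} {Z : Set X} (hZ : Z ⊆ K.skeletonLT (n + 1))
    (h : IsClosed (Z ∩ K.skeletonLT n)) (h' : ∀ i c, IsClosed (K.map n i c ⁻¹' Z)) : IsClosed Z :=
  K.isClosed_of_subset_skeletonLT hZ <| K.isClosed_skeletonLT_succ n Z
    ((isClosed_preimage_val_iff (K.isClosed_skeletonLT n)).2 h) h'

/-- The `G`-subspace `skeletonLT n` with some of the `n`-cells attached. -/
def stage (n : ℕ) (s : Set (K.cell n)) : SubMulAction G X where
  carrier := K.skeletonLT n ∪ {x | ∃ i ∈ s, ∃ c d, K.map n i c d = x}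
  smul_mem' g x hx := by
    rcases hx with hx | ⟨i, hi, c, d, rfl⟩
    · exact .inl (K.smul_mem_skeletonLT n g hx)
    · exact .inr ⟨i, hi, g • c, d, K.map_smul _ _ _ _ _⟩

variable {K} in
lemma mem_stage {n : ℕ} {s : Set (K.cell n)} {x : X} :
    x ∈ K.stage n s ↔ x ∈ K.skeletonLT n ∨ ∃ i ∈ s, ∃ c d, K.map n i c d = x := Iff.rfl

lemma map_mem_stage_iff {n : ℕ} {s : Set (K.cell n)} {i : K.cell n} {c : G ⧸ K.stab n i}
    {d : EuclideanDisk n} : K.map n i c d ∈ K.stage n s ↔ i ∈ s ∨ d ∈ diskBoundary n := by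
  rw [mem_stage, K.map_mem_skeletonLT_iff]
  refine ⟨?_, fun h => h.symm.imp id fun h => ⟨i, h, c, d, rfl⟩⟩
  rintro (h | ⟨i', hi', c', d', e⟩)
  · exact .inr h
  · by_contra! hd
    have hd' : d' ∉ diskBoundary n := fun hd' =>
      hd.2 (K.map_mem_skeletonLT_iff.1 (e ▸ K.map_mem_skeletonLT_iff.2 hd'))
    have := K.map_injective n ⟨i', c', d'⟩ ⟨i, c, d⟩ (lt_of_le_of_ne d'.norm_le hd')
      (lt_of_le_of_ne d.norm_le hd.2) e
    obtain rfl : i' = i := congrArg Sigma.fst this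
    exact hd.1 hi'

lemma stage_subset (n : ℕ) (s : Set (K.cell n)) : (K.stage n s : Set X) ⊆ K.skeletonLT (n + 1) := by
  rintro x (hx | ⟨i, -, c, d, rfl⟩)
  · exact K.skeletonLT_mono n.le_succ hx
  · exact K.map_mem_skeletonLT _ _ _ _

lemma isClosed_stage (n : ℕ) (s : Set (K.cell n)) : IsClosed (K.stage n s : Set X) := by
  refine K.isClosed_of_subset_skeletonLT_succ (K.stage_subset n s) ?_ fun i c => ?_
  · convert K.isClosed_skeletonLT n
    exact inter_eq_right.2 fun x hx => mem_stage.2 (.inl hx)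
  · by_cases hi : i ∈ s
    · convert isClosed_univ
      exact eq_univ_of_forall fun d => K.map_mem_stage_iff.2 (.inl hi)
    · convert isClosed_diskBoundary n
      ext d
      exact K.map_mem_stage_iff.trans (or_iff_right hi)

lemma stage_mono (n : ℕ) : Monotone (K.stage n) := fun s s' h x hx => by
  rw [mem_stage] at hx ⊢
  exact hx.imp id fun ⟨i, hi, e⟩ => ⟨i, h hi, e⟩

/-- The characteristic map of a cell, as an equivariant map. -/
def charMap {n : ℕ} (i : K.cell n) : GHom G (CosetSpace (K.stab n i) × EuclideanDisk n) X :=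
  .of (fun x => K.map n i x.1 x.2)
    (continuous_prod_of_discrete_left.2 fun c => (K.map n i c).continuous)
    fun g x => K.map_smul n i g x.1 x.2

/-- This refines the skeletal filtration to one orbit of cells per step, the form needed for
induction over a finite complex. -/
lemma isAttachment_stage {n : ℕ} {s : Set (K.cell n)} {i : K.cell n} (hi : i ∉ s) :
    IsAttachment (diskBoundary n) (GHom.incl (K.stage_mono n (subset_insert i s)))
      ((K.charMap i).codRestrict (K.stage n (insert i s)) fun _ =>
        K.map_mem_stage_iff.2 (.inl (mem_insert i s))) where
  isClosedEmbedding := isClosedEmbedding_incl _ (K.isClosed_stage n s)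
  mem_range_iff c d := by
    trans K.map n i c d ∈ K.stage n s
    · refine ⟨?_, fun h => ⟨⟨_, h⟩, rfl⟩⟩
      rintro ⟨x, hx⟩
      have hx' : (x : X) = K.map n i c d := congrArg Subtype.val hx
      exact hx' ▸ x.2
    · exact K.map_mem_stage_iff.trans (or_iff_right hi)
  injective c d c' d' hd hd' e := by
    have := K.map_injective n ⟨i, c, d⟩ ⟨i, c', d'⟩ (lt_of_le_of_ne d.norm_le hd)
      (lt_of_le_of_ne d'.norm_le hd') (congrArg Subtype.val e)
    have h := eq_of_heq (Sigma.mk.inj this).2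
    exact ⟨congrArg Prod.fst h, congrArg Prod.snd h⟩
  surjective := by
    rintro ⟨x, hx⟩
    rcases mem_stage.1 hx with h | ⟨j, rfl | hj, c, d, e⟩
    · exact .inl ⟨⟨x, mem_stage.2 (.inl h)⟩, rfl⟩
    · exact .inr ⟨(c, d), Subtype.ext e⟩
    · exact .inl ⟨⟨x, mem_stage.2 (.inr ⟨j, hj, c, d, e⟩)⟩, rfl⟩
  isClosed_of A hA hA' := by
    have h1 : IsClosed (Subtype.val '' A ∩ K.stage n s) := by
      have := (K.isClosed_stage n s).isClosedEmbedding_subtypeVal.isClosedMap _ hA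
      convert this
      ext x
      constructor
      · rintro ⟨⟨y, hy, rfl⟩, hx⟩
        exact ⟨⟨y, hx⟩, hy, rfl⟩
      · rintro ⟨y, hy, rfl⟩
        exact ⟨⟨_, hy, rfl⟩, y.2⟩
    have h2 : IsClosed (Subtype.val '' A) := by
      refine K.isClosed_of_subset_skeletonLT_succ (n := n) ?_ ?_ fun j c => ?_
      · rintro _ ⟨y, -, rfl⟩
        exact K.stage_subset _ _ y.2
      · convert h1.inter (K.isClosed_skeletonLT n) using 1
        rw [inter_assoc]
        congr 1
        exact (inter_eq_right.2 fun x hx => mem_stage.2 (.inl hx)).symm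
      · by_cases hj : j = i
        · subst hj
          convert hA'.preimage (Continuous.prodMk_right (c : CosetSpace (K.stab n j)))
          ext d
          constructor
          · rintro ⟨y, hy, e⟩
            have : y = ⟨K.map n j c d, e ▸ y.2⟩ := Subtype.ext e
            rw [this] at hy
            exact hy
          · intro hd
            exact ⟨_, hd, rfl⟩
        · convert h1.preimage (K.map n j c).continuous using 1
          ext d
          refine ⟨fun hd => ⟨hd, ?_⟩, fun hd => hd.1⟩
          obtain ⟨y, hy, e⟩ := hd
          have := y.2
          rw [e, K.map_mem_stage_iff, mem_insert_iff, or_iff_right hj] at this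
          exact K.map_mem_stage_iff.2 this
    convert h2.preimage continuous_subtype_val
    exact (preimage_image_eq _ Subtype.val_injective).symm

lemma stage_empty (n : ℕ) : (K.stage n ∅ : Set X) = K.skeletonLT n := by
  ext x
  simp [mem_stage]

lemma stage_univ (n : ℕ) : (K.stage n univ : Set X) = K.skeletonLT (n + 1) := by
  ext x
  simp [mem_stage, mem_skeletonLT_succ]

lemma stage_empty_succ (n : ℕ) : K.stage (n + 1) ∅ = K.stage n univ :=
  SetLike.coe_injective ((K.stage_empty _).trans (K.stage_univ n).symm)

variable {K} in
/-- Induction on the cells of dimension at least `n₀` of a finite complex. -/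
theorem IsFinite.induction (hK : K.IsFinite) (n₀ : ℕ) {motive : SubMulAction G X → Prop}
    (skeleton : motive (K.stage n₀ ∅))
    (attach : ∀ m ≥ n₀, ∀ (A A' : SubMulAction G X) (hA : A ≤ A'), IsClosed (A : Set X) →
      IsClosed (A' : Set X) → ∀ (T : Type u) [TopologicalSpace T] [DiscreteTopology T]
      [MulAction G T] [MulAction.IsPretransitive G T] [Nonempty T]
      (χ : GHom G (T × EuclideanDisk m) A'),
      IsAttachment (diskBoundary m) (GHom.incl hA) χ → motive A → motive A') : motive ⊤ := by
  have hfin : ∀ n, Finite (K.cell n) := fun n =>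
    have : Finite (Σ n : ℕ, K.cell n) := hK
    Finite.of_injective (fun i : K.cell n => (⟨n, i⟩ : Σ n : ℕ, K.cell n)) sigma_mk_injective
  have hstage : ∀ n ≥ n₀, motive (K.stage n ∅) → ∀ s, motive (K.stage n s) := by
    intro n hn h s
    induction s, s.toFinite using Set.Finite.induction_on with
    | empty => exact h
    | insert hi _ ih =>
      exact attach n hn _ _ _ (K.isClosed_stage _ _) (K.isClosed_stage _ _) _ _
        (K.isAttachment_stage hi) ih
  have hall : ∀ n ≥ n₀, motive (K.stage n ∅) := by
    intro n hn
    induction n, hn using Nat.le_induction with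
    | base => exact skeleton
    | succ n hn ih =>
      rw [stage_empty_succ]
      exact hstage n hn ih _
  -- Finitely many cells have bounded dimension, so the skeleta are constant from `N` on and exhaust
  -- the space.
  obtain ⟨N, hN⟩ : ∃ N, ∀ n (_ : K.cell n), n < N := by
    have : Finite (Σ n : ℕ, K.cell n) := hK
    obtain ⟨N, hN⟩ := (Set.finite_range (Sigma.fst : (Σ n : ℕ, K.cell n) → ℕ)).bddAbove
    exact ⟨N + 1, fun n i => Nat.lt_succ_of_le (hN ⟨⟨n, i⟩, rfl⟩)⟩
  have hNs : ∀ n ≥ N, K.skeletonLT n = K.skeletonLT N := by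
    intro n hn
    induction n, hn using Nat.le_induction with
    | base => rfl
    | succ n hn ih =>
      rw [← ih]
      ext x
      rw [mem_skeletonLT_succ]
      refine or_iff_left ?_
      rintro ⟨i, -⟩
      exact absurd (hN n i) hn.not_gt
  have htop : K.stage (max N n₀) ∅ = ⊤ := by
    refine SetLike.coe_injective ((K.stage_empty _).trans ?_)
    refine eq_univ_of_forall fun x => ?_
    have hx : x ∈ ⋃ n, K.skeletonLT n := K.iUnion_skeletonLT ▸ mem_univ x
    obtain ⟨n, hn⟩ := mem_iUnion.1 hx
    rw [hNs _ (le_max_left _ _), ← hNs _ (le_max_left N n)]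
    exact K.skeletonLT_mono (le_max_right _ _) hn
  rw [← htop]
  exact hall _ (le_max_right _ _)

end GCWComplex

section TopSubspace

variable {G : Type u} [Group G] {X : Type u} [TopologicalSpace X] [MulAction G X]
  [ContinuousConstSMul G X]

lemma equivalent_of_forall_mem {A : SubMulAction G X} (hA : ∀ x, x ∈ A) : GEquivalent G A X := by
  refine ⟨GHom.val A, .of_bijective_isClosedMap _ ⟨Subtype.val_injective, fun x => ⟨⟨x, hA x⟩, rfl⟩⟩
    (IsClosed.isClosedMap_subtype_val ?_)⟩
  convert isClosed_univ
  exact eq_univ_of_forall hA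

/-- Finite `G`-CW-complexes are cellular. -/
theorem IsFiniteGCWComplex.isCellular (h : IsFiniteGCWComplex G X) : IsCellular G X := by
  obtain ⟨K, hK⟩ := h
  have : IsCellular G (⊤ : SubMulAction G X) := by
    refine hK.induction 0 (motive := fun A => IsCellular G A) ?_ ?_
    · have : IsEmpty (K.stage 0 ∅) := by
        refine ⟨fun x => ?_⟩
        have hx : (x : X) ∈ (K.stage 0 ∅ : Set X) := x.2
        simp [K.stage_empty, K.skeletonLT_zero] at hx
      exact .empty _
    · intro m _ A A' hA _ _ T _ _ _ _ _ χ hχ ih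
      exact ih.attach hχ
  exact this.equiv (equivalent_of_forall_mem fun _ => mem_univ _)

end TopSubspace

lemma isClosed_prod_of_discrete_left {T D : Type*} [TopologicalSpace T] [DiscreteTopology T]
    [TopologicalSpace D] {A : Set (T × D)} : IsClosed A ↔ ∀ t, IsClosed (Prod.mk t ⁻¹' A) := by
  simp only [← isOpen_compl_iff, ← preimage_compl]
  exact continuous_Prop.symm.trans <| continuous_prod_of_discrete_left.trans <|
    forall_congr' fun t => continuous_Prop

/-! ### Adding a cell to a `G`-CW-structure -/

namespace GCWComplex

variable {G : Type u} [Group G] {X Y T : Type u} [TopologicalSpace X] [MulAction G X]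
  [TopologicalSpace Y] [MulAction G Y] [TopologicalSpace T] [MulAction G T] {n : ℕ}

section InsertCell

variable (K : GCWComplex G X) (i : GHom G X Y) (χ : GHom G (T × EuclideanDisk n) Y) (t₀ : T)

/-- The cells of a complex with an additional `n`-cell. -/
abbrev InsertCell (n : ℕ) (m : ℕ) : Type u := K.cell m ⊕ ULift.{u} (PLift (m = n))

/-- The isotropy groups of the cells of a complex with an additional cell. -/
def insertStab (m : ℕ) (j : K.InsertCell n m) : Subgroup G :=
  match j with
  | .inl j => K.stab m j
  | .inr _ => MulAction.stabilizer G t₀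

/-- The characteristic maps of a complex with an additional cell. -/
def insertMap (m : ℕ) (j : K.InsertCell n m) (c : G ⧸ K.insertStab t₀ m j) :
    C(EuclideanDisk m, Y) :=
  match m, j, c with
  | m, .inl j, c => i.toContinuousMap.comp (K.map m j c)
  | _, .inr ⟨⟨rfl⟩⟩, c => ⟨fun d => χ (MulAction.ofQuotientStabilizer G t₀ c, d), by fun_prop⟩

/-- The skeleta of a complex with an additional cell. -/
def insertSkeletonLT (m : ℕ) : Set Y := i '' K.skeletonLT m ∪ {y | n < m ∧ y ∈ range χ}

variable {K i χ t₀}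

lemma mem_insertSkeletonLT {m : ℕ} {y : Y} : y ∈ K.insertSkeletonLT i χ m ↔
    (∃ x ∈ K.skeletonLT m, i x = y) ∨ n < m ∧ y ∈ range χ := Iff.rfl

lemma char_mem_insertSkeletonLT {m : ℕ} (hm : n < m) (x : T × EuclideanDisk n) :
    χ x ∈ K.insertSkeletonLT i χ m := .inr ⟨hm, x, rfl⟩

lemma mem_insertSkeletonLT_of_le {m : ℕ} (hm : m ≤ n) {y : Y} :
    y ∈ K.insertSkeletonLT i χ m ↔ ∃ x ∈ K.skeletonLT m, i x = y :=
  mem_insertSkeletonLT.trans (or_iff_left fun h => absurd h.1 hm.not_gt)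

lemma exists_ofQuotientStabilizer [MulAction.IsPretransitive G T] (t : T) :
    ∃ c, MulAction.ofQuotientStabilizer G t₀ c = t := by
  obtain ⟨g, rfl⟩ := MulAction.exists_smul_eq G t₀ t
  exact ⟨QuotientGroup.mk g, rfl⟩

lemma mem_insertSkeletonLT_succ [MulAction.IsPretransitive G T] {m : ℕ} {y : Y} :
    y ∈ K.insertSkeletonLT i χ (m + 1) ↔
      y ∈ K.insertSkeletonLT i χ m ∨ ∃ j c d, K.insertMap i χ t₀ m j c d = y := by
  simp only [mem_insertSkeletonLT, mem_skeletonLT_succ]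
  constructor
  · rintro (⟨x, hx | ⟨j, c, d, rfl⟩, rfl⟩ | ⟨hm, ⟨t, d⟩, rfl⟩)
    · exact .inl (.inl ⟨x, hx, rfl⟩)
    · exact .inr ⟨.inl j, c, d, rfl⟩
    · rcases (Nat.lt_succ_iff.1 hm).lt_or_eq with hm | rfl
      · exact .inl (.inr ⟨hm, (t, d), rfl⟩)
      · obtain ⟨c, rfl⟩ := exists_ofQuotientStabilizer (G := G) (t₀ := t₀) t
        exact .inr ⟨.inr ⟨⟨rfl⟩⟩, c, d, rfl⟩
  · rintro ((⟨x, hx, rfl⟩ | ⟨hm, h⟩) | ⟨j | ⟨⟨⟨rfl⟩⟩⟩, c, d, rfl⟩)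
    · exact .inl ⟨x, .inl hx, rfl⟩
    · exact .inr ⟨hm.trans (Nat.lt_succ_self m), h⟩
    · exact .inl ⟨_, .inr ⟨j, c, d, rfl⟩, rfl⟩
    · exact .inr ⟨Nat.lt_succ_self m, (MulAction.ofQuotientStabilizer G t₀ c, d), rfl⟩

variable (h : IsAttachment (diskBoundary n) i χ)
  (hK : ∀ t, ∀ d ∈ diskBoundary n, ∃ x ∈ K.skeletonLT n, i x = χ (t, d))

-- By `hK` the boundary of the new cell already lies in the `(n - 1)`-skeleton, so no point of `X`
-- enters a skeleton earlier than before.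
include h hK in
lemma apply_mem_insertSkeletonLT {m : ℕ} {x : X} :
    i x ∈ K.insertSkeletonLT i χ m ↔ x ∈ K.skeletonLT m := by
  rw [mem_insertSkeletonLT]
  constructor
  · rintro (⟨x', hx', e⟩ | ⟨hm, ⟨t, d⟩, e⟩)
    · rwa [← h.isClosedEmbedding.injective e]
    · obtain ⟨x', hx', e'⟩ := hK t d (h.mem_of_eq x t d e.symm)
      rw [← h.isClosedEmbedding.injective (e'.trans e)]
      exact K.skeletonLT_mono hm.le hx'
  · exact fun hx => .inl ⟨x, hx, rfl⟩

include h hK in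
lemma isClosed_insertSkeletonLT (m : ℕ) : IsClosed (K.insertSkeletonLT i χ m) := by
  have hi : IsClosed (i '' K.skeletonLT m) :=
    h.isClosedEmbedding.isClosedMap _ (K.isClosed_skeletonLT m)
  refine h.isClosed_of _ ?_ ?_
  · convert K.isClosed_skeletonLT m
    ext x
    exact apply_mem_insertSkeletonLT h hK
  · rcases lt_or_ge n m with hm | hm
    · convert isClosed_univ
      exact eq_univ_of_forall fun x => char_mem_insertSkeletonLT hm x
    · convert hi.preimage χ.continuous using 1
      ext x
      exact mem_insertSkeletonLT_of_le hm

include h hK in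
lemma isClosed_inter_insertSkeletonLT_succ [DiscreteTopology T] [MulAction.IsPretransitive G T]
    {m : ℕ} {A : Set Y} (hA : IsClosed (A ∩ K.insertSkeletonLT i χ m))
    (hA' : ∀ j c, IsClosed (K.insertMap i χ t₀ m j c ⁻¹' A)) :
    IsClosed (A ∩ K.insertSkeletonLT i χ (m + 1)) := by
  have hX : IsClosed (i ⁻¹' A ∩ K.skeletonLT (m + 1)) := by
    refine K.isClosed_of_subset_skeletonLT_succ inter_subset_right ?_ fun j c => ?_
    · convert hA.preimage i.continuous using 1
      ext x
      simp only [mem_inter_iff, mem_preimage, apply_mem_insertSkeletonLT h hK]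
      exact ⟨fun hx => ⟨hx.1.1, hx.2⟩, fun hx => ⟨⟨hx.1, K.skeletonLT_mono m.le_succ hx.2⟩, hx.2⟩⟩
    · convert hA' (.inl j) c using 1
      ext d
      exact and_iff_left (K.map_mem_skeletonLT m j c d)
  refine h.isClosed_of _ ?_ ?_
  · convert hX using 1
    ext x
    simp only [mem_inter_iff, mem_preimage, apply_mem_insertSkeletonLT h hK]
  -- For `m < n` the skeleton lies in the image of `X`; for `m = n` the new cell is tested by `hA'`,
  -- one point of the orbit at a time; for `m > n` the cell is already contained in the previous
  -- skeleton.
  · rcases lt_trichotomy m n with hm | rfl | hm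
    · convert (h.isClosedEmbedding.isClosedMap _ hX).preimage χ.continuous using 1
      ext x
      simp only [mem_preimage, mem_inter_iff, mem_insertSkeletonLT_of_le hm]
      constructor
      · rintro ⟨hx, x', hx', e⟩
        exact ⟨x', ⟨by rwa [mem_preimage, e], hx'⟩, e⟩
      · rintro ⟨x', ⟨hx, hx'⟩, e⟩
        exact ⟨by rwa [mem_preimage, e] at hx, x', hx', e⟩
    · rw [isClosed_prod_of_discrete_left]
      intro t
      obtain ⟨c, rfl⟩ := exists_ofQuotientStabilizer (G := G) (t₀ := t₀) t
      convert hA' (.inr ⟨⟨rfl⟩⟩) c using 1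
      ext d
      exact and_iff_left (char_mem_insertSkeletonLT (Nat.lt_succ_self m) _)
    · convert hA.preimage χ.continuous using 1
      ext x
      exact and_congr_right fun _ => iff_of_true
        (char_mem_insertSkeletonLT (hm.trans (Nat.lt_succ_self m)) x)
        (char_mem_insertSkeletonLT hm x)

variable (t₀) in
/-- Attaching an `n`-cell to a `G`-CW-complex along a map to the `(n - 1)`-skeleton. -/
def insertCell [DiscreteTopology T] [MulAction.IsPretransitive G T] : GCWComplex G Y where
  cell m := K.InsertCell n m
  stab m j := K.insertStab t₀ m j
  map m j c := K.insertMap i χ t₀ m j c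
  map_smul m j g c d := by
    rcases j with j | ⟨⟨⟨rfl⟩⟩⟩
    · exact (congrArg i (K.map_smul m j g c d)).trans (i.map_smul g _)
    · refine (congrArg (fun t => χ (t, d)) (MulAction.ofQuotientStabilizer_smul G t₀ g c)).trans ?_
      exact χ.map_smul g (_, d)
  skeletonLT m := K.insertSkeletonLT i χ m
  skeletonLT_zero := by
    ext y
    simp [mem_insertSkeletonLT, K.skeletonLT_zero]
  skeletonLT_succ m := by
    ext y
    simp only [mem_insertSkeletonLT_succ (t₀ := t₀), mem_union, mem_iUnion, mem_range]
  map_boundary m j c d hd := by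
    rcases j with j | ⟨⟨⟨rfl⟩⟩⟩
    · exact (apply_mem_insertSkeletonLT h hK).2 (K.map_boundary m j c d hd)
    · exact .inl (hK _ d hd)
  map_interior m j c d hd := by
    rcases j with j | ⟨⟨⟨rfl⟩⟩⟩
    · exact fun hc => K.map_interior m j c d hd ((apply_mem_insertSkeletonLT h hK).1 hc)
    · rw [mem_insertSkeletonLT_of_le le_rfl]
      rintro ⟨x, -, hx⟩
      exact hd.ne (h.mem_of_eq x _ d hx)
  map_injective m y z hy hz e := by
    rcases y with ⟨j | ⟨⟨⟨rfl⟩⟩⟩, c, d⟩ <;> rcases z with ⟨j' | ⟨⟨⟨h'⟩⟩⟩, c', d'⟩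
    · have := K.map_injective m ⟨j, c, d⟩ ⟨j', c', d'⟩ hy hz (h.isClosedEmbedding.injective e)
      cases this
      rfl
    · subst h'
      exact absurd (h.mem_of_eq _ _ d' e) hz.ne
    · exact absurd (h.mem_of_eq _ _ d e.symm) hy.ne
    · obtain ⟨h1, rfl⟩ := h.injective _ _ _ _ hy.ne hz.ne e
      obtain rfl := MulAction.injective_ofQuotientStabilizer G t₀ h1
      rfl
  isClosed_skeletonLT_succ m A hA hA' := by
    rw [isClosed_preimage_val_iff (isClosed_insertSkeletonLT h hK _)] at hA ⊢
    exact isClosed_inter_insertSkeletonLT_succ h hK hA hA'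
  iUnion_skeletonLT := by
    refine eq_univ_of_forall fun y => mem_iUnion.2 ?_
    induction y using h.ind with
    | hl x =>
      have hx : x ∈ ⋃ n, K.skeletonLT n := K.iUnion_skeletonLT ▸ mem_univ x
      obtain ⟨m, hm⟩ := mem_iUnion.1 hx
      exact ⟨m, .inl ⟨x, hm, rfl⟩⟩
    | hr t d => exact ⟨n + 1, char_mem_insertSkeletonLT (Nat.lt_succ_self n) _⟩
  isClosed_of_skeletonLT A hA := by
    replace hA : ∀ m, IsClosed (A ∩ K.insertSkeletonLT i χ m) := fun m =>
      (isClosed_preimage_val_iff (isClosed_insertSkeletonLT h hK _)).1 (hA m)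
    refine h.isClosed_of _ (K.isClosed_of_skeletonLT _ fun m => ?_) ?_
    · rw [isClosed_preimage_val_iff (K.isClosed_skeletonLT m)]
      convert (hA m).preimage i.continuous using 1
      ext x
      exact and_congr_right fun _ => (apply_mem_insertSkeletonLT h hK).symm
    · convert (hA (n + 1)).preimage χ.continuous using 1
      ext x
      exact (and_iff_left (char_mem_insertSkeletonLT (Nat.lt_succ_self n) x)).symm

lemma isFinite_insertCell [DiscreteTopology T] [MulAction.IsPretransitive G T]
    (hf : K.IsFinite) : (insertCell t₀ h hK).IsFinite := by
  have : Finite (Σ m, K.cell m) := hf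
  refine Finite.of_injective (β := (Σ m, K.cell m) ⊕ Unit)
    (fun x : Σ m, K.InsertCell n m => x.2.elim (fun j => .inl ⟨x.1, j⟩) fun _ => .inr ()) ?_
  rintro ⟨m, j | ⟨⟨⟨rfl⟩⟩⟩⟩ ⟨m', j' | ⟨⟨⟨rfl⟩⟩⟩⟩ e
  · cases e
    rfl
  · cases e
  · cases e
  · rfl

end InsertCell

end GCWComplex

/-! ### From cellular spaces to finite complexes -/

section CellularApproximation

variable {G : Type u} [Group G]

/-- Equivariant maps from `T × Sⁿ⁻¹` to a finite complex can be deformed to the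
`(n - 1)`-skeleton. -/
lemma GCWComplex.IsFinite.exists_compression {X T : Type u} [TopologicalSpace X] [MulAction G X]
    [ContinuousConstSMul G X] [TopologicalSpace T] [MulAction G T] [ContinuousConstSMul G T]
    [MulAction.IsPretransitive G T] [Nonempty T] {K : GCWComplex G X} (hK : K.IsFinite) {n : ℕ}
    (φ : GHom G (T × diskBoundary n) X) :
    ∃ φ' : GHom G (T × diskBoundary n) (K.stage n ∅),
      φ.Homotopic ((GHom.val (K.stage n ∅)).comp φ') := by
  -- Induct over the cells of dimension `m ≥ n`: a map from an `(n - 1)`-sphere is pushed off the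
  -- last cell, then treated in the smaller stage.
  have key := hK.induction n (motive := fun A => ∀ φ : GHom G (T × diskBoundary n) A,
    ∃ φ' : GHom G (T × diskBoundary n) (K.stage n ∅),
      ((GHom.val A).comp φ).Homotopic ((GHom.val (K.stage n ∅)).comp φ'))
    (fun φ => ⟨φ, .refl _⟩) (by
      intro m hm A A' hA _ _ T₀ _ _ _ _ _ χ hχ ih φ
      obtain ⟨φ₁, h₁⟩ := hχ.exists_compression hm φ
      obtain ⟨φ₂, h₂⟩ := ih φ₁
      exact ⟨φ₂, (h₁.comp_left (GHom.val A')).trans h₂⟩)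
  exact key (φ.codRestrict ⊤ fun _ => mem_univ _)

/-- Cellular spaces are equivalent to finite `G`-CW-complexes. -/
theorem IsCellular.exists_equivalent {X : Type u} [TopologicalSpace X] [MulAction G X]
    [ContinuousConstSMul G X] (hX : IsCellular G X) :
    ∃ (Y : Type u) (_ : TopologicalSpace Y) (_ : MulAction G Y) (_ : ContinuousConstSMul G Y),
      IsFiniteGCWComplex G Y ∧ GEquivalent G X Y := by
  induction hX with
  | empty X =>
    refine ⟨X, inferInstance, inferInstance, inferInstance, ⟨⟨fun _ => PEmpty, fun _ => PEmpty.elim,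
      fun _ => nofun, fun _ => nofun, fun _ => ∅, rfl, fun _ => Subsingleton.elim _ _, fun _ => nofun,
      fun _ => nofun, fun _ => nofun, fun _ A _ _ => ?_, Subsingleton.elim _ _, fun A _ => ?_⟩, ?_⟩,
      ⟨GHom.id G X, .id G X⟩⟩
    · rw [Subsingleton.elim A ∅]; simp
    · rw [Subsingleton.elim A ∅]; simp
    · exact @Finite.of_subsingleton _ ⟨fun x => x.2.elim⟩
  | equiv _ e ih =>
    obtain ⟨Y, _, _, _, hY, e'⟩ := ih
    exact ⟨Y, _, _, inferInstance, hY, e.symm.trans e'⟩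
  | @attach X Y T _ _ _ _ _ _ _ _ _ _ _ n i χ _ h ih =>
    have : ContinuousConstSMul G T := ⟨fun _ => continuous_of_discreteTopology⟩
    obtain ⟨X₀, _, _, _, ⟨K, hK⟩, ⟨a, ha⟩⟩ := ih
    -- Transport the attaching map to the complex `X₀` and deform it into the `(n - 1)`-skeleton,
    -- since only then does the new cell extend the CW-structure.
    obtain ⟨φ, hφ⟩ := hK.exists_compression (a.comp h.attachingMap)
    let ψ := (GHom.val (K.stage n ∅)).comp φ
    have e : GEquivalent G (DoubleCyl.Attach h.attachingMap) (DoubleCyl.Attach ψ) :=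
      DoubleCyl.equivalent_of_isEquiv ha (.id _ _) (.id _ _) hφ (.refl _)
    have hψ := DoubleCyl.isAttachment_attach ψ
    refine ⟨DoubleCyl.Attach ψ, inferInstance, inferInstance, inferInstance,
      ⟨GCWComplex.insertCell (K := K) (Classical.arbitrary T) hψ ?_, ?_⟩, h.equivalent_attach.trans e⟩
    · intro t d hd
      refine ⟨ψ (t, ⟨d, hd⟩), ?_, ?_⟩
      · rw [← K.stage_empty]
        exact (φ _).2
      · have := hψ.attachingMap_spec (t, ⟨d, hd⟩)
        rwa [DoubleCyl.attachingMap_attach] at this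
    · exact GCWComplex.isFinite_insertCell _ _ hK

end CellularApproximation

variable {G : Type u} [Group G]

/-! ### Homotopy trivialization over a disk -/

section DiskTransport

variable {E : Type u} [TopologicalSpace E] [MulAction G E]

/-- An invariant map from `P` to the disk along which points can be transported, where `O` is the
preimage of the center and `C` is the preimage of the points of norm at least `1 / 2`. -/
structure DiskTransport (n : ℕ) (P O C : SubMulAction G E) where
  coord : C(P, EuclideanDisk n)
  coord_smul : ∀ (g : G) e, coord (g • e) = coord e
  move : GHom G ((P × EuclideanDisk n) × I) P
  move_zero : ∀ e v, move ((e, v), 0) = e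
  coord_move : ∀ e v (t : I), (coord (move ((e, v), t)) : EuclideanSpace ℝ (Fin n)) =
    (1 - t : ℝ) • (coord e : EuclideanSpace ℝ (Fin n)) + (t : ℝ) • (v : EuclideanSpace ℝ (Fin n))
  center_le : O ≤ P
  outer_le : C ≤ P
  mem_center : ∀ e : P, (e : E) ∈ O ↔ (coord e : EuclideanSpace ℝ (Fin n)) = 0
  mem_outer : ∀ e : P, (e : E) ∈ C ↔ 1 / 2 ≤ ‖(coord e : EuclideanSpace ℝ (Fin n))‖

namespace DiskTransport

variable {n : ℕ} {P O C : SubMulAction G E} (Λ : DiskTransport n P O C)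

lemma coord_move_one (e : P) (v : EuclideanDisk n) : Λ.coord (Λ.move ((e, v), 1)) = v :=
  Subtype.ext (by simp [Λ.coord_move])

lemma coe_move_zero (e : P) (v : EuclideanDisk n) : (Λ.move ((e, v), 0) : E) = e :=
  congrArg Subtype.val (Λ.move_zero e v)

lemma norm_clip_two {v : EuclideanSpace ℝ (Fin n)} (h : 1 / 2 ≤ ‖v‖) :
    clip ((2 : ℝ) • v) ∈ diskBoundary n := by
  have h1 : ‖(2 : ℝ) • v‖ = 2 * ‖v‖ := by rw [norm_smul]; norm_num
  have h2 : (1 : ℝ) ≤ ‖(2 : ℝ) • v‖ := by linarith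
  change ‖(max 1 ‖(2 : ℝ) • v‖)⁻¹ • (2 : ℝ) • v‖ = 1
  rw [max_eq_right h2, norm_smul, norm_inv, norm_norm, inv_mul_cancel₀ (by linarith)]

lemma clip_two_of_mem {v : EuclideanDisk n} (h : v ∈ diskBoundary n) :
    clip ((2 : ℝ) • (v : EuclideanSpace ℝ (Fin n))) = v := by
  have hv : ‖(v : EuclideanSpace ℝ (Fin n))‖ = 1 := h
  have h1 : ‖(2 : ℝ) • (v : EuclideanSpace ℝ (Fin n))‖ = 2 := by rw [norm_smul, hv]; norm_num
  ext1
  change (max 1 ‖(2 : ℝ) • (v : EuclideanSpace ℝ (Fin n))‖)⁻¹ • (2 : ℝ) • (v : EuclideanSpace ℝ (Fin n)) = v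
  rw [h1, max_eq_right one_le_two, smul_smul, inv_mul_cancel₀ two_ne_zero, one_smul]

/-- The points of the segment from `v` to its radial projection to the sphere stay away from the
center. -/
lemma half_le_norm_segment {v : EuclideanSpace ℝ (Fin n)} (h : 1 / 2 ≤ ‖v‖) (t : I) :
    1 / 2 ≤ ‖(1 - t : ℝ) • v + (t : ℝ) • (clip ((2 : ℝ) • v) : EuclideanSpace ℝ (Fin n))‖ := by
  have h1 : ‖(2 : ℝ) • v‖ = 2 * ‖v‖ := by rw [norm_smul]; norm_num
  have h0 : ‖v‖ ≠ 0 := by linarith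
  have hc : (clip ((2 : ℝ) • v) : EuclideanSpace ℝ (Fin n)) = ‖v‖⁻¹ • v := by
    change (max 1 ‖(2 : ℝ) • v‖)⁻¹ • (2 : ℝ) • v = _
    rw [h1, max_eq_right (by linarith), smul_smul]
    congr 1
    field_simp
  have ht0 := t.2.1
  have ht1 := t.2.2
  have hs : 0 ≤ (1 - t : ℝ) + t * ‖v‖⁻¹ := add_nonneg (by linarith) (by positivity)
  rw [hc, smul_smul, ← add_smul, norm_smul, Real.norm_of_nonneg hs, add_mul, mul_assoc,
    inv_mul_cancel₀ h0]
  nlinarith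

/-- The retraction to the center. -/
def toCenter : GHom G P O :=
  ((GHom.val P).comp (GHom.of (fun e => Λ.move ((e, ⟨0, by simp⟩), 1)) (by fun_prop) (by
    intro g e
    exact Λ.move.map_smul g ((e, ⟨0, by simp⟩), 1)))).codRestrict O fun e =>
      (Λ.mem_center _).2 (congrArg Subtype.val (Λ.coord_move_one e _))

variable [ContinuousConstSMul G E]

/-- Transport to the center keeps the coordinate of a point of `O` at `0`, but it may still move the
point inside `O`. The transport itself is the homotopy, and in general equality fails. -/
lemma toCenter_incl : (Λ.toCenter.comp (GHom.incl Λ.center_le)).Homotopic (GHom.id G O) := by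
  refine .symm (.of_uncurried (((GHom.val P).comp (GHom.of (fun x : O × I =>
    Λ.move ((GHom.incl Λ.center_le x.1, ⟨0, by simp⟩), x.2)) (by fun_prop) fun g x => ?_)).codRestrict
      O fun x => ?_) (fun x => ?_) fun x => rfl)
  · exact Λ.move.map_smul g ((GHom.incl Λ.center_le x.1, ⟨0, by simp⟩), x.2)
  · refine (Λ.mem_center _).2 ?_
    refine (Λ.coord_move _ _ _).trans ?_
    rw [(Λ.mem_center (GHom.incl Λ.center_le x.1)).1 x.1.2]
    simp
  · exact Subtype.ext (Λ.coe_move_zero _ _)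

lemma isEquiv_toCenter : Λ.toCenter.IsEquiv := by
  refine ⟨GHom.incl Λ.center_le, .symm (.of_uncurried (GHom.of (fun x : P × I =>
    Λ.move ((x.1, ⟨0, by simp⟩), x.2)) (by fun_prop) fun g x => ?_) (fun x => Λ.move_zero _ _)
      fun x => rfl), Λ.toCenter_incl⟩
  exact Λ.move.map_smul g ((x.1, ⟨0, by simp⟩), x.2)

/-- The comparison map to the product of the center and the disk. -/
noncomputable def toProd : GHom G P (O × EuclideanDisk n) :=
  .of (fun e => (Λ.toCenter e, clip ((2 : ℝ) • (Λ.coord e : EuclideanSpace ℝ (Fin n)))))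
    (by fun_prop) (by intro g e; simp [Λ.coord_smul])

/-- Projection to `O` is an equivalence because the disk is contractible, and its composite with
`toProd` is `toCenter`. -/
lemma isEquiv_toProd : Λ.toProd.IsEquiv := by
  let q : GHom G (O × EuclideanDisk n) O := .of Prod.fst (by fun_prop) fun _ _ => rfl
  have hq : q.IsEquiv := by
    refine ⟨.of (fun e => (e, clip 0)) (by fun_prop) fun _ _ => rfl, .of_uncurried
      (.of (fun x => (x.1.1, clip ((x.2 : ℝ) • (x.1.2 : EuclideanSpace ℝ (Fin n))))) (by fun_prop)
        fun _ _ => rfl) (fun x => ?_) (fun x => ?_), .of_eq fun x => rfl⟩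
    · simp [q]
    · simp
  exact hq.of_comp_left Λ.isEquiv_toCenter

/-- The comparison map of the outer part to the product of the center and the sphere. -/
noncomputable def toSphere : GHom G C (O × diskBoundary n) :=
  .of (fun e => (Λ.toCenter (GHom.incl Λ.outer_le e),
    ⟨clip ((2 : ℝ) • (Λ.coord (GHom.incl Λ.outer_le e) : EuclideanSpace ℝ (Fin n))),
      norm_clip_two ((Λ.mem_outer (GHom.incl Λ.outer_le e)).1 e.2)⟩))
    (by fun_prop) (by intro g e; simp [Λ.coord_smul])

/-- The inverse of `toSphere` up to homotopy. -/
def ofSphere : GHom G (O × diskBoundary n) C :=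
  ((GHom.val P).comp (GHom.of (fun x : O × diskBoundary n =>
    Λ.move ((GHom.incl Λ.center_le x.1, (x.2 : EuclideanDisk n)), 1)) (by fun_prop) (by
      intro g x
      exact Λ.move.map_smul g ((GHom.incl Λ.center_le x.1, (x.2 : EuclideanDisk n)), 1)))).codRestrict
    C fun x => (Λ.mem_outer _).2 (by
      have h : ‖((x.2 : EuclideanDisk n) : EuclideanSpace ℝ (Fin n))‖ = 1 := x.2.2
      refine le_of_le_of_eq ?_ (congrArg (fun d : EuclideanDisk n => ‖(d : EuclideanSpace ℝ (Fin n))‖)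
        (Λ.coord_move_one (GHom.incl Λ.center_le x.1) x.2)).symm
      rw [h]
      norm_num)

lemma incl_ofSphere (x : O × diskBoundary n) : GHom.incl Λ.outer_le (Λ.ofSphere x) =
    Λ.move ((GHom.incl Λ.center_le x.1, (x.2 : EuclideanDisk n)), 1) := rfl

/-- Stopping the inner transport at time `t` deforms the first component to transport of a point
that is already central, which `toCenter_incl` handles; the second component needs no change. -/
lemma toSphere_ofSphere :
    (Λ.toSphere.comp Λ.ofSphere).Homotopic (GHom.id G (O × diskBoundary n)) := by
  have h1 : (Λ.toSphere.comp Λ.ofSphere).Homotopic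
      ((Λ.toCenter.comp (GHom.incl Λ.center_le)).prodMap (.id _)) := by
    refine .symm (.of_uncurried (.of (fun x : (O × diskBoundary n) × I =>
      (Λ.toCenter (Λ.move ((GHom.incl Λ.center_le x.1.1, (x.1.2 : EuclideanDisk n)), x.2)), x.1.2))
      (by fun_prop) fun g x => ?_) (fun x => ?_) fun x => ?_)
    · refine Prod.ext ?_ rfl
      exact (congrArg Λ.toCenter (Λ.move.map_smul g ((GHom.incl Λ.center_le x.1.1, _), x.2))).trans
        (Λ.toCenter.map_smul _ _)
    · simp [Λ.move_zero]
    · refine Prod.ext rfl (Subtype.ext ?_)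
      simp only [toSphere, GHom.comp_apply, GHom.of_apply, incl_ofSphere, coord_move_one]
      exact (clip_two_of_mem x.2.2).symm
  exact h1.trans (Λ.toCenter_incl.prodMap (.id _))

/-- The composite travels to the center and then out to the projected point `s e`. With `k₃` the
intermediate stop is moved from the center to the coordinate of `e`; the end stays on the sphere
throughout. The resulting path is undone by `k₂`, which retracts the radial leg outside norm `1 /
2`, and by `k₁`, which has constant coordinate. -/
lemma ofSphere_toSphere : (Λ.ofSphere.comp Λ.toSphere).Homotopic (GHom.id G C) := by
  let ι : GHom G C P := GHom.incl Λ.outer_le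
  let s : C → EuclideanDisk n := fun e => clip ((2 : ℝ) • (Λ.coord (ι e) : EuclideanSpace ℝ (Fin n)))
  have hs : ∀ e, s e ∈ diskBoundary n := fun e => norm_clip_two ((Λ.mem_outer (ι e)).1 e.2)
  have hsc : Continuous s := by fun_prop
  have hsg : ∀ (g : G) e, s (g • e) = s e := fun g e => by simp [s, Λ.coord_smul]
  have hv : ∀ (g : G) e, Λ.coord (ι (g • e)) = Λ.coord (ι e) := fun g e => by simp [Λ.coord_smul]
  let k₁ : GHom G (C × I) P := .of (fun x => Λ.move ((ι x.1, Λ.coord (ι x.1)), x.2)) (by fun_prop) (by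
    intro g x
    simp only [smul_fst_trivial, smul_snd_trivial, hv]
    rw [ι.map_smul]
    exact Λ.move.map_smul g ((ι x.1, Λ.coord (ι x.1)), x.2))
  have hk₁ : ∀ x, Λ.coord (k₁ x) = Λ.coord (ι x.1) := fun x => Subtype.ext (by
    simp only [k₁, GHom.of_apply, Λ.coord_move]
    rw [← add_smul, sub_add_cancel, one_smul])
  let k₂ : GHom G (C × I) P := .of (fun x => Λ.move ((k₁ (x.1, 1), s x.1), x.2)) (by fun_prop) (by
    intro g x
    simp only [smul_fst_trivial, smul_snd_trivial, hsg]
    rw [← smul_mk_trivial, k₁.map_smul]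
    exact Λ.move.map_smul g ((k₁ (x.1, 1), s x.1), x.2))
  let k₃ : GHom G (C × I) P := .of (fun x => Λ.move ((Λ.move ((ι x.1,
      clip ((x.2 : ℝ) • (Λ.coord (ι x.1) : EuclideanSpace ℝ (Fin n)))), 1), s x.1), 1))
      (by fun_prop) (by
    intro g x
    simp only [smul_fst_trivial, smul_snd_trivial, hsg, hv]
    rw [ι.map_smul, ← smul_mk_trivial, ← smul_mk_trivial, Λ.move.map_smul, ← smul_mk_trivial,
      ← smul_mk_trivial, Λ.move.map_smul])
  have m₁ : ∀ x, (k₁ x : E) ∈ C := fun x => (Λ.mem_outer _).2 (by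
    rw [hk₁]
    exact (Λ.mem_outer _).1 x.1.2)
  have m₂ : ∀ x, (k₂ x : E) ∈ C := fun x => (Λ.mem_outer _).2 (by
    simp only [k₂, GHom.of_apply, Λ.coord_move, hk₁]
    exact half_le_norm_segment ((Λ.mem_outer (ι x.1)).1 x.1.2) x.2)
  have m₃ : ∀ x, (k₃ x : E) ∈ C := fun x => (Λ.mem_outer _).2 (by
    simp only [k₃, GHom.of_apply, Λ.coord_move_one]
    rw [show ‖_‖ = 1 from hs x.1]
    norm_num)
  let l₁ := ((GHom.val P).comp k₁).codRestrict C m₁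
  let l₂ := ((GHom.val P).comp k₂).codRestrict C m₂
  let l₃ := ((GHom.val P).comp k₃).codRestrict C m₃
  have h₁ : (GHom.id G C).Homotopic (l₁.comp (DoubleCyl.slice C 1)) :=
    .of_uncurried l₁ (fun x => Subtype.ext (Λ.coe_move_zero _ _)) fun x => rfl
  have h₂ : (l₁.comp (DoubleCyl.slice C 1)).Homotopic (l₂.comp (DoubleCyl.slice C 1)) :=
    .of_uncurried l₂ (fun x => Subtype.ext (Λ.coe_move_zero _ _)) fun x => rfl
  have h₃ : (Λ.ofSphere.comp Λ.toSphere).Homotopic (l₂.comp (DoubleCyl.slice C 1)) := by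
    refine .of_uncurried l₃ (fun x => Subtype.ext ?_) fun x => Subtype.ext ?_
    · refine congrArg (fun v => (Λ.move ((Λ.move ((ι x, v), 1), s x), 1) : E)) ?_
      ext1
      change ((clip (((0 : I) : ℝ) • _) : EuclideanDisk n) : EuclideanSpace ℝ (Fin n)) = 0
      rw [Icc.coe_zero, zero_smul, clip_of_le (by simp)]
    · refine congrArg (fun v => (Λ.move ((Λ.move ((ι x, v), 1), s x), 1) : E)) ?_
      change clip (((1 : I) : ℝ) • _) = _
      rw [Icc.coe_one, one_smul, clip_coe]
      rfl
  exact h₃.trans (h₁.trans h₂).symm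

/-- A space which is glued from `N` and `P` is obtained from `N` by attaching `O × Dⁿ`. -/
lemma equivalent_attach {N : Type u} [TopologicalSpace N] [MulAction G N] [ContinuousConstSMul G N]
    (f : GHom G C N) : GEquivalent G (DoubleCyl f (GHom.incl Λ.outer_le))
      (DoubleCyl.Attach (f.comp Λ.ofSphere)) :=
  -- The square with `toProd` and `toSphere` commutes strictly; the one over `N` commutes only up to
  -- homotopy.
  DoubleCyl.equivalent_of_isEquiv (.id G N) ⟨Λ.ofSphere, Λ.ofSphere_toSphere, Λ.toSphere_ofSphere⟩
    Λ.isEquiv_toProd (Λ.ofSphere_toSphere.symm.comp_left f) (.of_eq fun _ => rfl)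

end DiskTransport

end DiskTransport

/-! ### Fibrations over a space with an attached cell -/

section Fibrations

variable {G : Type u} [Group G] {A B E T : Type u} [TopologicalSpace A] [TopologicalSpace B]
  [TopologicalSpace E] [TopologicalSpace T] [MulAction G A] [MulAction G B] [MulAction G E]
  [MulAction G T]

/-- The equivariant homotopy lifting property. -/
def GHom.IsFibration (p : GHom G E B) : Prop :=
  ∀ (X : Type u) [TopologicalSpace X] [MulAction G X] [ContinuousConstSMul G X] (f : GHom G X E)
    (H : GHom G (X × I) B), (∀ x, H (x, 0) = p (f x)) →
      ∃ L : GHom G (X × I) E, (∀ x, L (x, 0) = f x) ∧ ∀ x, p (L x) = H x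

namespace IsAttachment

variable {n : ℕ} {i : GHom G A B} {χ : GHom G (T × EuclideanDisk n) B}
  (h : IsAttachment (diskBoundary n) i χ)

/-- The part of the total space over the points with radius in a given set. -/
noncomputable def shell (p : GHom G E B) (s : Set ℝ) : SubMulAction G E where
  carrier := {e | h.radius (p e) ∈ s}
  smul_mem' g e he := by
    rw [mem_ofPred_eq, p.map_smul, h.radius_smul]
    exact he

lemma mem_shell {p : GHom G E B} {s : Set ℝ} {e : E} : e ∈ h.shell p s ↔ h.radius (p e) ∈ s :=
  Iff.rfl

lemma isClosed_shell (p : GHom G E B) {s : Set ℝ} (hs : IsClosed s) :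
    IsClosed (h.shell p s : Set E) :=
  hs.preimage (h.continuous_radius.comp p.continuous)

lemma radius_eq_norm_coord {b : B} (hb : h.radius b ≤ 2 / 3) : h.radius b = ‖h.coord b‖ := by
  induction b using h.ind with
  | hl x => rw [h.radius_left] at hb; norm_num at hb
  | hr t d =>
    rw [h.radius_right] at hb ⊢
    rw [h.coord_right_of_le hb]

variable [ContinuousConstSMul G B]

section Expand

/-- Pushing the points away from the center of an attachment. -/
noncomputable def expand : GHom G (B × I) B :=
  h.cellwise (diskExpand n (1 / 3) (by norm_num))
    (diskExpand_boundary (by norm_num) (by norm_num))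

lemma expand_zero (b : B) : h.expand (b, 0) = b := by
  induction b using h.ind with
  | hl x => simp [expand]
  | hr t d => simp [expand, diskExpand_zero]

lemma radius_expand_left (x : A) (t : I) : h.radius (h.expand (i x, t)) = 1 := by
  simp [expand, h.radius_left]

lemma radius_expand {b : B} (hb : 1 / 3 ≤ h.radius b) (t : I) :
    h.radius (h.expand (b, t)) = (1 - t) * h.radius b + t := by
  induction b using h.ind with
  | hl x => rw [radius_expand_left, h.radius_left]; ring
  | hr c d =>
    rw [h.radius_right] at hb ⊢
    simp only [expand, cellwise_right, h.radius_right]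
    have h0 : ‖(d : EuclideanSpace ℝ (Fin n))‖ ≠ 0 := by linarith
    have hd := d.norm_le
    have ht0 := t.2.1
    have ht1 := t.2.2
    have hs : (0 : ℝ) ≤ (1 - t : ℝ) + t / ‖(d : EuclideanSpace ℝ (Fin n))‖ :=
      add_nonneg (by linarith) (by positivity)
    have hn : ‖((1 - t : ℝ) + t / ‖(d : EuclideanSpace ℝ (Fin n))‖) •
        (d : EuclideanSpace ℝ (Fin n))‖ = (1 - t) * ‖(d : EuclideanSpace ℝ (Fin n))‖ + t := by
      rw [norm_smul, Real.norm_of_nonneg hs, add_mul, div_mul_cancel₀ _ h0]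
    simp only [diskExpand, ContinuousMap.coe_mk, max_eq_left hb]
    rw [clip_of_le, hn]
    rw [hn]
    nlinarith

/-- The part of a fibration outside the center of an attachment deforms to the boundary. -/
lemma isEquiv_incl_shell [ContinuousConstSMul G E] {p : GHom G E B} (hp : p.IsFibration)
    (hle : h.shell p {1} ≤ h.shell p (Ici (1 / 3))) : (GHom.incl hle).IsEquiv := by
  -- Lift the radial expansion of the base, starting from the inclusion. At time `1` the lift lies
  -- over radius `1`, which gives the retraction.
  obtain ⟨L, hL0, hL⟩ := hp (h.shell p (Ici (1 / 3))) (GHom.val _)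
    (h.expand.comp ((p.comp (GHom.val _)).prodMap (.id I))) fun x => h.expand_zero _
  have hr : ∀ x, h.radius (p (L x)) = (1 - x.2) * h.radius (p x.1) + x.2 := fun x => by
    rw [hL]
    exact h.radius_expand x.1.2 x.2
  -- Over radius `1` the expansion does not change the radius, so the lifted homotopy stays in that
  -- part; `L₂` likewise stays over radius at least `1 / 3`.
  let L₁ : GHom G (h.shell p {1} × I) (h.shell p {1}) :=
    (L.comp ((GHom.incl hle).prodMap (.id I))).codRestrict _ fun x => by
      have h1 : h.radius (p x.1) = 1 := x.1.2
      rw [mem_shell, mem_singleton_iff]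
      refine (hr _).trans ?_
      change (1 - (x.2 : ℝ)) * h.radius (p x.1) + x.2 = 1
      rw [h1]
      ring
  let L₂ : GHom G (h.shell p (Ici (1 / 3)) × I) (h.shell p (Ici (1 / 3))) :=
    L.codRestrict _ fun x => by
      have h1 : 1 / 3 ≤ h.radius (p x.1) := x.1.2
      have h2 := x.2.2.2
      rw [mem_shell, mem_Ici, hr]
      nlinarith [x.2.2.1, h.radius_le_one (p x.1)]
  let r : GHom G (h.shell p (Ici (1 / 3))) (h.shell p {1}) :=
    (L.comp (DoubleCyl.slice _ 1)).codRestrict _ fun x => by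
      rw [mem_shell, mem_singleton_iff]
      refine (hr _).trans ?_
      change (1 - ((1 : I) : ℝ)) * _ + ((1 : I) : ℝ) = 1
      simp
  exact ⟨r, .symm (.of_uncurried L₁ (fun x => Subtype.ext (hL0 _)) fun x => rfl),
    .symm (.of_uncurried L₂ (fun x => Subtype.ext (hL0 _)) fun x => rfl)⟩

end Expand

section Move

/-- Moving the points close to the center of the disk along segments. -/
noncomputable def _root_.diskMove (n : ℕ) :
    C(EuclideanDisk n × (EuclideanDisk n × I), EuclideanDisk n) where
  -- The target is scaled to the ball of radius `2 / 3`, on which the damping factor is `1`, so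
  -- there the motion follows a segment exactly.
  toFun x := clip ((x.1 : EuclideanSpace ℝ (Fin n)) +
    (x.2.2 * min 1 (3 * (1 - ‖(x.1 : EuclideanSpace ℝ (Fin n))‖)) : ℝ) •
      ((2 / 3 : ℝ) • (x.2.1 : EuclideanSpace ℝ (Fin n)) - x.1))

lemma _root_.diskMove_boundary {n : ℕ} (s : EuclideanDisk n) (hs : s ∈ diskBoundary n)
    (w : EuclideanDisk n × I) : diskMove n (s, w) = s := by
  have hs' : ‖(s : EuclideanSpace ℝ (Fin n))‖ = 1 := hs
  simp [diskMove, hs']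

lemma _root_.diskMove_zero {n : ℕ} (d v : EuclideanDisk n) : diskMove n (d, (v, 0)) = d := by
  simp [diskMove]

lemma _root_.norm_segment_le {n : ℕ} {d : EuclideanSpace ℝ (Fin n)} (hd : ‖d‖ ≤ 2 / 3)
    (v : EuclideanDisk n) (t : I) :
    ‖(1 - t : ℝ) • d + (t : ℝ) • (2 / 3 : ℝ) • (v : EuclideanSpace ℝ (Fin n))‖ ≤ 2 / 3 := by
  have ht0 := t.2.1
  have ht1 : (0 : ℝ) ≤ 1 - t := sub_nonneg.2 t.2.2
  refine (norm_add_le _ _).trans ?_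
  rw [norm_smul, norm_smul, norm_smul, Real.norm_of_nonneg ht0, Real.norm_of_nonneg ht1,
    Real.norm_of_nonneg (by norm_num : (0 : ℝ) ≤ 2 / 3)]
  nlinarith [v.norm_le, mul_le_mul_of_nonneg_left v.norm_le ht0, mul_le_mul_of_nonneg_left hd ht1]

lemma _root_.coe_diskMove {n : ℕ} {d : EuclideanDisk n}
    (hd : ‖(d : EuclideanSpace ℝ (Fin n))‖ ≤ 2 / 3) (v : EuclideanDisk n) (t : I) :
    (diskMove n (d, (v, t)) : EuclideanSpace ℝ (Fin n)) =
      (1 - t : ℝ) • (d : EuclideanSpace ℝ (Fin n)) + (t : ℝ) • (2 / 3 : ℝ) • (v : _) := by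
  have he : (d : EuclideanSpace ℝ (Fin n)) + (t : ℝ) • ((2 / 3 : ℝ) •
      (v : EuclideanSpace ℝ (Fin n)) - d) = (1 - t : ℝ) • (d : EuclideanSpace ℝ (Fin n)) +
        (t : ℝ) • (2 / 3 : ℝ) • (v : EuclideanSpace ℝ (Fin n)) := by
    module
  simp only [diskMove, ContinuousMap.coe_mk]
  rw [min_eq_left (by linarith), mul_one, he]
  exact clip_of_le ((norm_segment_le hd v t).trans (by norm_num))

/-- Moving the points close to the center of an attachment along segments. -/
noncomputable def move : GHom G (B × (EuclideanDisk n × I)) B :=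
  h.cellwise (diskMove n) diskMove_boundary

lemma move_zero (b : B) (v : EuclideanDisk n) : h.move (b, (v, 0)) = b := by
  induction b using h.ind with
  | hl x => simp [move]
  | hr t d => simp [move, diskMove_zero]

lemma coord_move {b : B} (hb : h.radius b ≤ 2 / 3) (v : EuclideanDisk n) (t : I) :
    h.coord (h.move (b, (v, t))) =
      (1 - t : ℝ) • h.coord b + (t : ℝ) • (2 / 3 : ℝ) • (v : EuclideanSpace ℝ (Fin n)) := by
  induction b using h.ind with
  | hl x => rw [h.radius_left] at hb; norm_num at hb
  | hr c d =>
    rw [h.radius_right] at hb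
    rw [move, cellwise_right, h.coord_right_of_le hb, h.coord_right_of_le, coe_diskMove hb]
    rw [coe_diskMove hb]
    exact norm_segment_le hb v t

lemma radius_move_le {b : B} (hb : h.radius b ≤ 2 / 3) (v : EuclideanDisk n) (t : I) :
    h.radius (h.move (b, (v, t))) ≤ 2 / 3 := by
  induction b using h.ind with
  | hl x => rw [h.radius_left] at hb; norm_num at hb
  | hr c d =>
    rw [h.radius_right] at hb
    rw [move, cellwise_right, h.radius_right, coe_diskMove hb]
    exact norm_segment_le hb v t

/-- Lift the straight-line motion in the base by the homotopy lifting property. Scaling by `3 / 2`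
turns the ball of radius `2 / 3` into the unit disk and radius `1 / 3` into norm `1 / 2`. -/
lemma nonempty_diskTransport [ContinuousConstSMul G E] {p : GHom G E B} (hp : p.IsFibration) :
    Nonempty (DiskTransport n (h.shell p (Iic (2 / 3))) (h.shell p {0})
      (h.shell p (Ici (1 / 3)) ⊓ h.shell p (Iic (2 / 3)))) := by
  let P := h.shell p (Iic (2 / 3))
  let U : GHom G ((P × EuclideanDisk n) × I) B := .of (fun x => h.move (p x.1.1, (x.1.2, x.2)))
    (by fun_prop) (by
      intro g x
      refine Eq.trans ?_ (h.move.map_smul g (p x.1.1, (x.1.2, x.2)))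
      exact congrArg (fun b => h.move (b, (x.1.2, x.2))) (p.map_smul g (x.1.1 : E)))
  obtain ⟨L, hL0, hL⟩ := hp (P × EuclideanDisk n)
    (.of (fun x => (x.1 : E)) (by fun_prop) fun _ _ => rfl) U fun x => h.move_zero _ _
  have hP : ∀ e : P, h.radius (p e) ≤ 2 / 3 := fun e => e.2
  have hle : ∀ e : P, ‖(3 / 2 : ℝ) • h.coord (p e)‖ = 3 / 2 * h.radius (p e) := fun e => by
    rw [norm_smul, h.radius_eq_norm_coord (hP e)]
    norm_num
  have hcoe : ∀ e : P, (clip ((3 / 2 : ℝ) • h.coord (p e)) : EuclideanSpace ℝ (Fin n)) =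
      (3 / 2 : ℝ) • h.coord (p e) := fun e => clip_of_le (by rw [hle]; linarith [hP e])
  have hcont := h.continuous_coord
  refine ⟨{
    coord := ⟨fun e => clip ((3 / 2 : ℝ) • h.coord (p e)), by fun_prop⟩
    coord_smul := fun g e => ?_
    move := L.codRestrict P fun x => ?_
    move_zero := fun e v => Subtype.ext (hL0 _)
    coord_move := fun e v t => ?_
    center_le := fun e he => ?_
    outer_le := inf_le_right
    mem_center := fun e => ?_
    mem_outer := fun e => ?_ }⟩
  · simp [h.coord_smul]
  · rw [mem_shell, hL]
    exact h.radius_move_le (hP _) _ _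
  · simp only [ContinuousMap.coe_mk, hcoe]
    simp only [GHom.coe_codRestrict, hL]
    change (3 / 2 : ℝ) • h.coord (h.move (p e, (v, t))) = _
    rw [h.coord_move (hP e)]
    module
  · have he' : h.radius (p e) = 0 := he
    rw [mem_shell, he', mem_Iic]
    norm_num
  · simp only [ContinuousMap.coe_mk, hcoe]
    rw [← norm_eq_zero, hle, mem_shell, mem_singleton_iff]
    simp
  · simp only [ContinuousMap.coe_mk, hcoe]
    rw [hle]
    refine (and_iff_left (hP e)).trans (h.mem_shell.trans ?_)
    rw [mem_Ici]
    constructor <;> intro <;> linarith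

end Move

/-- The total space of a fibration over a space with an attached cell is cellular, if the parts over
the boundary and over the center of the cell are. -/
theorem isCellular_total [ContinuousConstSMul G E] {p : GHom G E B} (hp : p.IsFibration)
    (h1 : IsCellular G (h.shell p {1})) (h0 : IsCellular G (h.shell p {0})) : IsCellular G E := by
  obtain ⟨Λ⟩ := h.nonempty_diskTransport hp
  have hle : h.shell p {1} ≤ h.shell p (Ici (1 / 3)) := by
    intro e he
    have he' : h.radius (p e) = 1 := he
    rw [mem_shell, he', mem_Ici]
    norm_num
  have hN := h1.equiv ⟨_, h.isEquiv_incl_shell hp hle⟩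
  -- The parts of radius at least `1 / 3` and at most `2 / 3` cover `E`. The function `2 - 3 r`,
  -- clamped to `[0, 1]`, interpolates across their overlap.
  have hcover : GEquivalent G E (DoubleCyl
      (GHom.incl (inf_le_left : h.shell p (Ici (1 / 3)) ⊓ h.shell p (Iic (2 / 3)) ≤ _))
      (GHom.incl (inf_le_right : h.shell p (Ici (1 / 3)) ⊓ h.shell p (Iic (2 / 3)) ≤ _))) := by
    refine equivalent_doubleCyl_of_cover (h.isClosed_shell p isClosed_Ici)
      (h.isClosed_shell p isClosed_Iic)
      (τ := fun e => projIcc 0 1 zero_le_one (2 - 3 * h.radius (p e))) ?_ ?_ ?_ ?_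
    · have := h.continuous_radius
      exact continuous_projIcc.comp (by fun_prop)
    · intro g e
      simp [h.radius_smul]
    · intro e he
      rw [mem_shell, mem_Ici]
      by_contra! hlt
      exact he (projIcc_of_right_le _ (by linarith))
    · intro e he
      rw [mem_shell, mem_Iic]
      by_contra! hlt
      exact he (projIcc_of_le_left _ (by linarith))
  -- Up to equivalence `E` is the outer part with `O × Dⁿ` attached, where `O` is the part over the
  -- centers.
  have := IsCellular.of_isAttachment h0 hN
    (DoubleCyl.isAttachment_attach ((GHom.incl inf_le_left).comp Λ.ofSphere))
  exact (this.equiv (Λ.equivalent_attach (GHom.incl inf_le_left)).symm).equiv hcover.symm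

end IsAttachment

end Fibrations

/-! ### Fibers and the induction over the base -/

section FiniteType

variable {G : Type u} [Group G] {E B : Type u} [TopologicalSpace E] [TopologicalSpace B]
  [MulAction G E] [MulAction G B]

lemma GEquivalent.of_bijective_isInducing {X Y : Type u} [TopologicalSpace X] [TopologicalSpace Y]
    [MulAction G X] [MulAction G Y] [ContinuousConstSMul G X] [ContinuousConstSMul G Y]
    (f : GHom G X Y) (hf : Function.Bijective f) (h : IsInducing f) : GEquivalent G X Y :=
  ⟨f, .of_bijective_isClosedMap f hf (h.isClosedMap (by rw [hf.2.range_eq]; exact isClosed_univ))⟩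

/-- The total space over a `G`-subspace. -/
def totalOver (p : E →[G] B) (A : SubMulAction G B) : SubMulAction G E where
  carrier := p ⁻¹' A
  smul_mem' g e he := by
    rw [mem_preimage, map_smul]
    exact A.smul_mem g he

/-- The restriction of a `G`-fibration to a `G`-subspace. -/
def restrictOver {p : E →[G] B} (hp : Continuous p) (A : SubMulAction G B) :
    GHom G (totalOver p A) A :=
  .of (fun e => ⟨p e, e.2⟩) (by fun_prop) fun g e => Subtype.ext (map_smul p g (e : E))

/-- A lift to `E` of a homotopy in `A` automatically stays over `A`. -/
lemma IsGFibration.isFibration {p : E →[G] B} (hp : IsGFibration p) (A : SubMulAction G B) :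
    (restrictOver hp.continuous A).IsFibration := by
  intro X _ _ _ f H hH
  obtain ⟨L, hLg, hL0, hL⟩ := hp.homotopy_lifting X ⟨fun x => (f x : E), by fun_prop⟩
    ⟨fun x => (H x : B), by fun_prop⟩ (fun g x => congrArg Subtype.val (f.map_smul g x))
    (fun g x t => congrArg Subtype.val (H.map_smul g (x, t))) fun x => congrArg Subtype.val (hH x)
  have hmem : ∀ x, L x ∈ totalOver p A := fun x => by
    change p (L x) ∈ A
    rw [hL x.1 x.2]
    exact (H x).2
  exact ⟨.of (fun x => ⟨L x, hmem x⟩) (L.continuous.subtype_mk _) fun g x =>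
    Subtype.ext (hLg g x.1 x.2), fun x => Subtype.ext (hL0 x), fun x => Subtype.ext (hL x.1 x.2)⟩

variable [ContinuousConstSMul G E] [ContinuousConstSMul G B] {p : E →[G] B} (hp : IsGFibration p)
  {A A' : SubMulAction G B} (hA : A ≤ A') {T : Type u} [TopologicalSpace T] [DiscreteTopology T]
  [MulAction G T] {n : ℕ} {χ : GHom G (T × EuclideanDisk n) A'}
  (h : IsAttachment (diskBoundary n) (GHom.incl hA) χ)

instance (p : E →[G] B) (b : B) :
    ContinuousConstSMul (MulAction.stabilizer G b) (gFiber p b) where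
  continuous_const_smul g := by
    have : Continuous fun x : gFiber p b => (g : G) • (x : E) := by fun_prop
    exact this.subtype_mk _

lemma equivalent_boundaryShell :
    GEquivalent G (totalOver p A) (h.shell (restrictOver hp.continuous A') {1}) := by
  let f : GHom G (totalOver p A) (h.shell (restrictOver hp.continuous A') {1}) :=
    ((GHom.val (totalOver p A)).codRestrict (totalOver p A') fun e => hA e.2).codRestrict _ fun e =>
      h.radius_left ⟨p e, e.2⟩
  have hv : IsInducing fun e => ((f e : totalOver p A') : E) := IsInducing.subtypeVal
  refine .of_bijective_isInducing f ⟨fun e e' he => ?_, fun e => ?_⟩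
    (.of_comp f.continuous (continuous_subtype_val.comp continuous_subtype_val) hv)
  · exact Subtype.ext (congrArg (fun x : h.shell (restrictOver hp.continuous A') {1} =>
      ((x : totalOver p A') : E)) he)
  · obtain ⟨a, ha⟩ := h.mem_range_of_radius_eq_one e.2
    have ha' : (a : B) = p e := congrArg Subtype.val ha
    exact ⟨⟨e, show p e ∈ A from ha' ▸ a.2⟩, rfl⟩

lemma center_notMem_diskBoundary (n : ℕ) : (clip 0 : EuclideanDisk n) ∉ diskBoundary n := fun h => by
  have h : ‖(clip 0 : EuclideanDisk n).1‖ = 1 := h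
  rw [clip_of_le (by simp), norm_zero] at h
  exact zero_ne_one h

-- No separation axiom is assumed; closedness of the center comes from the attachment topology and
-- the discreteness of `T`.
include h in
lemma isClosed_center (t : T) : IsClosed {χ (t, clip 0)} := by
  refine h.isClosed_of _ ?_ ?_
  · convert isClosed_empty
    refine eq_empty_of_forall_notMem fun x hx => ?_
    exact center_notMem_diskBoundary n (h.mem_of_eq x t _ hx)
  · convert (isClosed_discrete ({t} : Set T)).prod (isClosed_singleton (x := (clip 0 : EuclideanDisk n)))
    ext ⟨t', d⟩
    simp only [mem_preimage, mem_singleton_iff, mem_prod]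
    constructor
    · intro e
      have hd : d ∉ diskBoundary n := fun hd => by
        obtain ⟨x, hx⟩ := (h.mem_range_iff t' d).2 hd
        exact center_notMem_diskBoundary n (h.mem_of_eq x t _ (hx.trans e))
      exact h.injective _ _ _ _ hd (center_notMem_diskBoundary n) e
    · rintro ⟨rfl, rfl⟩
      rfl

/-- The centers form the orbit of `b`. Over it the total space is the disjoint union of the
translates of the closed fiber `F_b`, and an element carrying a point of `F_b` into `F_b` must fix
`b`. -/
lemma equivalent_centerShell [Finite G] [MulAction.IsPretransitive G T] (t₀ : T) :
    GEquivalent G (Ind (MulAction.stabilizer G (χ (t₀, clip 0) : B))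
      (gFiber p (χ (t₀, clip 0) : B))) (h.shell (restrictOver hp.continuous A') {0}) := by
  let b := χ (t₀, clip 0)
  have hrb : h.radius b = 0 := by
    rw [h.radius_right, clip_of_le (by simp), norm_zero]
  have hpx : ∀ x : gFiber p (b : B), p x = b := fun x => x.2
  let j : gFiber p (b : B) → h.shell (restrictOver hp.continuous A') {0} := fun x =>
    ⟨⟨x, show p x ∈ A' from (hpx x).symm ▸ b.2⟩, by
      have : restrictOver hp.continuous A' ⟨x, show p x ∈ A' from (hpx x).symm ▸ b.2⟩ = b :=
        Subtype.ext (hpx x)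
      rw [h.mem_shell, this, hrb]
      rfl⟩
  have hjc : Continuous j := by fun_prop
  have hj : IsClosedEmbedding j := by
    refine ⟨⟨.of_comp hjc (continuous_subtype_val.comp continuous_subtype_val)
      (IsInducing.subtypeVal : IsInducing fun x : gFiber p (b : B) => (x : E)), fun x y e => ?_⟩, ?_⟩
    · exact Subtype.ext (congrArg (fun z : h.shell (restrictOver hp.continuous A') {0} =>
      ((z : totalOver p A') : E)) e)
    · convert (isClosed_center hA h t₀).preimage
        ((restrictOver hp.continuous A').continuous.comp continuous_subtype_val)
      ext z
      constructor
      · rintro ⟨x, rfl⟩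
        exact Subtype.ext (hpx x)
      · intro hz
        exact ⟨⟨z, congrArg Subtype.val hz⟩, rfl⟩
  refine equivalent_ind hj (fun _ _ => rfl) (fun g x x' e => ?_) fun z => ?_
  · have e' : g • (x : E) = x' := congrArg (fun z : h.shell (restrictOver hp.continuous A') {0} =>
      ((z : totalOver p A') : E)) e
    have := congrArg p e'
    rw [map_smul, hpx, hpx] at this
    exact this
  · have hz : h.radius (restrictOver hp.continuous A' z) = 0 := z.2
    obtain ⟨t, d, e⟩ := h.exists_of_radius_ne_one (hz.trans_ne zero_ne_one)
    rw [← e, h.radius_right, norm_eq_zero] at hz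
    obtain rfl : d = clip 0 := Subtype.ext (by rw [hz, clip_of_le (by simp)])
    obtain ⟨g, rfl⟩ := MulAction.exists_smul_eq G t₀ t
    have e' : p (z : totalOver p A') = g • (b : B) := by
      have := congrArg Subtype.val (χ.map_smul g (t₀, clip 0))
      exact (congrArg Subtype.val e).symm.trans this
    refine ⟨g, ⟨g⁻¹ • ((z : totalOver p A') : E), ?_⟩, ?_⟩
    · change p _ = _
      rw [map_smul, e', inv_smul_smul]
    · exact Subtype.ext (Subtype.ext (smul_inv_smul g _).symm)

/-- A space which is equivalent to a finite `G`-CW-complex is cellular. -/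
lemma GHomotopyEquivalentToFiniteGCWComplex.isCellular
    (h : GHomotopyEquivalentToFiniteGCWComplex G E) : IsCellular G E := by
  obtain ⟨Y, _, _, _, hY, e⟩ := h
  exact hY.isCellular.equiv (GEquivalent.iff_gHomotopyEquivalent.2 e).symm

end FiniteType

theorem proposition4p4 {G : Type u} [Group G] [Finite G]
    {E B : Type u} [TopologicalSpace E] [TopologicalSpace B]
    [MulAction G E] [MulAction G B] [ContinuousConstSMul G E] [ContinuousConstSMul G B]
    (hB : IsFiniteGCWComplex G B)
    (p : E →[G] B) (hp : IsGFibration p)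
    (F : isotropySubgroups G B → Type u) [∀ H, TopologicalSpace (F H)]
    [∀ H : isotropySubgroups G B, MulAction H.1 (F H)] [∀ H : isotropySubgroups G B, ContinuousConstSMul H.1 (F H)]
    (hF : HasFiberType p F)
    (hfin : ∀ H : isotropySubgroups G B,
      GHomotopyEquivalentToFiniteGCWComplex H.1 (F H)) :
    GHomotopyEquivalentToFiniteGCWComplex G E := by
  have hfib : ∀ b : B, IsCellular (MulAction.stabilizer G b) (gFiber p b) := fun b =>
    (hfin (isotropyAt G b)).isCellular.equiv (GEquivalent.iff_gHomotopyEquivalent.2 (hF b)).symm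
  obtain ⟨K, hK⟩ := hB
  have htop : IsCellular G (totalOver p ⊤) := by
    refine hK.induction 0 (motive := fun A => IsCellular G (totalOver p A)) ?_ ?_
    · have : IsEmpty (totalOver p (K.stage 0 ∅)) := by
        refine ⟨fun x => ?_⟩
        have hx : p x ∈ (K.stage 0 ∅ : Set B) := x.2
        simp [K.stage_empty, K.skeletonLT_zero] at hx
      exact .empty _
    · intro n _ A A' hA _ _ T _ _ _ _ _ χ h ih
      -- The boundary part is the total space over `A`, cellular by induction; the central part is
      -- induced from the fiber over one center.
      exact h.isCellular_total (hp.isFibration A') (ih.equiv (equivalent_boundaryShell hp hA h))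
        ((hfib _).ind.equiv (equivalent_centerShell hp hA h (Classical.arbitrary T)))
  have hE : IsCellular G E := htop.equiv (equivalent_of_forall_mem fun _ => mem_univ _)
  obtain ⟨Y, _, _, _, hY, e⟩ := hE.exists_equivalent
  exact ⟨Y, _, _, inferInstance, hY, GEquivalent.iff_gHomotopyEquivalent.1 e⟩
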